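/- All graphs are finite, simple and undirected. Let $G$ be a graph on $n\ge 1$ vertices with maximum degree $\delta$ and two given terminal vertices $s,t$. An $s$-$t$ path is a simple path from $s$ to $t$. A set $T\subseteq V(G)$ is a \emph{tracking set} if for any two distinct $s$-$t$ paths $P_1,P_2$, the sequence of vertices of $T$ encountered along $P_1$ differs from the sequence encountered along $P_2$; it is \emph{$\rho$-approximate} if moreover $|T|\le\rho\,|T'|$ for every tracking set $T'$. A \emph{feedback vertex set} (FVS) of a graph is a set of its vertices whose removal leaves an acyclic graph; it is $2$-approximate if its size is at most twice the minimum size of an FVS of that graph. The \emph{reduced graph} $G'$ is obtained from $G$ by deleting all vertices and edges that lie on no $s$-$t$ path. (1) Every tracking set $T\subseteq V(G')$ is an FVS of $G'$. For every $2$-approximate FVS $S$ of $G'$, the set $S\cup N_{G'}(S)$, consisting of $S$ and all neighbours in $G'$ of the vertices of $S$, is a $2(\delta+1)$-approximate tracking set for $G$. (2) There is an algorithm (a single program for a unit-cost random access machine with words of $O(\log n)$ bits) that, given $n$, $s$, $t$ and the adjacency matrix of $G$, halts after $O(n^2)$ steps, the implied constant being absolute (in particular independent of $\delta$), and outputs a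 $2(\delta+1)$-approximate tracking set for $G$; its output is of the form $S\cup N_{G'}(S)$ for some $2$-approximate FVS $S$ of $G'$. -/

import Mathlib

/-! ### A random access machine with unit-cost instructions and logarithmic word length -/

namespace Ram

/-- Arithmetic and comparison instructions; a comparison returns `1` for true and `0` for false,
`sub` is truncated subtraction and `div` is division with rounding down. -/
inductive Op
  | add
  | sub
  | mul
  | div
  | lt
  | eq

/-- The value computed by an arithmetic instruction. -/
def Op.apply : Op → ℕ → ℕ → ℕ
  | .add, x, y => x + y
  | .sub, x, y => x - y
  | .mul, x, y => x * y
  | .div, x, y => x / y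
  | .lt, x, y => if x < y then 1 else 0
  | .eq, x, y => if x = y then 1 else 0

/-- A configuration of the memory: registers, and banks of indirectly addressed cells. A program
names its registers and its banks by literals, so it uses only a constant number of them. -/
@[ext]
structure State where
  reg : ℕ → ℕ
  cell : ℕ → ℕ → ℕ

/-- Expressions: literals, registers, reading the cell of a bank at a computed address, and
arithmetic. -/
inductive Expr
  | lit (k : ℕ)
  | reg (r : ℕ)
  | read (bank : ℕ) (addr : Expr)
  | op (o : Op) (e₁ e₂ : Expr)

namespace Expr

/-- The value of an expression. -/
def eval (σ : State) : Expr → ℕ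
  | lit k => k
  | reg r => σ.reg r
  | read b a => σ.cell b (a.eval σ)
  | op o e₁ e₂ => o.apply (e₁.eval σ) (e₂.eval σ)

/-- Every value that occurs in the evaluation (addresses and intermediate results included) is
less than `B`, that is, fits into a machine word. -/
def Fits (B : ℕ) (σ : State) : Expr → Prop
  | lit k => k < B
  | reg r => σ.reg r < B
  | read b a => a.Fits B σ ∧ σ.cell b (a.eval σ) < B
  | op o e₁ e₂ => e₁.Fits B σ ∧ e₂.Fits B σ ∧ o.apply (e₁.eval σ) (e₂.eval σ) < B

/-- The number of elementary operations needed to evaluate an expression. -/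
def cost : Expr → ℕ
  | lit _ => 1
  | reg _ => 1
  | read _ a => a.cost + 1
  | op _ e₁ e₂ => e₁.cost + e₂.cost + 1

end Expr

/-- Programs of the machine. A test succeeds when its value is nonzero. -/
inductive Prog
  | skip
  | set (r : ℕ) (e : Expr)
  | write (bank : ℕ) (addr e : Expr)
  | seq (p q : Prog)
  | ite (e : Expr) (p q : Prog)
  | loop (e : Expr) (p : Prog)

/-- `Exec B p σ m τ`: started in `σ`, the program `p` halts in `τ` after exactly `m` elementary
steps, and all the values it handles are less than `B`. The machine gets stuck (has no halting
execution) when a value does not fit. -/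
inductive Exec (B : ℕ) : Prog → State → ℕ → State → Prop
  | skip (σ : State) : Exec B .skip σ 1 σ
  | set (r : ℕ) (e : Expr) (σ : State) (h : e.Fits B σ) :
      Exec B (.set r e) σ (e.cost + 1)
        { σ with reg := Function.update σ.reg r (e.eval σ) }
  | write (b : ℕ) (a e : Expr) (σ : State) (ha : a.Fits B σ) (he : e.Fits B σ) :
      Exec B (.write b a e) σ (a.cost + e.cost + 1)
        { σ with
          cell := Function.update σ.cell b
            (Function.update (σ.cell b) (a.eval σ) (e.eval σ)) }
  | seq {p q : Prog} {σ τ υ : State} {m l : ℕ} (hp : Exec B p σ m τ) (hq : Exec B q τ l υ) :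
      Exec B (.seq p q) σ (m + l) υ
  | ite_true {e : Expr} {p q : Prog} {σ τ : State} {m : ℕ} (hf : e.Fits B σ)
      (he : e.eval σ ≠ 0) (hp : Exec B p σ m τ) :
      Exec B (.ite e p q) σ (e.cost + 1 + m) τ
  | ite_false {e : Expr} {p q : Prog} {σ τ : State} {m : ℕ} (hf : e.Fits B σ)
      (he : e.eval σ = 0) (hq : Exec B q σ m τ) :
      Exec B (.ite e p q) σ (e.cost + 1 + m) τ
  | loop_stop {e : Expr} {p : Prog} {σ : State} (hf : e.Fits B σ) (he : e.eval σ = 0) :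
      Exec B (.loop e p) σ (e.cost + 1) σ
  | loop_step {e : Expr} {p : Prog} {σ τ υ : State} {m l : ℕ} (hf : e.Fits B σ)
      (he : e.eval σ ≠ 0) (hp : Exec B p σ m τ) (hl : Exec B (.loop e p) τ l υ) :
      Exec B (.loop e p) σ (e.cost + 1 + m + l) υ

end Ram

/-! ### Tracking sets and feedback vertex sets -/

namespace Tracking

section Graphs

variable {V : Type*} (G : SimpleGraph V) (s t : V)

/-- The sequence of trackers encountered along a walk. -/
def trackerSeq [DecidableEq V] {G : SimpleGraph V} {s t : V} (T : Finset V) (p : G.Walk s t) : List V :=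
  p.support.filter (fun v => v ∈ T)

/-- `T` is a tracking set: distinct simple paths from `s` to `t` have distinct sequences of
trackers. -/
def IsTrackingSet [DecidableEq V] (T : Finset V) : Prop :=
  ∀ p q : G.Path s t, p ≠ q → trackerSeq T p.1 ≠ trackerSeq T q.1

/-- `T` is a tracking set whose size is at most `ratio` times the size of every (hence of a
smallest) tracking set. -/
def IsApproxTrackingSet [DecidableEq V] (ratio : ℕ) (T : Finset V) : Prop :=
  IsTrackingSet G s t T ∧ ∀ T', IsTrackingSet G s t T' → T.card ≤ ratio * T'.card

/-- The reduced graph: all vertices and edges that participate in no simple path from `s` to `t`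
are deleted. -/
def reducedGraph : G.Subgraph where
  verts := {v | ∃ p : G.Path s t, v ∈ p.1.support}
  Adj a b := ∃ p : G.Path s t, s(a, b) ∈ p.1.edges
  adj_sub := by
    rintro a b ⟨p, hp⟩
    exact p.1.adj_of_mem_edges hp
  edge_vert := by
    rintro a b ⟨p, hp⟩
    exact ⟨p, p.1.fst_mem_support_of_mem_edges hp⟩
  symm := ⟨by
    rintro a b ⟨p, hp⟩
    exact ⟨p, by rwa [Sym2.eq_swap]⟩⟩

variable {G}

/-- `S` is a feedback vertex set of the graph `H`: a set of vertices of `H` whose removal leaves an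
acyclic graph. -/
def IsFVS (H : G.Subgraph) (S : Finset V) : Prop :=
  (S : Set V) ⊆ H.verts ∧ (H.deleteVerts (S : Set V)).coe.IsAcyclic

/-- `S` is a feedback vertex set of `H` whose size is at most twice that of every (hence of a
smallest) feedback vertex set of `H`. -/
def IsTwoApproxFVS (H : G.Subgraph) (S : Finset V) : Prop :=
  IsFVS H S ∧ ∀ S', IsFVS H S' → S.card ≤ 2 * S'.card

open Classical in
/-- The set `S` together with all neighbours in `H` of its vertices. -/
noncomputable def withNeighbors [Fintype V] [DecidableEq V] (H : G.Subgraph) (S : Finset V) : Finset V :=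
  S ∪ Finset.univ.filter (fun x => ∃ v ∈ S, H.Adj v x)

end Graphs

/-- The memory holding the input `(G, s, t)`: registers `0`, `1`, `2` contain `n`, `s`, `t`, bank
`0` contains the adjacency matrix of `G` row by row, and everything else is `0`. -/
def inputState {n : ℕ} (G : SimpleGraph (Fin n)) [DecidableRel G.Adj] (s t : Fin n) :
    Ram.State where
  reg r := if r = 0 then n else if r = 1 then s else if r = 2 then t else 0
  cell b a :=
    if b = 0 ∧ ∃ i j : Fin n, a = i * n + j ∧ G.Adj i j then 1 else 0

/-- The set of vertices whose characteristic vector is in bank `1`. -/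
def outputSet (n : ℕ) (σ : Ram.State) : Finset (Fin n) :=
  Finset.univ.filter (fun v => σ.cell 1 v ≠ 0)

end Tracking

/-!
Why the theorem is true.

*Tracking sets are feedback vertex sets.* A cycle in the reduced graph contains an edge of an
`s`-`t` path. The part of some path between its first and its last vertex on the cycle can be
replaced by either of the two arcs, so a cycle without trackers gives two paths with the same
sequence of trackers (`IsTrackingSet.isFVS`). A minimum tracking set may be shrunk to the vertices
of the reduced graph, hence it is at least as large as a minimum feedback vertex set. Conversely,
if all neighbours of a feedback vertex set `S` are trackers besides `S` itself, then two paths with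
the same sequence of trackers leave and enter `S` in the same way, and between consecutive trackers
they run in a forest, so they agree (`IsFVS.isTrackingSet_withNeighbors`). Each vertex of `S` brings
in at most `δ` neighbours, which gives the factor `2 (δ + 1)`.

*The reduced graph in quadratic time.* If the edge `s t` is imagined to be present, the reduced
graph consists of the edges inside the block of this edge. Depth-first search starts with the tree
edge from `s` to `t`. A visited vertex `v` other than `s` and `t` is in the block exactly if its
parent is and the lowpoint of `v` is less than the number of its parent
(`DfsTree.reducedGraph_adj_iff`). That these vertices lie on `s`-`t` paths is shown with an
`s`-`t` numbering; that the others do not, by the separating vertex that the lowpoints exhibit.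

*A 2-approximate feedback vertex set in quadratic time.* The local ratio method subtracts the
largest possible multiple of the degrees from the weights, as long as all degrees are at least two,
and eliminates a vertex whose weight becomes zero; vertices of degree at most one are eliminated for
free. Going through the vertices in the reverse order, one keeps every vertex that closes no cycle
with those already kept; the vertices that are not kept form the feedback vertex set. With real
weights each of the subtractions costs a factor of at most two. Words hold integers only, so the
start weight is `n ^ 2 + 1` for each vertex, quotients are rounded down, and each eliminated vertex
keeps a remainder of at most `n`. The total error of at most `n ^ 2` is less than the weight of
one vertex and disappears because the cardinalities are integers
(`Elim.card_compl_greedyForest_le`). The elimination scans all vertices once for each vertex, and the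
components of the growing forest are maintained as labels, so that both take `O(n ^ 2)` steps.

*The program.* The programs are verified with a Hoare logic for total correctness with time bounds
(`Ram.Runs`), in which programs without loops are treated by their weakest preconditions and loops by
invariants. `program_runs` combines the parts.
-/

namespace Tracking

open SimpleGraph

/-! ### Restricting a graph to a set of vertices -/

/-- The graph on the whole vertex type whose edges are the edges of `H` with both ends in `A`.
Vertices outside `A` stay as isolated vertices, so that no subtypes are needed. -/
def within {V : Type*} (H : SimpleGraph V) (A : Set V) : SimpleGraph V where
  Adj a b := H.Adj a b ∧ a ∈ A ∧ b ∈ A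
  symm := ⟨fun _ _ h => ⟨h.1.symm, h.2.2, h.2.1⟩⟩
  loopless := ⟨fun _ h => h.1.ne rfl⟩

section Within

variable {V : Type*} {H : SimpleGraph V}

@[simp] theorem within_adj {A : Set V} {a b : V} :
    (within H A).Adj a b ↔ H.Adj a b ∧ a ∈ A ∧ b ∈ A := Iff.rfl

theorem within_le (A : Set V) : within H A ≤ H := fun _ _ h => h.1

theorem within_mono {A B : Set V} (h : A ⊆ B) : within H A ≤ within H B :=
  fun _ _ hab => ⟨hab.1, h hab.2.1, h hab.2.2⟩

theorem isAcyclic_within_mono {A B : Set V} (h : A ⊆ B) (hB : (within H B).IsAcyclic) :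
    (within H A).IsAcyclic :=
  IsAcyclic.anti (within_mono h) hB

theorem mem_of_reachable_within {A : Set V} {a b : V} (h : (within H A).Reachable a b)
    (ha : a ∈ A) : b ∈ A := by
  rw [reachable_iff_reflTransGen] at h
  induction h with
  | refl => exact ha
  | tail _ hbc _ => exact hbc.2.2

theorem exists_isPath_within {A : Set V} {a b : V} (p : H.Walk a b) (hp : p.IsPath)
    (hA : ∀ x ∈ p.support, x ∈ A) :
    ∃ q : (within H A).Walk a b, q.IsPath ∧ q.support = p.support := by
  have h : ∀ e ∈ p.edges, e ∈ (within H A).edgeSet := by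
    intro e he
    induction e with
    | h x y =>
      exact ⟨p.adj_of_mem_edges he, hA _ (p.fst_mem_support_of_mem_edges he),
        hA _ (p.snd_mem_support_of_mem_edges he)⟩
  exact ⟨p.transfer _ h, hp.transfer h, p.support_transfer h⟩

end Within

/-- Feedback vertex sets of a subgraph in terms of `within`. -/
theorem isFVS_iff {V : Type*} {G : SimpleGraph V} (H : G.Subgraph) (S : Finset V) :
    IsFVS H S ↔ (S : Set V) ⊆ H.verts ∧ (within H.spanningCoe (S : Set V)ᶜ).IsAcyclic := by
  unfold IsFVS
  refine and_congr_right fun _ => ⟨fun h => ?_, fun h => ?_⟩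
  · rw [isAcyclic_iff_forall_adj_isBridge] at h ⊢
    intro a b hab hr
    have key : ∀ x (hx : x ∈ (H.deleteVerts (S : Set V)).verts) y,
        Relation.ReflTransGen
          ((within H.spanningCoe (S : Set V)ᶜ).deleteEdges {s(a, b)}).Adj x y →
        ∃ hy : y ∈ (H.deleteVerts (S : Set V)).verts, ∀ ha hb,
          ((H.deleteVerts (S : Set V)).coe.deleteEdges
            {s((⟨a, ha⟩ : (H.deleteVerts (S : Set V)).verts), ⟨b, hb⟩)}).Reachable ⟨x, hx⟩ ⟨y, hy⟩ := by
      intro x hx y hxy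
      induction hxy with
      | refl => exact ⟨hx, fun _ _ => Reachable.rfl⟩
      | @tail y z _ hyz ih =>
        obtain ⟨hy, ih⟩ := ih
        rw [deleteEdges_adj] at hyz
        have hz : z ∈ (H.deleteVerts (S : Set V)).verts :=
          ⟨hyz.1.1.snd_mem, hyz.1.2.2⟩
        refine ⟨hz, fun ha hb => (ih ha hb).trans (Adj.reachable ?_)⟩
        rw [deleteEdges_adj]
        refine ⟨?_, ?_⟩
        · simp only [Subgraph.coe_adj, Subgraph.deleteVerts_adj]
          exact ⟨hy.1, hy.2, hz.1, hz.2, hyz.1.1⟩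
        · have h2 := hyz.2
          simp only [Set.mem_singleton_iff, Sym2.eq_iff, Subtype.mk.injEq] at h2 ⊢
          exact h2
    have ha : a ∈ (H.deleteVerts (S : Set V)).verts := ⟨hab.1.fst_mem, hab.2.1⟩
    rw [reachable_iff_reflTransGen] at hr
    obtain ⟨hb, hr⟩ := key a ha b hr
    refine h (v := ⟨a, ha⟩) (w := ⟨b, hb⟩) ?_ (hr ha hb)
    simp only [Subgraph.coe_adj, Subgraph.deleteVerts_adj]
    exact ⟨ha.1, ha.2, hb.1, hb.2, hab.1⟩
  · refine IsAcyclic.comap (G' := within H.spanningCoe (S : Set V)ᶜ)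
      ⟨fun x => x.1, ?_⟩ Subtype.val_injective h
    intro x y hxy
    simp only [Subgraph.coe_adj, Subgraph.deleteVerts_adj] at hxy
    exact ⟨hxy.2.2.2.2, hxy.2.1, hxy.2.2.2.1⟩

/-! ### Tracking sets are feedback vertex sets of the reduced graph -/

section Walks

variable {V : Type*} {G : SimpleGraph V}

/-- A walk that meets `C` splits at the first vertex of `C`. -/
theorem exists_first_hit {u v : V} (p : G.Walk u v) (C : Set V) (h : ∃ x ∈ p.support, x ∈ C) :
    ∃ w ∈ C, ∃ (q : G.Walk u w) (r : G.Walk w v), p = q.append r ∧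
      ∀ x ∈ q.support, x ∈ C → x = w := by
  induction p with
  | nil =>
    obtain ⟨x, hx, hxC⟩ := h
    simp only [Walk.support_nil, List.mem_singleton] at hx
    subst hx
    exact ⟨x, hxC, Walk.nil, Walk.nil, rfl, by simp⟩
  | @cons a b c hab p ih =>
    by_cases ha : a ∈ C
    · exact ⟨a, ha, Walk.nil, Walk.cons hab p, rfl, by simp⟩
    · obtain ⟨x, hx, hxC⟩ := h
      have hx' : x ∈ p.support := by
        rw [Walk.support_cons, List.mem_cons] at hx
        rcases hx with rfl | hx
        · exact absurd hxC ha
        · exact hx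
      obtain ⟨w, hw, q, r, rfl, hq⟩ := ih ⟨x, hx', hxC⟩
      refine ⟨w, hw, Walk.cons hab q, r, rfl, ?_⟩
      intro y hy hyC
      rw [Walk.support_cons, List.mem_cons] at hy
      rcases hy with rfl | hy
      · exact absurd hyC ha
      · exact hq y hy hyC

/-- Two arcs of a cycle between distinct vertices: two paths that share no edge and stay on the
cycle. -/
theorem exists_two_arcs [DecidableEq V] {x : V} {c : G.Walk x x} (hc : c.IsCycle) {u v : V}
    (hu : u ∈ c.support) (hv : v ∈ c.support) :
    ∃ p q : G.Walk u v, p.IsPath ∧ q.IsPath ∧ p.edges.Disjoint q.edges ∧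
      (∀ y ∈ p.support, y ∈ c.support) ∧ ∀ y ∈ q.support, y ∈ c.support := by
  have hc' := hc.rotate hu
  have hv' : v ∈ (c.rotate u hu).support := (Walk.mem_support_rotate_iff c u hu).2 hv
  have hsub : ∀ y ∈ (c.rotate u hu).support, y ∈ c.support := fun y hy =>
    (Walk.mem_support_rotate_iff c u hu).1 hy
  by_cases huv : u = v
  · subst huv
    exact ⟨Walk.nil, Walk.nil, by simp, by simp, by simp, by simpa using hu, by simpa using hu⟩
  refine ⟨(c.rotate u hu).takeUntil v hv', ((c.rotate u hu).dropUntil v hv').reverse,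
    hc'.isPath_takeUntil hv', ?_, ?_, ?_, ?_⟩
  · have h2 := hc'
    rw [← Walk.take_spec (c.rotate u hu) hv'] at h2
    exact (h2.isPath_of_append_right (Walk.not_nil_of_ne huv)).reverse
  · intro e he he'
    rw [Walk.edges_reverse, List.mem_reverse] at he'
    exact (hc'.isTrail.disjoint_edges_takeUntil_dropUntil hv') he he'
  · exact fun y hy => hsub y (Walk.support_takeUntil_subset_support _ hv' hy)
  · intro y hy
    rw [Walk.support_reverse, List.mem_reverse] at hy
    exact hsub y (Walk.support_dropUntil_subset_support _ hv' hy)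

/-- A detour of a path along a path that meets its two outer parts only at the ends. -/
theorem isPath_append_append {s u v t : V} {p : G.Walk s u} {a : G.Walk u v} {q : G.Walk v t}
    (hp : p.IsPath) (ha : a.IsPath) (hq : q.IsPath)
    (hpq : ∀ x ∈ p.support, x ∉ q.support)
    (hpa : ∀ x ∈ p.support, x ∈ a.support → x = u)
    (hqa : ∀ x ∈ q.support, x ∈ a.support → x = v) :
    (p.append (a.append q)).IsPath := by
  rw [Walk.isPath_def] at *
  rw [Walk.support_append, Walk.support_append]
  have ha' : a.support = u :: a.support.tail := (Walk.cons_tail_support a).symm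
  have hq' : q.support = v :: q.support.tail := (Walk.cons_tail_support q).symm
  have hap : a.support.tail.Nodup := ha.tail
  rw [ha', List.cons_append, List.tail_cons]
  rw [ha'] at ha
  rw [hq'] at hq
  refine List.nodup_append'.2 ⟨hp, List.nodup_append'.2 ⟨hap, (List.nodup_cons.1 hq).2, ?_⟩, ?_⟩
  · intro x hx hxq
    have hxv := hqa x (by rw [hq']; exact List.mem_cons_of_mem _ hxq)
      (by rw [ha']; exact List.mem_cons_of_mem _ hx)
    subst hxv
    exact (List.nodup_cons.1 hq).1 hxq
  · intro x hxp hx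
    rcases List.mem_append.1 hx with hx | hx
    · have := hpa x hxp (by rw [ha']; exact List.mem_cons_of_mem _ hx)
      subst this
      exact (List.nodup_cons.1 ha).1 hx
    · exact hpq x hxp (by rw [hq']; exact List.mem_cons_of_mem _ hx)

/-- If an edge of a cycle lies on a path from `s` to `t`, then two different paths from `s` to `t`
encounter the same vertices outside the cycle: they take the two arcs between the first and the
last vertex of the cycle on the given path. -/
theorem exists_paths_of_isCycle [DecidableEq V] {s t x a b : V} {c : G.Walk x x} (hc : c.IsCycle)
    (P : G.Walk s t) (hP : P.IsPath) (hab : a ≠ b) (ha : a ∈ c.support) (hb : b ∈ c.support)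
    (haP : a ∈ P.support) (hbP : b ∈ P.support) (T : Finset V)
    (hT : ∀ y ∈ c.support, y ∉ T) :
    ∃ W₁ W₂ : G.Path s t, W₁ ≠ W₂ ∧ trackerSeq T W₁.1 = trackerSeq T W₂.1 := by
  obtain ⟨u, huc, p, r, rfl, hp⟩ := exists_first_hit P {y | y ∈ c.support} ⟨a, haP, ha⟩
  obtain ⟨v, hvc, q', m, hrq, hq'⟩ := exists_first_hit r.reverse {y | y ∈ c.support}
    ⟨u, by simp, huc⟩
  obtain ⟨q, rfl⟩ : ∃ q : G.Walk v t, q' = q.reverse := ⟨q'.reverse, by simp⟩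
  obtain ⟨m, rfl⟩ : ∃ m' : G.Walk u v, m = m'.reverse := ⟨m.reverse, by simp⟩
  have hr : r = m.append q := by
    have := congrArg Walk.reverse hrq
    simpa [Walk.reverse_append] using this
  subst hr
  have hq : ∀ y ∈ q.support, y ∈ c.support → y = v := fun y hy hyc =>
    hq' y (by simpa using hy) hyc
  have hqP : q.IsPath := hP.of_append_right.of_append_right
  have hpP : p.IsPath := hP.of_append_left
  have hnd := hP
  rw [Walk.isPath_def, Walk.support_append] at hnd
  have hdis := (List.nodup_append'.1 hnd).2.2
  have huv : u ≠ v := by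
    rintro rfl
    -- the middle part is then a closed path, hence trivial, and the cycle is met only once
    have hm : m = Walk.nil := (Walk.isPath_iff_nil.1 hP.of_append_right.of_append_left).eq_nil
    subst hm
    have : ∀ y ∈ (p.append (Walk.nil.append q)).support, y ∈ c.support → y = u := by
      intro y hy hyc
      rw [Walk.mem_support_append_iff] at hy
      rcases hy with hy | hy
      · exact hp y hy hyc
      · exact hq y (by simpa using hy) hyc
    exact hab ((this a haP ha).trans (this b hbP hb).symm)
  have hpq : ∀ y ∈ p.support, y ∉ q.support := by
    intro y hy hyq
    by_cases hyv : y = v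
    · subst hyv
      exact huv.symm (hp y hy hvc)
    · refine hdis hy ?_
      have hmem : y ∈ (m.append q).support := by
        rw [Walk.mem_support_append_iff]; exact Or.inr hyq
      rw [← Walk.cons_tail_support, List.mem_cons] at hmem
      rcases hmem with rfl | hmem
      · exact absurd (hq _ hyq huc) hyv
      · exact hmem
  obtain ⟨a₁, a₂, h₁, h₂, hd, hs₁, hs₂⟩ := exists_two_arcs hc huc hvc
  have hW : ∀ w : G.Walk u v, w.IsPath → (∀ y ∈ w.support, y ∈ c.support) →
      (p.append (w.append q)).IsPath := fun w hw hws =>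
    isPath_append_append hpP hw hqP hpq (fun y hy hyw => hp y hy (hws y hyw))
      (fun y hy hyw => hq y hy (hws y hyw))
  refine ⟨⟨_, hW a₁ h₁ hs₁⟩, ⟨_, hW a₂ h₂ hs₂⟩, ?_, ?_⟩
  · intro h
    have h3 := congrArg (fun w : G.Path s t => w.1.edges) h
    simp only [Walk.edges_append] at h3
    have h4 : a₁.edges = a₂.edges :=
      List.append_cancel_right (List.append_cancel_left h3)
    have h5 : a₁.edges = [] := by
      rw [List.eq_nil_iff_forall_not_mem]
      intro e he
      exact hd he (h4 ▸ he)
    have h6 : a₁.length = 0 := by rw [← Walk.length_edges, h5]; rfl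
    exact huv (Walk.eq_of_length_eq_zero h6)
  · have hnil : ∀ w : G.Walk u v, (∀ y ∈ w.support, y ∈ c.support) →
        w.support.tail.filter (fun y => y ∈ T) = [] := by
      intro w hws
      rw [List.filter_eq_nil_iff]
      intro y hy
      simpa using hT y (hws y (List.mem_of_mem_tail hy))
    have hseq : ∀ w : G.Walk u v, (∀ y ∈ w.support, y ∈ c.support) →
        trackerSeq T (p.append (w.append q)) =
          p.support.filter (fun y => y ∈ T) ++ q.support.tail.filter (fun y => y ∈ T) := by
      intro w hws
      unfold trackerSeq
      rw [Walk.support_append, Walk.support_append, ← Walk.cons_tail_support w, List.cons_append,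
        List.tail_cons, List.filter_append, List.filter_append, hnil w hws, List.nil_append]
    exact (hseq a₁ hs₁).trans (hseq a₂ hs₂).symm

end Walks

theorem IsTrackingSet.isFVS {V : Type*} [DecidableEq V] {G : SimpleGraph V} {s t : V}
    {T : Finset V} (hT : IsTrackingSet G s t T) (hv : (T : Set V) ⊆ (reducedGraph G s t).verts) :
    IsFVS (reducedGraph G s t) T := by
  rw [isFVS_iff]
  refine ⟨hv, fun x c hc => ?_⟩
  have hK : within (reducedGraph G s t).spanningCoe (T : Set V)ᶜ ≤ G :=
    (within_le _).trans (Subgraph.spanningCoe_le _)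
  have hle : ∀ y ∈ (c.mapLe hK).support, y ∉ T := by
    intro y hy
    rw [Walk.support_mapLe_eq_support] at hy
    obtain ⟨z, hz⟩ := adj_of_mem_walk_support c hc.not_nil hy
    exact hz.2.2.1
  have hc' : (c.mapLe hK).IsCycle := hc.mapLe hK
  cases c with
  | nil => exact hc.not_nil Walk.Nil.nil
  | @cons _ y _ hxy c =>
    obtain ⟨⟨P, hP⟩, hxP⟩ := hxy.1
    obtain ⟨W₁, W₂, hne, heq⟩ := exists_paths_of_isCycle hc' P hP hxy.ne (by simp)
      (by rw [Walk.support_mapLe_eq_support]; simp)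
      (P.fst_mem_support_of_mem_edges hxP) (P.snd_mem_support_of_mem_edges hxP) T hle
    exact hT W₁ W₂ hne heq

/-! ### A feedback vertex set with its neighbours is a tracking set -/

/-- A path splits at its first tracker, or at its end if it has none. -/
theorem exists_first_tracker {V : Type*} [DecidableEq V] {H : SimpleGraph V} (T : Finset V)
    {x t : V} (p : H.Walk x t) :
    ∃ (b : V) (q : H.Walk x b) (r : H.Walk b t), p = q.append r ∧
      (∀ z ∈ q.support, z ∈ T → z = b) ∧
      ((b ∈ T ∧ (trackerSeq T p).head? = some b) ∨
        (b ∉ T ∧ b = t ∧ (trackerSeq T p).head? = none)) := by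
  induction p with
  | @nil x =>
    refine ⟨x, Walk.nil, Walk.nil, rfl, by simp, ?_⟩
    by_cases hx : x ∈ T
    · exact Or.inl ⟨hx, by simp [trackerSeq, hx]⟩
    · exact Or.inr ⟨hx, rfl, by simp [trackerSeq, hx]⟩
  | @cons x y t hxy p ih =>
    by_cases hx : x ∈ T
    · exact ⟨x, Walk.nil, Walk.cons hxy p, rfl, by simp,
        Or.inl ⟨hx, by simp [trackerSeq, hx]⟩⟩
    · obtain ⟨b, q, r, rfl, hq, hb⟩ := ih
      refine ⟨b, Walk.cons hxy q, r, rfl, ?_, ?_⟩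
      · intro z hz hzT
        rw [Walk.support_cons, List.mem_cons] at hz
        rcases hz with rfl | hz
        · exact absurd hzT hx
        · exact hq z hz hzT
      · simpa [trackerSeq, List.filter_cons, hx] using hb

theorem eq_or_exists_adj_end {V : Type*} {H : SimpleGraph V} {x b : V} (p : H.Walk x b) :
    x = b ∨ ∃ z ∈ p.support, H.Adj z b := by
  induction p with
  | nil => exact Or.inl rfl
  | @cons x y b hxy p ih =>
    rcases ih with rfl | ⟨z, hz, hzb⟩
    · exact Or.inr ⟨x, by simp, hxy⟩
    · exact Or.inr ⟨z, by simp [hz], hzb⟩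

/-- Next to a vertex of `S` two paths with the same trackers cannot separate, because the
neighbours of `S` are trackers; and away from `S` the graph is a forest. -/
theorem support_eq_of_trackerSeq_eq {V : Type*} [DecidableEq V] {H : SimpleGraph V}
    {S T : Finset V} (hac : (within H (S : Set V)ᶜ).IsAcyclic) (hST : S ⊆ T)
    (hN : ∀ v ∈ S, ∀ x, H.Adj v x → x ∈ T) {u t : V} (p q : H.Walk u t)
    (hp : p.IsPath) (hq : q.IsPath) (h : trackerSeq T p = trackerSeq T q) :
    p.support = q.support := by
  induction p with
  | nil => rw [(Walk.isPath_iff_nil.1 hq).eq_nil]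
  | @cons u x t hux p ih =>
    cases q with
    | nil => rw [(Walk.isPath_iff_nil.1 hp).eq_nil]
    | @cons _ y _ huy q =>
      have htail : trackerSeq T p = trackerSeq T q := by
        simp only [trackerSeq, Walk.support_cons, List.filter_cons] at h ⊢
        split at h <;> simpa using h
      by_cases hxy : x = y
      · subst hxy
        rw [Walk.support_cons, Walk.support_cons, ih q hp.of_cons hq.of_cons htail]
      exfalso
      obtain ⟨b, p₁, p₂, rfl, hp₁, hb⟩ := exists_first_tracker T p
      obtain ⟨b', q₁, q₂, rfl, hq₁, hb'⟩ := exists_first_tracker T q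
      have hbb : b = b' := by
        rw [htail] at hb
        rcases hb with ⟨_, hb⟩ | ⟨_, hb, hb0⟩ <;> rcases hb' with ⟨_, hb'⟩ | ⟨_, hb', hb0'⟩
        · exact Option.some_injective _ (hb.symm.trans hb')
        · rw [hb0'] at hb; cases hb
        · rw [hb0] at hb'; cases hb'
        · exact hb.trans hb'.symm
      subst hbb
      have huS : u ∉ S := by
        intro hu
        have h1 := hp₁ x (by simp) (hN u hu x hux)
        have h2 := hq₁ y (by simp) (hN u hu y huy)
        exact hxy (h1.trans h2.symm)
      have hbS : b ∉ S := by
        intro hbS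
        have h1 : x = b := by
          rcases eq_or_exists_adj_end p₁ with h | ⟨z, hz, hzb⟩
          · exact h
          · exact absurd (hp₁ z hz (hN b hbS z hzb.symm)) hzb.ne
        have h2 : y = b := by
          rcases eq_or_exists_adj_end q₁ with h | ⟨z, hz, hzb⟩
          · exact h
          · exact absurd (hq₁ z hz (hN b hbS z hzb.symm)) hzb.ne
        exact hxy (h1.trans h2.symm)
      rw [← Walk.cons_append] at hp hq
      obtain ⟨P, hP, hPs⟩ := exists_isPath_within (A := (S : Set V)ᶜ) (Walk.cons hux p₁)
        hp.of_append_left (by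
          intro z hz hzS
          rw [Walk.support_cons, List.mem_cons] at hz
          rcases hz with rfl | hz
          · exact huS hzS
          · exact hbS (hp₁ z hz (hST hzS) ▸ hzS))
      obtain ⟨Q, hQ, hQs⟩ := exists_isPath_within (A := (S : Set V)ᶜ) (Walk.cons huy q₁)
        hq.of_append_left (by
          intro z hz hzS
          rw [Walk.support_cons, List.mem_cons] at hz
          rcases hz with rfl | hz
          · exact huS hzS
          · exact hbS (hq₁ z hz (hST hzS) ▸ hzS))
      have hPQ : P = Q := congrArg Subtype.val ((hac.subsingleton_path _ _).elim ⟨P, hP⟩ ⟨Q, hQ⟩)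
      rw [hPQ, hQs] at hPs
      rw [Walk.support_cons, Walk.support_cons, ← Walk.cons_tail_support p₁,
        ← Walk.cons_tail_support q₁] at hPs
      simp only [List.cons.injEq] at hPs
      exact hxy hPs.2.1.symm

theorem IsFVS.isTrackingSet_withNeighbors {V : Type*} [Fintype V] [DecidableEq V]
    {G : SimpleGraph V} {s t : V} {S : Finset V} (hS : IsFVS (reducedGraph G s t) S) :
    IsTrackingSet G s t (withNeighbors (reducedGraph G s t) S) := by
  rw [isFVS_iff] at hS
  intro p q hpq heq
  have hedge : ∀ w : G.Path s t, ∀ e ∈ w.1.edges,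
      e ∈ (reducedGraph G s t).spanningCoe.edgeSet := by
    intro w e he
    induction e with
    | h a b => exact ⟨w, he⟩
  have := support_eq_of_trackerSeq_eq (T := withNeighbors (reducedGraph G s t) S) hS.2
    (by simp [withNeighbors])
    (by
      intro v hv x hvx
      simp only [withNeighbors, Finset.mem_union, Finset.mem_filter, Finset.mem_univ, true_and]
      exact Or.inr ⟨v, hv, hvx⟩)
    (p.1.transfer _ (hedge p)) (q.1.transfer _ (hedge q))
    (p.2.transfer _) (q.2.transfer _)
    (by simpa [trackerSeq, Walk.support_transfer] using heq)
  rw [Walk.support_transfer, Walk.support_transfer] at this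
  exact hpq (Subtype.ext (Walk.ext_support this))

theorem card_withNeighbors_le {V : Type*} [Fintype V] [DecidableEq V]
    {G : SimpleGraph V} [DecidableRel G.Adj] (H : G.Subgraph) (S : Finset V) :
    (withNeighbors H S).card ≤ (G.maxDegree + 1) * S.card := by
  have hsub : withNeighbors H S ⊆ S.biUnion fun v => insert v (G.neighborFinset v) := by
    intro x hx
    simp only [withNeighbors, Finset.mem_union, Finset.mem_filter, Finset.mem_univ, true_and] at hx
    rw [Finset.mem_biUnion]
    rcases hx with hx | ⟨v, hv, hvx⟩
    · exact ⟨x, hx, Finset.mem_insert_self _ _⟩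
    · exact ⟨v, hv, Finset.mem_insert_of_mem (by simpa using hvx.adj_sub)⟩
  refine (Finset.card_le_card hsub).trans (Finset.card_biUnion_le.trans ?_)
  rw [mul_comm, ← smul_eq_mul]
  refine Finset.sum_le_card_nsmul _ _ _ fun v _ => ?_
  refine (Finset.card_insert_le _ _).trans ?_
  rw [card_neighborFinset_eq_degree]
  exact Nat.add_le_add_right (G.degree_le_maxDegree v) 1

/-- Trackers outside the reduced graph are never encountered. -/
theorem IsTrackingSet.inter_verts {V : Type*} [DecidableEq V] {G : SimpleGraph V} {s t : V}
    {T : Finset V} (hT : IsTrackingSet G s t T)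
    [DecidablePred (fun v => v ∈ (reducedGraph G s t).verts)] :
    IsTrackingSet G s t (T.filter fun v => v ∈ (reducedGraph G s t).verts) := by
  have hseq : ∀ p : G.Path s t,
      trackerSeq (T.filter fun v => v ∈ (reducedGraph G s t).verts) p.1 = trackerSeq T p.1 := by
    intro p
    unfold trackerSeq
    refine List.filter_congr fun x hx => ?_
    have : x ∈ (reducedGraph G s t).verts := ⟨p, hx⟩
    simp [this]
  intro p q hpq
  rw [hseq, hseq]
  exact hT p q hpq

theorem IsTwoApproxFVS.isApproxTrackingSet_withNeighbors {V : Type*} [Fintype V] [DecidableEq V]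
    {G : SimpleGraph V} [DecidableRel G.Adj] {s t : V} {S : Finset V}
    (hS : IsTwoApproxFVS (reducedGraph G s t) S) :
    IsApproxTrackingSet G s t (2 * (G.maxDegree + 1))
      (withNeighbors (reducedGraph G s t) S) := by
  classical
  refine ⟨hS.1.isTrackingSet_withNeighbors, fun T' hT' => ?_⟩
  have h1 := hS.2 _ (hT'.inter_verts.isFVS (by
    intro x hx
    exact (Finset.mem_filter.1 (Finset.mem_coe.1 hx)).2))
  have h2 := card_withNeighbors_le (reducedGraph G s t) S
  have h3 : (T'.filter fun v => v ∈ (reducedGraph G s t).verts).card ≤ T'.card :=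
    Finset.card_filter_le _ _
  calc _ ≤ (G.maxDegree + 1) * S.card := h2
    _ ≤ (G.maxDegree + 1) * (2 * T'.card) := Nat.mul_le_mul_left _ (by omega)
    _ = _ := by ring

/-! ### The local ratio bound for degree weights -/

section FVS

variable {V : Type*} (H : SimpleGraph V)

open Classical in
/-- The number of neighbours of `v` in `A`. -/
noncomputable def degIn (A : Finset V) (v : V) : ℕ := (A.filter fun x => H.Adj v x).card

variable {H}

theorem degIn_mono {A B : Finset V} (h : A ⊆ B) (v : V) : degIn H A v ≤ degIn H B v :=
  by classical exact Finset.card_le_card (Finset.filter_subset_filter _ h)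

theorem degIn_union [DecidableEq V] {A B : Finset V} (h : Disjoint A B) (v : V) :
    degIn H (A ∪ B) v = degIn H A v + degIn H B v := by
  classical
  unfold degIn
  rw [Finset.filter_union, Finset.card_union_of_disjoint (Finset.disjoint_filter_filter h)]

theorem sum_degIn_comm (A B : Finset V) : ∑ a ∈ A, degIn H B a = ∑ b ∈ B, degIn H A b := by
  classical
  have := Finset.sum_card_bipartiteAbove_eq_sum_card_bipartiteBelow (s := A) (t := B) H.Adj
  simpa [degIn, Finset.bipartiteAbove, Finset.bipartiteBelow, H.adj_comm] using this

theorem sum_degIn_self (X : Finset V) :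
    ∑ x ∈ X, degIn H X x = 2 * Nat.card (H.induce (X : Set V)).edgeSet := by
  classical
  rw [Nat.card_eq_fintype_card, ← SimpleGraph.edgeFinset_card,
    ← sum_degrees_eq_twice_card_edges, ← Finset.sum_coe_sort]
  refine Finset.sum_congr rfl fun x _ => ?_
  rw [← card_neighborFinset_eq_degree]
  unfold degIn
  rw [← Finset.card_map (Function.Embedding.subtype (fun x => x ∈ (X : Set V)))]
  congr 1
  ext y
  simp only [Finset.mem_filter, Finset.mem_map, mem_neighborFinset, comap_adj]
  constructor
  · rintro ⟨hy, hxy⟩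
    exact ⟨⟨y, hy⟩, hxy, rfl⟩
  · rintro ⟨⟨y, hy⟩, hxy, rfl⟩
    exact ⟨hy, hxy⟩

/-- A forest on `X` has fewer edges than vertices. -/
theorem sum_degIn_le_of_isAcyclic [Fintype V] {X : Finset V}
    (h : (within H (X : Set V)).IsAcyclic) : ∑ x ∈ X, degIn H X x ≤ 2 * X.card := by
  classical
  rcases X.eq_empty_or_nonempty with rfl | ⟨x, hx⟩
  · simp
  have hac : (H.induce (X : Set V)).IsAcyclic :=
    IsAcyclic.comap (G' := within H (X : Set V)) ⟨fun x => x.1, fun {a b} hab =>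
      ⟨hab, a.2, b.2⟩⟩ Subtype.val_injective h
  have : Nonempty (X : Set V) := ⟨⟨x, hx⟩⟩
  obtain ⟨T, hle, -, hT⟩ := connected_top.exists_isTree_le_of_le_of_isAcyclic
    (le_top : H.induce (X : Set V) ≤ ⊤) hac
  have h1 := hT.card_edgeFinset
  have h2 : Nat.card (H.induce (X : Set V)).edgeSet ≤ T.edgeFinset.card := by
    rw [Nat.card_eq_fintype_card, ← SimpleGraph.edgeFinset_card]
    exact Finset.card_le_card (edgeFinset_mono hle)
  have h3 : Fintype.card (X : Set V) = X.card := by simp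
  rw [sum_degIn_self]
  omega

/-- A connected graph on `X` has at least `|X| - 1` edges. -/
theorem le_sum_degIn_of_connected [Fintype V] {X : Finset V}
    (h : (H.induce (X : Set V)).Connected) : 2 * X.card ≤ ∑ x ∈ X, degIn H X x + 2 := by
  have h1 := h.card_vert_le_card_edgeSet_add_one
  have h3 : Nat.card (X : Set V) = X.card := by simp
  rw [sum_degIn_self]
  omega

variable (H) in
/-- Two neighbours of `v` lie in the same component of the graph induced on `Φ`, so that adding `v`
to the forest `Φ` would close a cycle. -/
def Conflict (Φ : Finset V) (v : V) : Prop :=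
  ∃ x ∈ Φ, ∃ y ∈ Φ, x ≠ y ∧ H.Adj v x ∧ H.Adj v y ∧ (within H (Φ : Set V)).Reachable x y

theorem Conflict.mono {Φ Ψ : Finset V} {v : V} (h : Conflict H Φ v) (hs : Φ ⊆ Ψ) :
    Conflict H Ψ v := by
  obtain ⟨x, hx, y, hy, hxy, hvx, hvy, hr⟩ := h
  exact ⟨x, hs hx, y, hs hy, hxy, hvx, hvy, hr.mono (within_mono (by exact_mod_cast hs))⟩

theorem Conflict.two_le_degIn {Φ A : Finset V} {v : V} (h : Conflict H Φ v) (hs : Φ ⊆ A) :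
    2 ≤ degIn H A v := by
  classical
  obtain ⟨x, hx, y, hy, hxy, hvx, hvy, -⟩ := h
  have : ({x, y} : Finset V) ⊆ A.filter fun z => H.Adj v z := by
    intro z hz
    rw [Finset.mem_insert, Finset.mem_singleton] at hz
    rcases hz with rfl | rfl
    · exact Finset.mem_filter.2 ⟨hs hx, hvx⟩
    · exact Finset.mem_filter.2 ⟨hs hy, hvy⟩
  have h2 := Finset.card_le_card this
  rwa [Finset.card_pair hxy] at h2

theorem not_isAcyclic_of_reachable {W : Set V} {u x y : V} (hu : u ∈ W) (hx : x ∈ W) (hy : y ∈ W)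
    (hxy : x ≠ y) (hux : H.Adj u x) (huy : H.Adj u y)
    (hr : (within H (W \ {u})).Reachable x y) : ¬ (within H W).IsAcyclic := by
  intro hac
  rw [isAcyclic_iff_forall_adj_isBridge] at hac
  refine hac (v := u) (w := x) ⟨hux, hu, hx⟩ ?_
  have h1 : ((within H W).deleteEdges {s(u, x)}).Adj u y := by
    rw [deleteEdges_adj]
    refine ⟨⟨huy, hu, hy⟩, ?_⟩
    simp only [Set.mem_singleton_iff, Sym2.eq_iff, not_or, not_and]
    exact ⟨fun _ h => hxy h.symm, fun h => absurd h hux.ne⟩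
  refine h1.reachable.trans (hr.symm.mono ?_)
  intro a b hab
  rw [deleteEdges_adj]
  refine ⟨⟨hab.1, hab.2.1.1, hab.2.2.1⟩, ?_⟩
  simp only [Set.mem_singleton_iff, Sym2.eq_iff, not_or, not_and]
  exact ⟨fun h => absurd h hab.2.1.2, fun _ h => absurd h hab.2.2.2⟩

variable [DecidableEq V]

/-- Let all degrees in `A` be at least two. A vertex set `A \ Φ` each of whose vertices closes a
cycle with `Φ` has at most twice the total degree of any feedback vertex set `F'`.

A component `K` of `Φ` with which some vertices of `A \ Φ` close a cycle forms with each of them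
a cycle that `F'` has to meet, and those vertices send two edges each into `K`. -/
theorem sum_degIn_le_two_mul [Fintype V] {A Φ F' : Finset V} (hΦ : Φ ⊆ A)
    (hdeg : ∀ u ∈ A, 2 ≤ degIn H A u) (hF : ∀ u ∈ A \ Φ, Conflict H Φ u)
    (hF' : (within H ((A \ F' : Finset V) : Set V)).IsAcyclic) :
    ∑ u ∈ A \ Φ, degIn H A u ≤ 2 * ∑ u ∈ A ∩ F', degIn H A u := by
  classical
  let κ : V → (within H (Φ : Set V)).ConnectedComponent := connectedComponentMk _
  choose! x hx y hy hxy hux huy hr using hF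
  let g : V → (within H (Φ : Set V)).ConnectedComponent := fun z => if z ∈ Φ then κ z else κ (x z)
  have hgΦ : ∀ z ∈ Φ, g z = κ z := fun z hz => if_pos hz
  have hgF : ∀ z ∈ A \ Φ, g z = κ (x z) := fun z hz => if_neg (Finset.mem_sdiff.1 hz).2
  let I := (A \ Φ).image g
  -- every component that takes part in a cycle contributes a vertex to `F'`
  have hI : I.card ≤ (A ∩ F').card := by
    refine (Finset.card_le_card (t := (A ∩ F').image g) ?_).trans Finset.card_image_le
    intro C hC
    obtain ⟨u, hu, rfl⟩ := Finset.mem_image.1 hC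
    by_contra hno
    have hW : ∀ z ∈ A, g z = g u → z ∈ ((A \ F' : Finset V) : Set V) := by
      intro z hz hzu
      rw [Finset.mem_coe, Finset.mem_sdiff]
      refine ⟨hz, fun hzF => hno ?_⟩
      exact Finset.mem_image.2 ⟨z, Finset.mem_inter.2 ⟨hz, hzF⟩, hzu⟩
    have huA := (Finset.mem_sdiff.1 hu).1
    have hgu := hgF u hu
    have hstep : ∀ z, (within H (Φ : Set V)).Reachable (x u) z →
        z ∈ Φ ∧ g z = g u ∧ (within H (((A \ F' : Finset V) : Set V) \ {u})).Reachable (x u) z := by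
      intro z hz
      rw [reachable_iff_reflTransGen] at hz
      induction hz with
      | refl => exact ⟨hx u hu, (hgΦ _ (hx u hu)).trans hgu.symm, Reachable.rfl⟩
      | @tail b c _ hbc ih =>
        have hc : c ∈ Φ := hbc.2.2
        have hgc : g c = g u := by
          rw [← ih.2.1, hgΦ c hc, hgΦ b ih.1]
          exact (ConnectedComponent.sound hbc.reachable).symm
        have hne : ∀ z ∈ Φ, z ≠ u := fun z hz h => (Finset.mem_sdiff.1 hu).2 (h ▸ hz)
        refine ⟨hc, hgc, ih.2.2.trans (Adj.reachable ⟨hbc.1, ⟨?_, ?_⟩, ⟨?_, ?_⟩⟩)⟩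
        · exact hW b (hΦ ih.1) ih.2.1
        · exact hne b ih.1
        · exact hW c (hΦ hc) hgc
        · exact hne c hc
    refine not_isAcyclic_of_reachable (hW u huA rfl) (hW _ (hΦ (hx u hu)) ?_)
      (hW _ (hΦ (hy u hu)) ?_) (hxy u hu) (hux u hu) (huy u hu) (hstep _ (hr u hu)).2.2 hF'
    · exact (hstep _ Reachable.rfl).2.1
    · exact (hstep _ (hr u hu)).2.1
  -- the contribution of one component
  have hcomp : ∀ C, 2 * (Φ.filter fun z => g z = C).card + 2 * ((A \ Φ).filter fun z => g z = C).card
      ≤ ∑ z ∈ Φ.filter (fun z => g z = C), degIn H A z + 2 * (if C ∈ I then 1 else 0) := by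
    intro C
    split_ifs with hC
    · obtain ⟨u, hu, huC⟩ := Finset.mem_image.1 hC
      set K := Φ.filter fun z => g z = C with hK
      set L := (A \ Φ).filter fun z => g z = C with hL
      have hdisj : Disjoint K L := by
        rw [Finset.disjoint_left]
        intro z hzK hzL
        exact (Finset.mem_sdiff.1 (Finset.mem_filter.1 hzL).1).2 (Finset.mem_filter.1 hzK).1
      have hKL : K ∪ L ⊆ A := by
        intro z hz
        rcases Finset.mem_union.1 hz with hz | hz
        · exact hΦ (Finset.mem_filter.1 hz).1
        · exact (Finset.mem_sdiff.1 (Finset.mem_filter.1 hz).1).1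
      have hconn : (H.induce (K : Set V)).Connected := by
        have hsupp : C.supp = (K : Set V) := by
          ext z
          rw [ConnectedComponent.mem_supp_iff, hK, Finset.mem_coe, Finset.mem_filter]
          constructor
          · intro hz
            have hz' : (within H (Φ : Set V)).Reachable (x u) z := by
              refine ConnectedComponent.exact ?_
              rw [hz, ← huC, hgF u hu]
            have hzΦ : z ∈ Φ := mem_of_reachable_within hz' (hx u hu)
            exact ⟨hzΦ, (hgΦ z hzΦ).trans hz⟩
          · rintro ⟨hzΦ, hz⟩
            rw [← hz, hgΦ z hzΦ]
        have h1 := C.connected_toSimpleGraph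
        have h2 : ((within H (Φ : Set V)).induce C.supp).Connected := h1
        rw [hsupp] at h2
        exact h2.mono fun a b (hab : (within H (Φ : Set V)).Adj a b) => hab.1
      have h1 := le_sum_degIn_of_connected hconn
      have h2 : 2 * L.card ≤ ∑ z ∈ K, degIn H L z := by
        rw [sum_degIn_comm, mul_comm, ← smul_eq_mul]
        refine Finset.card_nsmul_le_sum _ _ _ fun v hv => ?_
        obtain ⟨hvF, hvC⟩ := Finset.mem_filter.1 hv
        have hmem : ∀ z ∈ Φ, (within H (Φ : Set V)).Reachable (x v) z → z ∈ K := by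
          intro z hz hrz
          refine Finset.mem_filter.2 ⟨hz, ?_⟩
          rw [hgΦ z hz, ← hvC, hgF v hvF]
          exact (ConnectedComponent.sound hrz).symm
        have hsub : ({x v, y v} : Finset V) ⊆ K.filter fun z => H.Adj v z := by
          intro z hz
          rw [Finset.mem_insert, Finset.mem_singleton] at hz
          rcases hz with rfl | rfl
          · exact Finset.mem_filter.2 ⟨hmem _ (hx v hvF) Reachable.rfl, hux v hvF⟩
          · exact Finset.mem_filter.2 ⟨hmem _ (hy v hvF) (hr v hvF), huy v hvF⟩
        have h3 := Finset.card_le_card hsub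
        rwa [Finset.card_pair (hxy v hvF)] at h3
      have h3 : ∑ z ∈ K, degIn H K z + ∑ z ∈ K, degIn H L z ≤ ∑ z ∈ K, degIn H A z := by
        rw [← Finset.sum_add_distrib]
        refine Finset.sum_le_sum fun z _ => ?_
        rw [← degIn_union hdisj]
        exact degIn_mono hKL z
      omega
    · have hL : (A \ Φ).filter (fun z => g z = C) = ∅ := by
        rw [Finset.filter_eq_empty_iff]
        intro z hz hzC
        exact hC (Finset.mem_image.2 ⟨z, hz, hzC⟩)
      rw [hL, Finset.card_empty, mul_comm, ← smul_eq_mul]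
      have := Finset.card_nsmul_le_sum (Φ.filter fun z => g z = C) (fun z => degIn H A z) 2
        fun z hz => hdeg z (hΦ (Finset.mem_filter.1 hz).1)
      omega
  have hfib : ∀ X : Finset V, ∑ C, (X.filter fun z => g z = C).card = X.card := fun X =>
    (Finset.card_eq_sum_card_fiberwise (fun _ _ => Finset.mem_coe.2 (Finset.mem_univ _))).symm
  have hfs : ∑ C, ∑ z ∈ Φ with g z = C, degIn H A z = ∑ z ∈ Φ, degIn H A z :=
    Finset.sum_fiberwise_of_maps_to (fun _ _ => Finset.mem_univ _) _
  have hsum := Finset.sum_le_sum fun C (_ : C ∈ (Finset.univ : Finset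
    (within H (Φ : Set V)).ConnectedComponent)) => hcomp C
  rw [Finset.sum_add_distrib, Finset.sum_add_distrib, ← Finset.mul_sum, ← Finset.mul_sum,
    ← Finset.mul_sum, hfib Φ, hfib (A \ Φ),
    hfs, Finset.sum_boole, Finset.filter_mem_eq_inter, Finset.univ_inter] at hsum
  -- edges outside `F'` form a forest
  have hA : ∑ u ∈ A, degIn H A u = ∑ u ∈ A ∩ F', degIn H A u + ∑ u ∈ A \ F', degIn H A u :=
    (Finset.sum_inter_add_sum_sdiff A F' _).symm
  have hA2 : ∑ u ∈ A, degIn H A u = ∑ u ∈ A \ Φ, degIn H A u + ∑ u ∈ Φ, degIn H A u :=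
    (Finset.sum_sdiff hΦ).symm
  have hsplit : ∑ u ∈ A \ F', degIn H A u ≤
      ∑ u ∈ A ∩ F', degIn H A u + 2 * (A \ F').card := by
    have hdisj : Disjoint (A ∩ F') (A \ F') :=
      (Finset.disjoint_sdiff_inter A F').symm
    have hun : A ∩ F' ∪ A \ F' = A := by
      rw [Finset.union_comm]; exact Finset.sdiff_union_inter A F'
    calc ∑ u ∈ A \ F', degIn H A u
        = ∑ u ∈ A \ F', (degIn H (A ∩ F') u + degIn H (A \ F') u) :=
          Finset.sum_congr rfl fun u _ => by rw [← degIn_union hdisj, hun]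
      _ = ∑ u ∈ A ∩ F', degIn H (A \ F') u + ∑ u ∈ A \ F', degIn H (A \ F') u := by
          rw [Finset.sum_add_distrib, sum_degIn_comm]
      _ ≤ _ := Nat.add_le_add
          (Finset.sum_le_sum fun u _ => degIn_mono Finset.sdiff_subset u)
          (sum_degIn_le_of_isAcyclic hF')
  have hc1 : (A \ F').card + (A ∩ F').card = A.card := Finset.card_sdiff_add_card_inter A F'
  have hc2 : (A \ Φ).card + Φ.card = A.card := Finset.card_sdiff_add_card_eq_card hΦ
  simp only [Nat.cast_id] at hsum
  omega

/-! ### Elimination with weights and the reverse greedy forest -/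

variable (H) in
/-- `Elim H n A w L`: the list `L` enumerates `A` in an order in which the vertices can be
eliminated by the local ratio method started from the weights `w`. A vertex with at most one
remaining neighbour is eliminated for free. Otherwise a multiple `γ` of the degrees is subtracted
from the weights, where `γ = 0` unless all degrees are at least two, and a vertex is eliminated
whose remaining weight is at most `n`; it need not be zero, as weights are integers. -/
inductive Elim (n : ℕ) : Finset V → (V → ℕ) → List V → Prop
  | nil (w : V → ℕ) : Elim n ∅ w []
  | low {A : Finset V} {w : V → ℕ} {v : V} {L : List V} (hv : v ∈ A) (hd : degIn H A v ≤ 1)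
      (h : Elim n (A.erase v) w L) : Elim n A w (v :: L)
  | main {A : Finset V} {w w' : V → ℕ} {γ : ℕ} {v : V} {L : List V} (hv : v ∈ A)
      (hγ : 0 < γ → ∀ u ∈ A, 2 ≤ degIn H A u)
      (hw : ∀ u ∈ A, w u = γ * degIn H A u + w' u) (hn : w' v ≤ n)
      (h : Elim n (A.erase v) w' L) : Elim n A w (v :: L)

theorem Elim.mem_iff {n : ℕ} {A : Finset V} {w : V → ℕ} {L : List V} (h : Elim H n A w L)
    (x : V) : x ∈ L ↔ x ∈ A := by
  induction h with
  | nil => simp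
  | low hv _ _ ih | main hv _ _ _ _ ih =>
    rw [List.mem_cons, ih, Finset.mem_erase]
    grind

open Classical in
variable (H) in
/-- The forest obtained by going through the list from its end and keeping every vertex that
closes no cycle with the vertices already kept. -/
noncomputable def greedyForest : List V → Finset V
  | [] => ∅
  | v :: L => if Conflict H (greedyForest L) v then greedyForest L else insert v (greedyForest L)

theorem mem_of_mem_greedyForest {L : List V} {x : V} (h : x ∈ greedyForest H L) : x ∈ L := by
  induction L with
  | nil => simp [greedyForest] at h
  | cons v L ih =>
    rw [greedyForest] at h
    split_ifs at h
    · exact List.mem_cons_of_mem _ (ih h)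
    · rcases Finset.mem_insert.1 h with rfl | h
      · exact List.mem_cons_self
      · exact List.mem_cons_of_mem _ (ih h)

theorem greedyForest_subset_cons (v : V) (L : List V) :
    greedyForest H L ⊆ greedyForest H (v :: L) := by
  rw [greedyForest]
  split_ifs
  · exact subset_rfl
  · exact Finset.subset_insert _ _

theorem conflict_of_notMem_greedyForest {L : List V} {x : V} (hx : x ∈ L)
    (h : x ∉ greedyForest H L) : Conflict H (greedyForest H L) x := by
  induction L with
  | nil => simp at hx
  | cons v L ih =>
    by_cases hxv : x = v
    · subst hxv
      by_contra hno
      refine h ?_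
      rw [greedyForest, if_neg fun hc => hno (hc.mono (greedyForest_subset_cons x L))]
      exact Finset.mem_insert_self _ _
    · have hxL : x ∈ L := (List.mem_cons.1 hx).resolve_left hxv
      exact (ih hxL fun h' => h (greedyForest_subset_cons v L h')).mono
        (greedyForest_subset_cons v L)

theorem isAcyclic_within_insert {Φ : Finset V} {v : V} (hac : (within H (Φ : Set V)).IsAcyclic)
    (hv : ¬ Conflict H Φ v) : (within H ((insert v Φ : Finset V) : Set V)).IsAcyclic := by
  intro z c hc
  by_cases hvc : v ∈ c.support
  · have hc' := hc.rotate hvc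
    revert hc'
    generalize c.rotate v hvc = c'
    intro hc'
    cases c' with
    | nil => exact hc'.not_nil Walk.Nil.nil
    | @cons _ x _ hvx p =>
      rw [Walk.cons_isCycle_iff] at hc'
      obtain ⟨q, hq⟩ : ∃ q, p = Walk.reverse q := ⟨p.reverse, by simp⟩
      subst hq
      cases q with
      | nil => exact hvx.ne rfl
      | @cons _ y _ hvy q =>
        have hqp : (Walk.cons hvy q).IsPath := (Walk.isPath_reverse_iff _).1 hc'.1
        have hmem : ∀ a ∈ (insert v Φ : Finset V), a ≠ v → a ∈ Φ := fun a ha hav =>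
          (Finset.mem_insert.1 ha).resolve_left hav
        refine hv ⟨x, hmem x hvx.2.2 hvx.ne', y, hmem y hvy.2.2 hvy.ne', ?_, hvx.1, hvy.1, ?_⟩
        · rintro rfl
          exact hc'.2 (by simp)
        · refine Reachable.symm ⟨q.transfer _ ?_⟩
          intro e he
          induction e with
          | h a b =>
            have hab := q.adj_of_mem_edges he
            rw [Walk.cons_isPath_iff] at hqp
            refine ⟨hab.1, hmem a hab.2.1 ?_, hmem b hab.2.2 ?_⟩
            · rintro rfl
              exact hqp.2 (q.fst_mem_support_of_mem_edges he)
            · rintro rfl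
              exact hqp.2 (q.snd_mem_support_of_mem_edges he)
  · have he : ∀ e ∈ c.edges, e ∈ (within H (Φ : Set V)).edgeSet := by
      intro e he
      induction e with
      | h a b =>
        have hab := c.adj_of_mem_edges he
        refine ⟨hab.1, (Finset.mem_insert.1 hab.2.1).resolve_left ?_,
          (Finset.mem_insert.1 hab.2.2).resolve_left ?_⟩
        · rintro rfl
          exact hvc (c.fst_mem_support_of_mem_edges he)
        · rintro rfl
          exact hvc (c.snd_mem_support_of_mem_edges he)
    exact hac _ (hc.transfer he)

theorem isAcyclic_within_greedyForest (L : List V) :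
    (within H (greedyForest H L : Set V)).IsAcyclic := by
  induction L with
  | nil =>
    refine IsAcyclic.anti (G' := ⊥) ?_ isAcyclic_bot
    intro a b hab
    simpa [greedyForest] using hab.2.1
  | cons v L ih =>
    rw [greedyForest]
    split_ifs with h
    · exact ih
    · exact isAcyclic_within_insert ih h

/-- The local ratio argument: weight that is a multiple of the degrees is paid for by
`sum_degIn_le_two_mul`, and the rest of the weight by induction, up to `n` for each vertex. -/
theorem Elim.sum_le [Fintype V] {n : ℕ} {A : Finset V} {w : V → ℕ} {L : List V}
    (h : Elim H n A w L) {F' : Finset V}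
    (hF' : (within H ((A \ F' : Finset V) : Set V)).IsAcyclic) :
    ∑ u ∈ A \ greedyForest H L, w u ≤
      2 * ∑ u ∈ A ∩ F', w u + n * (A \ greedyForest H L).card := by
  induction h with
  | nil => simp
  | @low A w v L hv hd h ih =>
    have hsub : greedyForest H L ⊆ A := fun x hx =>
      Finset.mem_of_mem_erase ((h.mem_iff x).1 (mem_of_mem_greedyForest hx))
    have hgf : greedyForest H (v :: L) = insert v (greedyForest H L) := by
      rw [greedyForest, if_neg]
      intro hc
      have := hc.two_le_degIn hsub
      omega
    have hset : A \ greedyForest H (v :: L) = A.erase v \ greedyForest H L := by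
      rw [hgf]
      ext x
      simp only [Finset.mem_sdiff, Finset.mem_insert, Finset.mem_erase]
      tauto
    rw [hset]
    refine (ih (isAcyclic_within_mono ?_ hF')).trans ?_
    · exact_mod_cast Finset.sdiff_subset_sdiff (Finset.erase_subset _ _) subset_rfl
    · have : ∑ u ∈ A.erase v ∩ F', w u ≤ ∑ u ∈ A ∩ F', w u :=
        Finset.sum_le_sum_of_subset
          (Finset.inter_subset_inter (Finset.erase_subset _ _) subset_rfl)
      omega
  | @main A w w' γ v L hv hγ hw hn h ih =>
    have hmem : ∀ x ∈ A, x ∈ v :: L := by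
      intro x hx
      rw [List.mem_cons, h.mem_iff, Finset.mem_erase]
      by_cases hxv : x = v
      · exact Or.inl hxv
      · exact Or.inr ⟨hxv, hx⟩
    have hsubL : greedyForest H L ⊆ A.erase v := fun x hx =>
      (h.mem_iff x).1 (mem_of_mem_greedyForest hx)
    have hsub : greedyForest H (v :: L) ⊆ A := fun x hx => by
      rcases List.mem_cons.1 (mem_of_mem_greedyForest hx) with rfl | hx
      · exact hv
      · exact Finset.mem_of_mem_erase ((h.mem_iff x).1 hx)
    have hdegree : γ * ∑ u ∈ A \ greedyForest H (v :: L), degIn H A u ≤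
        γ * (2 * ∑ u ∈ A ∩ F', degIn H A u) := by
      rcases Nat.eq_zero_or_pos γ with h0 | hpos
      · simp [h0]
      · refine Nat.mul_le_mul_left _ (sum_degIn_le_two_mul hsub (hγ hpos) ?_ hF')
        intro u hu
        rw [Finset.mem_sdiff] at hu
        exact conflict_of_notMem_greedyForest (hmem u hu.1) hu.2
    have hrest : ∑ u ∈ A \ greedyForest H (v :: L), w' u ≤
        2 * ∑ u ∈ A.erase v ∩ F', w' u + n * (A \ greedyForest H (v :: L)).card := by
      have ih' := ih (isAcyclic_within_mono (by
        exact_mod_cast Finset.sdiff_subset_sdiff (Finset.erase_subset v A) (subset_refl F')) hF')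
      by_cases hc : Conflict H (greedyForest H L) v
      · have hgf : greedyForest H (v :: L) = greedyForest H L := by rw [greedyForest, if_pos hc]
        have hset : A \ greedyForest H L = insert v (A.erase v \ greedyForest H L) := by
          rw [← Finset.insert_sdiff_of_notMem, Finset.insert_erase hv]
          exact fun hvL => Finset.notMem_erase v A (hsubL hvL)
        have hv' : v ∉ A.erase v \ greedyForest H L := by simp
        rw [hgf, hset, Finset.sum_insert hv', Finset.card_insert_of_notMem hv', mul_add]
        omega
      · have hgf : greedyForest H (v :: L) = insert v (greedyForest H L) := by
          rw [greedyForest, if_neg hc]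
        have hset : A \ greedyForest H (v :: L) = A.erase v \ greedyForest H L := by
          rw [hgf]
          ext x
          simp only [Finset.mem_sdiff, Finset.mem_insert, Finset.mem_erase]
          tauto
        rw [hset]
        exact ih'
    have hle : ∑ u ∈ A.erase v ∩ F', w' u ≤ ∑ u ∈ A ∩ F', w' u :=
      Finset.sum_le_sum_of_subset
        (Finset.inter_subset_inter (Finset.erase_subset _ _) subset_rfl)
    have e1 : ∑ u ∈ A \ greedyForest H (v :: L), w u =
        γ * ∑ u ∈ A \ greedyForest H (v :: L), degIn H A u +
          ∑ u ∈ A \ greedyForest H (v :: L), w' u := by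
      rw [Finset.mul_sum, ← Finset.sum_add_distrib]
      exact Finset.sum_congr rfl fun u hu => hw u (Finset.mem_sdiff.1 hu).1
    have e2 : ∑ u ∈ A ∩ F', w u = γ * ∑ u ∈ A ∩ F', degIn H A u + ∑ u ∈ A ∩ F', w' u := by
      rw [Finset.mul_sum, ← Finset.sum_add_distrib]
      exact Finset.sum_congr rfl fun u hu => hw u (Finset.mem_inter.1 hu).1
    rw [e1, e2]
    have e3 : γ * (2 * ∑ u ∈ A ∩ F', degIn H A u) = 2 * (γ * ∑ u ∈ A ∩ F', degIn H A u) := by ring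
    omega

/-- Started from equal weights above `n ^ 2`, the elimination yields a factor of two exactly: the
integer rounding costs less than the weight of one vertex. -/
theorem Elim.card_compl_greedyForest_le [Fintype V] {N : ℕ} {L : List V}
    (h : Elim H (Fintype.card V) Finset.univ (fun _ => N) L)
    (hN : Fintype.card V * Fintype.card V < N) {F' : Finset V}
    (hF' : (within H (F' : Set V)ᶜ).IsAcyclic) :
    (Finset.univ \ greedyForest H L).card ≤ 2 * F'.card := by
  have h1 := h.sum_le (F' := F') (by simpa [Set.compl_eq_univ_sdiff] using hF')
  rw [Finset.univ_inter, Finset.sum_const, Finset.sum_const, smul_eq_mul, smul_eq_mul] at h1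
  have h2 : Fintype.card V * (Finset.univ \ greedyForest H L).card ≤
      Fintype.card V * Fintype.card V := Nat.mul_le_mul_left _ (Finset.card_le_univ _)
  have h3 : (Finset.univ \ greedyForest H L).card * N < (2 * F'.card + 1) * N := by
    have : (2 * F'.card + 1) * N = 2 * (F'.card * N) + N := by ring
    omega
  have := Nat.lt_of_mul_lt_mul_right h3
  omega

end FVS

/-! ### The reduced graph through st-numberings -/

section StNumbering

variable {V : Type*} {G : SimpleGraph V} {s t : V}

variable (G s t) in
/-- An st-numbering of `U`: an injective numbering with minimum at `s` and maximum at `t` for which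
every other vertex of `U` has both a smaller and a larger neighbour in `U`. -/
structure IsStNumbering (U : Finset V) (f : V → ℕ) : Prop where
  s_mem : s ∈ U
  t_mem : t ∈ U
  inj : ∀ a ∈ U, ∀ b ∈ U, f a = f b → a = b
  s_lt : ∀ v ∈ U, v ≠ s → f s < f v
  lt_t : ∀ v ∈ U, v ≠ t → f v < f t
  down : ∀ v ∈ U, v ≠ s → v ≠ t → ∃ a ∈ U, G.Adj a v ∧ f a < f v
  up : ∀ v ∈ U, v ≠ s → v ≠ t → ∃ b ∈ U, G.Adj b v ∧ f v < f b

namespace IsStNumbering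

variable {U : Finset V} {f : V → ℕ}

theorem le_t (h : IsStNumbering G s t U f) {v : V} (hv : v ∈ U) : f v ≤ f t := by
  by_cases hvt : v = t
  · rw [hvt]
  · exact (h.lt_t v hv hvt).le

theorem s_le (h : IsStNumbering G s t U f) {v : V} (hv : v ∈ U) : f s ≤ f v := by
  by_cases hvs : v = s
  · rw [hvs]
  · exact (h.s_lt v hv hvs).le

theorem symm (h : IsStNumbering G s t U f) : IsStNumbering G t s U (fun v => f t - f v) where
  s_mem := h.t_mem
  t_mem := h.s_mem
  inj a ha b hb hab := by
    have := h.le_t ha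
    have := h.le_t hb
    exact h.inj a ha b hb (by omega)
  s_lt v hv hvt := by
    have := h.lt_t v hv hvt
    omega
  lt_t v hv hvs := by
    have := h.s_lt v hv hvs
    have := h.le_t hv
    omega
  down v hv hvt hvs := by
    obtain ⟨b, hb, hbv, hlt⟩ := h.up v hv hvs hvt
    have := h.le_t hb
    exact ⟨b, hb, hbv, by omega⟩
  up v hv hvt hvs := by
    obtain ⟨b, hb, hbv, hlt⟩ := h.down v hv hvs hvt
    have := h.le_t hv
    exact ⟨b, hb, hbv, by omega⟩

theorem exists_path_down (h : IsStNumbering G s t U f) {v : V} (hv : v ∈ U) (hvt : v ≠ t) :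
    ∃ p : G.Walk s v, p.IsPath ∧ ∀ x ∈ p.support, x ∈ U ∧ f x ≤ f v := by
  induction hn : f v using Nat.strong_induction_on generalizing v with
  | _ m ih =>
    subst hn
    by_cases hvs : v = s
    · subst hvs
      exact ⟨Walk.nil, by simp, by simpa using hv⟩
    · obtain ⟨a, ha, hav, hlt⟩ := h.down v hv hvs hvt
      obtain ⟨p, hp, hps⟩ := ih (f a) hlt ha (by
        rintro rfl
        exact absurd (h.le_t hv) (by omega)) rfl
      refine ⟨p.concat hav, hp.concat (fun hvp => ?_) hav, ?_⟩
      · exact absurd (hps v hvp).2 (by omega)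
      · intro x hx
        rw [Walk.support_concat, List.mem_append, List.mem_singleton] at hx
        rcases hx with hx | rfl
        · exact ⟨(hps x hx).1, (hps x hx).2.trans hlt.le⟩
        · exact ⟨hv, le_rfl⟩

theorem exists_path_up (h : IsStNumbering G s t U f) {v : V} (hv : v ∈ U) (hvs : v ≠ s) :
    ∃ p : G.Walk v t, p.IsPath ∧ ∀ x ∈ p.support, x ∈ U ∧ f v ≤ f x := by
  obtain ⟨p, hp, hps⟩ := h.symm.exists_path_down hv hvs
  refine ⟨p.reverse, hp.reverse, fun x hx => ?_⟩
  rw [Walk.support_reverse, List.mem_reverse] at hx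
  have h1 := hps x hx
  have h2 := h.le_t h1.1
  have h3 := h.le_t hv
  exact ⟨h1.1, by omega⟩

/-- An edge of a set with an st-numbering lies on a monotone path from `s` to `t`. -/
theorem reducedGraph_adj (h : IsStNumbering G s t U f) {a b : V} (ha : a ∈ U) (hb : b ∈ U)
    (hab : G.Adj a b) : (reducedGraph G s t).Adj a b := by
  have key : ∀ a ∈ U, ∀ b ∈ U, G.Adj a b → f a < f b → (reducedGraph G s t).Adj a b := by
    intro a ha b hb hab hlt
    obtain ⟨p, hp, hps⟩ := h.exists_path_down ha (by
      rintro rfl; exact absurd (h.le_t hb) (by omega))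
    obtain ⟨q, hq, hqs⟩ := h.exists_path_up hb (by
      rintro rfl; exact absurd (h.s_le ha) (by omega))
    have hpath : (p.append (Walk.cons hab q)).IsPath := by
      rw [Walk.isPath_def, Walk.support_append, Walk.support_cons, List.tail_cons]
      refine List.nodup_append'.2 ⟨(Walk.isPath_def _).1 hp, (Walk.isPath_def _).1 hq, ?_⟩
      intro x hx hx'
      have h1 := (hps x hx).2
      have h2 := (hqs x hx').2
      omega
    exact ⟨⟨_, hpath⟩, by simp⟩
  rcases Nat.lt_trichotomy (f a) (f b) with hlt | heq | hgt
  · exact key a ha b hb hab hlt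
  · exact absurd (h.inj a ha b hb heq) hab.ne
  · exact (key b hb a ha hab.symm hgt).symm

/-- An ear between two vertices of `U` can be numbered just above its lower end. -/
theorem exists_card_lt_of_ear [Fintype V] [DecidableEq V] (h : IsStNumbering G s t U f)
    {x z p y : V} (w : G.Walk x z) (hw : w.IsPath) (hwU : ∀ v ∈ w.support, v ∉ U) (hp : p ∈ U)
    (hy : y ∈ U) (hpy : f p < f y) (hpx : G.Adj p x) (hzy : G.Adj z y) :
    ∃ U' f', IsStNumbering G s t U' f' ∧ U.card < U'.card := by
  have hlen : w.length < Fintype.card V := hw.length_lt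
  obtain ⟨M, hM⟩ : ∃ M, M = Fintype.card V + 1 := ⟨_, rfl⟩
  -- the position of a vertex of the ear
  have hpos : ∀ v ∈ w.support, ∃ i, i ≤ w.length ∧ w.getVert i = v := by
    intro v hv
    obtain ⟨i, hi, hil⟩ := Walk.mem_support_iff_exists_getVert.1 hv
    exact ⟨i, hil, hi⟩
  choose! i hi hiv using hpos
  have hig : ∀ j ≤ w.length, i (w.getVert j) = j := fun j hj =>
    hw.getVert_injOn (hi _ (w.getVert_mem_support j)) hj (hiv _ (w.getVert_mem_support j))
  let f' : V → ℕ := fun v => if v ∈ U then f v * M else f p * M + (i v + 1)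
  have f'U : ∀ v ∈ U, f' v = f v * M := fun v hv => if_pos hv
  have f'w : ∀ v ∈ w.support, f' v = f p * M + (i v + 1) := fun v hv => if_neg (hwU v hv)
  have hlo : ∀ v ∈ w.support, f p * M < f' v := fun v hv => by rw [f'w v hv]; omega
  have hhi : ∀ v ∈ w.support, f' v < (f p + 1) * M := fun v hv => by
    rw [f'w v hv, add_mul]
    have := hi v hv
    omega
  have hM0 : 0 < M := by omega
  have hmono : ∀ a ∈ U, ∀ b ∈ U, f a < f b → f' a < f' b := fun a ha b hb hab => by
    rw [f'U a ha, f'U b hb]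
    exact Nat.mul_lt_mul_of_pos_right hab hM0
  have hmem : ∀ v, v ∈ U ∪ w.support.toFinset ↔ v ∈ U ∨ v ∈ w.support := by simp
  have hys : f p + 1 ≤ f y := hpy
  refine ⟨U ∪ w.support.toFinset, f', ⟨?_, ?_, ?_, ?_, ?_, ?_, ?_⟩, ?_⟩
  · exact (hmem s).2 (Or.inl h.s_mem)
  · exact (hmem t).2 (Or.inl h.t_mem)
  · have hmix : ∀ a ∈ U, ∀ b ∈ w.support, f' a ≠ f' b := by
      intro a ha b hb hab
      have h1 := hlo b hb
      have h2 := hhi b hb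
      rw [← hab, f'U a ha] at h1 h2
      have h3 := Nat.lt_of_mul_lt_mul_right h1
      have h4 := Nat.lt_of_mul_lt_mul_right h2
      omega
    intro a ha b hb hab
    rcases (hmem a).1 ha with ha | ha <;> rcases (hmem b).1 hb with hb | hb
    · rw [f'U a ha, f'U b hb] at hab
      exact h.inj a ha b hb (Nat.eq_of_mul_eq_mul_right hM0 hab)
    · exact absurd hab (hmix a ha b hb)
    · exact absurd hab.symm (hmix b hb a ha)
    · rw [f'w a ha, f'w b hb] at hab
      rw [← hiv a ha, ← hiv b hb]
      congr 1
      omega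
  · intro v hv hvs
    rcases (hmem v).1 hv with hv | hv
    · exact hmono s h.s_mem v hv (h.s_lt v hv hvs)
    · rw [f'U s h.s_mem]
      exact (Nat.mul_le_mul_right M (h.s_le hp)).trans_lt (hlo v hv)
  · intro v hv hvt
    rcases (hmem v).1 hv with hv | hv
    · exact hmono v hv t h.t_mem (h.lt_t v hv hvt)
    · rw [f'U t h.t_mem]
      exact (hhi v hv).trans_le (Nat.mul_le_mul_right M (hys.trans (h.le_t hy)))
  · intro v hv hvs hvt
    rcases (hmem v).1 hv with hv | hv
    · obtain ⟨a, ha, hav, hlt⟩ := h.down v hv hvs hvt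
      exact ⟨a, (hmem a).2 (Or.inl ha), hav, hmono a ha v hv hlt⟩
    · rcases Nat.eq_zero_or_pos (i v) with h0 | hpos
      · refine ⟨p, (hmem p).2 (Or.inl hp), ?_, ?_⟩
        · have : v = x := by rw [← hiv v hv, h0, Walk.getVert_zero]
          rwa [this]
        · rw [f'U p hp]; exact hlo v hv
      · refine ⟨w.getVert (i v - 1), (hmem _).2 (Or.inr (w.getVert_mem_support _)), ?_, ?_⟩
        · have h1 := w.adj_getVert_succ (i := i v - 1) (by have := hi v hv; omega)
          rwa [Nat.sub_add_cancel hpos, hiv v hv] at h1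
        · rw [f'w v hv, f'w _ (w.getVert_mem_support _), hig _ (by have := hi v hv; omega)]
          omega
  · intro v hv hvs hvt
    rcases (hmem v).1 hv with hv | hv
    · obtain ⟨a, ha, hav, hlt⟩ := h.up v hv hvs hvt
      exact ⟨a, (hmem a).2 (Or.inl ha), hav, hmono v hv a ha hlt⟩
    · rcases Nat.lt_or_ge (i v) w.length with hlt | hge
      · refine ⟨w.getVert (i v + 1), (hmem _).2 (Or.inr (w.getVert_mem_support _)), ?_, ?_⟩
        · have h1 := w.adj_getVert_succ hlt
          rw [hiv v hv] at h1
          exact h1.symm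
        · rw [f'w v hv, f'w _ (w.getVert_mem_support _), hig _ hlt]
          omega
      · refine ⟨y, (hmem y).2 (Or.inl hy), ?_, ?_⟩
        · have : v = z := by
            rw [← hiv v hv, le_antisymm (hi v hv) hge, Walk.getVert_length]
          rw [this]; exact hzy.symm
        · rw [f'U y hy]
          exact (hhi v hv).trans_le (Nat.mul_le_mul_right M hys)
  · refine Finset.card_lt_card ⟨Finset.subset_union_left, fun hsub => ?_⟩
    exact hwU x w.start_mem_support (hsub ((hmem x).2 (Or.inr w.start_mem_support)))

end IsStNumbering

/-- A maximal set with an st-numbering; the start is `{s, t}`, whether or not `s` and `t` are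
adjacent. -/
theorem exists_maximal_isStNumbering [Fintype V] [DecidableEq V] (G : SimpleGraph V) (hst : s ≠ t) :
    ∃ U f, IsStNumbering G s t U f ∧ ∀ U' f', IsStNumbering G s t U' f' → U'.card ≤ U.card := by
  have hne : {U : Finset V | ∃ f, IsStNumbering G s t U f}.Nonempty := by
    refine ⟨{s, t}, fun v => if v = s then 0 else 1, ?_, ?_, ?_, ?_, ?_, ?_, ?_⟩ <;>
      simp [hst, hst.symm]
  obtain ⟨U, ⟨f, hf⟩, hmax⟩ := Set.exists_max_image _ Finset.card (Set.toFinite _) hne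
  exact ⟨U, f, hf, fun U' f' h => hmax U' ⟨f', h⟩⟩

/-- Following a walk from `v` until it enters `U`. -/
theorem exists_reachable_adj_of_reachable {K : SimpleGraph V} (hK : K ≤ G) {U : Set V} {v e : V}
    (hv : v ∉ U) (he : e ∈ U) (h : K.Reachable v e) :
    ∃ a p, (within G Uᶜ).Reachable v a ∧ K.Adj a p ∧ p ∈ U := by
  rw [reachable_iff_reflTransGen] at h
  induction h using Relation.ReflTransGen.head_induction_on with
  | refl => exact absurd he hv
  | @head a c hac _ ih =>
    by_cases hc : c ∈ U
    · exact ⟨a, c, Reachable.rfl, hac, hc⟩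
    · obtain ⟨b, p, hb, hbp, hp⟩ := ih hc
      exact ⟨b, p, (Adj.reachable (G := within G Uᶜ) ⟨hK hac, hv, hc⟩).trans hb, hbp, hp⟩

variable (G s t) in
/-- No vertex `x ≠ v` separates `v` from `{s, t}`. -/
def NotSeparated (v : V) : Prop :=
  ∀ x, x ≠ v → ∃ e, (e = s ∨ e = t) ∧ e ≠ x ∧ (within G {x}ᶜ).Reachable v e

/-- A vertex that no other vertex separates from `{s, t}` lies in every maximal set with an
st-numbering: otherwise there is an ear through it. -/
theorem NotSeparated.mem [Fintype V] [DecidableEq V] {U : Finset V} {f : V → ℕ}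
    (hU : IsStNumbering G s t U f)
    (hmax : ∀ U' f', IsStNumbering G s t U' f' → U'.card ≤ U.card) {v : V}
    (hv : NotSeparated G s t v) : v ∈ U := by
  by_contra hvU
  have hmem : ∀ e, (e = s ∨ e = t) → e ∈ (U : Set V) := by
    rintro e (rfl | rfl)
    · exact hU.s_mem
    · exact hU.t_mem
  have exit : ∀ x, x ≠ v → ∃ a p, (within G (U : Set V)ᶜ).Reachable v a ∧ G.Adj a p ∧ p ∈ U ∧
      p ≠ x := by
    intro x hx
    obtain ⟨e, he, -, hr⟩ := hv x hx
    obtain ⟨a, p, ha, hap, hp⟩ := exists_reachable_adj_of_reachable (within_le _) hvU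
      (hmem e he) hr
    exact ⟨a, p, ha, hap.1, hp, hap.2.2⟩
  obtain ⟨a, p, ha, hap, hp, -⟩ := exit s fun h => hvU (h ▸ hU.s_mem)
  obtain ⟨b, y, hb, hby, hy, hyp⟩ := exit p fun h => hvU (h ▸ hp)
  have key : ∀ a p b y, (within G (U : Set V)ᶜ).Reachable a b → a ∉ U → G.Adj a p → p ∈ U →
      G.Adj b y → y ∈ U → f p < f y → False := by
    intro a p b y hab ha hap hp hby hy hlt
    obtain ⟨w, hw⟩ := hab.exists_isPath
    have hwU : ∀ v ∈ (w.mapLe (within_le _)).support, v ∉ U := by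
      intro z hz
      rw [Walk.support_mapLe_eq_support] at hz
      exact mem_of_reachable_within ⟨w.takeUntil z hz⟩ ha
    obtain ⟨U', f', h', hlt'⟩ := hU.exists_card_lt_of_ear (w.mapLe (within_le _))
      (hw.mapLe _) hwU hp hy hlt hap.symm hby
    exact absurd (hmax U' f' h') (by omega)
  have haU : a ∉ U := mem_of_reachable_within ha hvU
  have hbU : b ∉ U := mem_of_reachable_within hb hvU
  rcases Nat.lt_trichotomy (f p) (f y) with hlt | heq | hgt
  · exact key a p b y (ha.symm.trans hb) haU hap hp hby hy hlt
  · exact hyp (hU.inj p hp y hy heq).symm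
  · exact key b y a p (hb.symm.trans ha) hbU hby hy hap hp hgt

/-- The edges of the reduced graph are those between the vertices that no other vertex separates
from `{s, t}`. -/
theorem reducedGraph_adj_iff [Finite V] (hst : s ≠ t) {B : Set V}
    (hB : ∀ v ∈ B, v ≠ s → v ≠ t → NotSeparated G s t v)
    (hB' : ∀ v, NotSeparated G s t v → v ∈ B) {a b : V} :
    (reducedGraph G s t).Adj a b ↔ G.Adj a b ∧ a ∈ B ∧ b ∈ B := by
  classical
  have := Fintype.ofFinite V
  constructor
  · intro h
    have hsupp : ∀ p : G.Path s t, ∀ v ∈ p.1.support, v ∈ B := by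
      rintro ⟨p, hp⟩ v hv
      refine hB' v fun x hx => ?_
      have hv' : v ∈ p.support := hv
      -- `x` misses one of the two parts into which `v` splits the path
      by_cases hx1 : x ∈ (p.takeUntil v hv').support
      · have hx2 : ∀ z ∈ (p.dropUntil v hv').support, z ∈ ({x}ᶜ : Set V) := by
          rintro z hz rfl
          have h1 := (Walk.isPath_def _).1 hp
          rw [← Walk.take_spec p hv', Walk.support_append] at h1
          rw [← Walk.cons_tail_support, List.mem_cons] at hz
          exact (List.nodup_append'.1 h1).2.2 hx1 (hz.resolve_left hx)
        obtain ⟨q, -⟩ := exists_isPath_within _ (hp.dropUntil hv') hx2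
        exact ⟨t, Or.inr rfl, hx2 t (Walk.end_mem_support _), ⟨q⟩⟩
      · have hx2 : ∀ z ∈ (p.takeUntil v hv').support, z ∈ ({x}ᶜ : Set V) := by
          rintro z hz rfl
          exact hx1 hz
        obtain ⟨q, -⟩ := exists_isPath_within _ (hp.takeUntil hv') hx2
        exact ⟨s, Or.inl rfl, hx2 s (Walk.start_mem_support _), ⟨q.reverse⟩⟩
    obtain ⟨p, hp⟩ := h
    exact ⟨p.1.adj_of_mem_edges hp, hsupp p a (p.1.fst_mem_support_of_mem_edges hp),
      hsupp p b (p.1.snd_mem_support_of_mem_edges hp)⟩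
  · rintro ⟨hab, ha, hb⟩
    obtain ⟨U, f, hU, hmax⟩ := exists_maximal_isStNumbering G hst
    have hBU : ∀ v ∈ B, v ∈ U := by
      intro v hv
      by_cases hvs : v = s
      · exact hvs ▸ hU.s_mem
      by_cases hvt : v = t
      · exact hvt ▸ hU.t_mem
      exact (hB v hv hvs hvt).mem hU hmax
    exact hU.reducedGraph_adj (hBU a ha) (hBU b hb) hab

end StNumbering

/-! ### Recognising the reduced graph in a depth-first search tree -/

section Dfs

variable {V : Type*}

/-- `Desc s num par w x`: the vertex `x` lies in the subtree below `w` of the tree with root `s`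
and parent function `par` on the vertices with nonzero number. -/
inductive Desc (s : V) (num : V → ℕ) (par : V → V) (w : V) : V → Prop
  | refl : Desc s num par w w
  | step {x : V} (hx : num x ≠ 0) (hs : x ≠ s) (h : Desc s num par w (par x)) :
      Desc s num par w x

/-- The result of a depth-first search of `G` from `t` in which `s`, the parent of `t`, counts as
visited but is never left. The visited vertices are those with a nonzero number `num`; all edges
between them are vertical, and `low v` is the smallest number of a neighbour of the subtree
below `v` (or the number of `v`). -/
structure DfsTree (G : SimpleGraph V) (s t : V) (num : V → ℕ) (par : V → V) (low : V → ℕ) :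
    Prop where
  num_s : num s = 1
  num_t : num t = 2
  par_t : par t = s
  par_spec : ∀ v, num v ≠ 0 → v ≠ s → v ≠ t →
    G.Adj v (par v) ∧ num (par v) ≠ 0 ∧ num (par v) < num v ∧ par v ≠ s
  vertical : ∀ u v, num u ≠ 0 → num v ≠ 0 → G.Adj u v →
    Desc s num par u v ∨ Desc s num par v u
  closed : ∀ v y, num v ≠ 0 → v ≠ s → G.Adj v y → num y ≠ 0
  low_le : ∀ v x y, num v ≠ 0 → v ≠ s → Desc s num par v x → G.Adj x y → low v ≤ num y
  low_attained : ∀ v, num v ≠ 0 → v ≠ s →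
    low v = num v ∨ ∃ x y, Desc s num par v x ∧ G.Adj x y ∧ num y ≠ 0 ∧ num y = low v

theorem Desc.trans {s : V} {num : V → ℕ} {par : V → V} {a b c : V} (h : Desc s num par a b)
    (h' : Desc s num par b c) : Desc s num par a c := by
  induction h' with
  | refl => exact h
  | step hx hs _ ih => exact Desc.step hx hs ih

/-- The ancestors of a vertex form a chain. -/
theorem Desc.comparable {s : V} {num : V → ℕ} {par : V → V} {a b c : V} (h : Desc s num par a c)
    (h' : Desc s num par b c) : Desc s num par a b ∨ Desc s num par b a := by
  induction h with
  | refl => exact Or.inr h'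
  | step hx hs ha ih =>
    cases h' with
    | refl => exact Or.inl (Desc.step hx hs ha)
    | step _ _ hb => exact ih hb

theorem desc_root_iff {s : V} {num : V → ℕ} {par : V → V} {w : V} :
    Desc s num par w s ↔ w = s := by
  constructor
  · intro h
    cases h with
    | refl => rfl
    | step _ hs _ => exact absurd rfl hs
  · rintro rfl
    exact Desc.refl

/-- The subtree relation does not change when the tree grows at vertices not visited before. -/
theorem desc_congr {s : V} {num num' : V → ℕ} {par par' : V → V}
    (hnum : ∀ v, num v ≠ 0 → num' v ≠ 0) (hpar : ∀ v, num v ≠ 0 → par' v = par v)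
    (hclosed : ∀ v, num v ≠ 0 → v ≠ s → num (par v) ≠ 0) {w x : V} (hx : num x ≠ 0) :
    Desc s num' par' w x ↔ Desc s num par w x := by
  constructor
  · intro h
    induction h with
    | refl => exact Desc.refl
    | step _ hs _ ih =>
      rw [hpar _ hx] at ih
      exact Desc.step hx hs (ih (hclosed _ hx hs))
  · intro h
    induction h with
    | refl => exact Desc.refl
    | step hx' hs _ ih =>
      refine Desc.step (hnum _ hx) hs ?_
      rw [hpar _ hx]
      exact ih (hclosed _ hx hs)

namespace DfsTree

variable {G : SimpleGraph V} {s t : V} {num : V → ℕ} {par : V → V} {low : V → ℕ}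

theorem num_par (h : DfsTree G s t num par low) {v : V} (hv : num v ≠ 0) (hs : v ≠ s) :
    num (par v) ≠ 0 ∧ num (par v) < num v := by
  by_cases ht : v = t
  · subst ht
    rw [h.par_t, h.num_s, h.num_t]
    omega
  · exact ⟨(h.par_spec v hv hs ht).2.1, (h.par_spec v hv hs ht).2.2.1⟩

theorem le_of_desc (h : DfsTree G s t num par low) {w x : V} (hd : Desc s num par w x) :
    num w ≤ num x := by
  induction hd with
  | refl => exact le_rfl
  | step hx hs _ ih => exact ih.trans (h.num_par hx hs).2.le

theorem num_ne_zero_of_desc {w x : V} (hw : num w ≠ 0)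
    (hd : Desc s num par w x) : num x ≠ 0 := by
  cases hd with
  | refl => exact hw
  | step hx _ _ => exact hx

theorem eq_of_desc_of_num_le (h : DfsTree G s t num par low) {w x : V}
    (hd : Desc s num par w x) (hle : num x ≤ num w) : w = x := by
  cases hd with
  | refl => rfl
  | step hx hs hd =>
    have h1 := h.le_of_desc hd
    have h2 := (h.num_par hx hs).2
    omega

theorem desc_t (h : DfsTree G s t num par low) {w : V} (hd : Desc s num par w t) :
    w = t ∨ w = s := by
  cases hd with
  | refl => exact Or.inl rfl
  | step hx hs hd =>
    rw [h.par_t, desc_root_iff] at hd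
    exact Or.inr hd

/-- Inside the subtree below `w` its root is reached without using a vertex `x` of smaller
number. -/
theorem reachable_of_desc (h : DfsTree G s t num par low) {w z x : V} (hws : w ≠ s) (hwt : w ≠ t)
    (hx : num x < num w) (hd : Desc s num par w z) : (within G {x}ᶜ).Reachable w z := by
  have hne : ∀ y, Desc s num par w y → y ∈ ({x}ᶜ : Set V) := by
    rintro y hy rfl
    have := h.le_of_desc hy
    omega
  induction hd with
  | refl => exact Reachable.rfl
  | @step z hz hs hd ih =>
    have hzt : z ≠ t := by
      rintro rfl
      rw [h.par_t, desc_root_iff] at hd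
      exact hws hd
    exact ih.trans (Adj.reachable ⟨(h.par_spec z hz hs hzt).1.symm, hne _ hd,
      hne _ (Desc.step hz hs hd)⟩)

variable {B : Set V}

theorem mem_of_desc
    (hB : ∀ v, num v ≠ 0 → v ≠ s → v ≠ t → (v ∈ B ↔ par v ∈ B ∧ low v < num (par v)))
    (hs : s ∈ B) (h : DfsTree G s t num par low) {y p : V} (hp : p ∈ B)
    (hd : Desc s num par y p) : y ∈ B := by
  induction hd with
  | refl => exact hp
  | @step x hx hxs hd ih =>
    by_cases hxt : x = t
    · subst hxt
      rw [h.par_t, desc_root_iff] at hd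
      exact hd ▸ hs
    · exact ih ((hB x hx hxs hxt).1 hp).1

/-- If no lowpoint condition fails above `v`, then no vertex separates `v` from `{s, t}`: climb
the tree, and bypass `x` along an edge from below to above `x`. -/
theorem notSeparated_of_mem (h : DfsTree G s t num par low)
    (hB : ∀ v, num v ≠ 0 → v ≠ s → v ≠ t → (v ∈ B ↔ par v ∈ B ∧ low v < num (par v)))
    (hs : s ∈ B) (hun : ∀ v ∈ B, num v ≠ 0) {v : V} (hv : v ∈ B) (hvs : v ≠ s) :
    NotSeparated G s t v := by
  intro x hxv
  induction hn : num v using Nat.strong_induction_on generalizing v with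
  | _ m ih =>
    subst hn
    by_cases hvt : v = t
    · exact ⟨t, Or.inr rfl, hvt ▸ hxv.symm, hvt ▸ Reachable.rfl⟩
    obtain ⟨hpB, hlow⟩ := (hB v (hun v hv) hvs hvt).1 hv
    obtain ⟨hadj, hpv, hlt, hps⟩ := h.par_spec v (hun v hv) hvs hvt
    by_cases hpx : par v = x
    · subst hpx
      rcases h.low_attained v (hun v hv) hvs with hl | ⟨z, y, hz, hzy, hy0, hy⟩
      · omega
      have hyp : y ≠ par v := by rintro rfl; omega
      have hzn := h.le_of_desc hz
      have hz0 : num z ≠ 0 := num_ne_zero_of_desc (hun v hv) hz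
      have hvz : (within G {par v}ᶜ).Reachable v z := h.reachable_of_desc hvs hvt hlt hz
      have hzp : z ≠ par v := by rintro hzp; rw [hzp] at hzn; omega
      have hzy' : (within G {par v}ᶜ).Adj z y := ⟨hzy, hzp, hyp⟩
      by_cases hys : y = s
      · subst hys
        exact ⟨y, Or.inl rfl, hyp, hvz.trans hzy'.reachable⟩
      have hdy : Desc s num par y z := by
        rcases h.vertical z y hz0 hy0 hzy with hd | hd
        · have := h.le_of_desc hd
          omega
        · exact hd
      have hdp : Desc s num par y (par v) := by
        rcases hdy.comparable ((Desc.step (hun v hv) hvs Desc.refl).trans hz) with hd | hd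
        · exact hd
        · have := h.le_of_desc hd
          omega
      obtain ⟨e, he, hex, hr⟩ := ih (num y) (by omega) (mem_of_desc hB hs h hpB hdp) hys
        hyp.symm rfl
      exact ⟨e, he, hex, hvz.trans (hzy'.reachable.trans hr)⟩
    · obtain ⟨e, he, hex, hr⟩ := ih (num (par v)) hlt hpB hps (Ne.symm hpx) rfl
      refine ⟨e, he, hex, (Adj.reachable (G := within G {x}ᶜ) ⟨hadj, ?_, ?_⟩).trans hr⟩
      · exact fun hvx => hxv hvx.symm
      · exact hpx

/-- If the lowpoint condition fails at an ancestor `w` of `v`, then the parent of `w` separates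
`v` from `{s, t}`; and `s` does so if `v` is not visited. -/
theorem mem_of_notSeparated (h : DfsTree G s t num par low)
    (hB : ∀ v, num v ≠ 0 → v ≠ s → v ≠ t → (v ∈ B ↔ par v ∈ B ∧ low v < num (par v)))
    (hs : s ∈ B) (ht : t ∈ B) {v : V} (hv : NotSeparated G s t v) : v ∈ B := by
  have ht0 : num t ≠ 0 := by rw [h.num_t]; omega
  by_contra hvB
  have stay : ∀ {x : V} {P : V → Prop}, (∀ a b, P a → (within G {x}ᶜ).Adj a b → P b) → P v →
      ∀ e, (within G {x}ᶜ).Reachable v e → P e := by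
    intro x P hP hPv e he
    rw [reachable_iff_reflTransGen] at he
    induction he with
    | refl => exact hPv
    | tail _ hbc ih => exact hP _ _ ih hbc
  by_cases hv0 : num v = 0
  · obtain ⟨e, he, hes, hr⟩ := hv s (by rintro rfl; exact hvB hs)
    have he0 : num e = 0 := by
      refine stay (P := fun z => num z = 0) ?_ hv0 e hr
      intro a b ha hab
      by_contra hb
      exact h.closed b a hb hab.2.2 hab.1.symm ha
    rcases he with rfl | rfl
    · exact hes rfl
    · exact ht0 he0
  · have hw : ∀ m v, num v = m → num v ≠ 0 → v ∉ B → ∃ w, num w ≠ 0 ∧ w ≠ s ∧ w ≠ t ∧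
        Desc s num par w v ∧ num (par w) ≤ low w := by
      intro m
      induction m using Nat.strong_induction_on with
      | _ m ih =>
        rintro v rfl hv0 hvB
        have hvs : v ≠ s := by rintro rfl; exact hvB hs
        have hvt : v ≠ t := by rintro rfl; exact hvB ht
        rw [hB v hv0 hvs hvt, not_and_or, not_lt] at hvB
        rcases hvB with hp | hl
        · obtain ⟨-, hp0, hlt, -⟩ := h.par_spec v hv0 hvs hvt
          obtain ⟨w, hw0, hws, hwt, hwv, hl⟩ := ih _ hlt _ rfl hp0 hp
          exact ⟨w, hw0, hws, hwt, Desc.step hv0 hvs hwv, hl⟩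
        · exact ⟨v, hv0, hvs, hvt, Desc.refl, hl⟩
    obtain ⟨w, hw0, hws, hwt, hwv, hl⟩ := hw _ v rfl hv0 hvB
    have hlt := (h.num_par hw0 hws).2
    obtain ⟨e, he, hex, hr⟩ := hv (par w) (by
      intro hpv
      have := h.le_of_desc hwv
      rw [← hpv] at this
      omega)
    have hwe : Desc s num par w e := by
      refine stay (P := fun z => Desc s num par w z) ?_ hwv e hr
      intro z y hwz hzy
      have hz0 : num z ≠ 0 := num_ne_zero_of_desc hw0 hwz
      have hzs : z ≠ s := by rintro rfl; exact hws (desc_root_iff.1 hwz)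
      have hy0 := h.closed z y hz0 hzs hzy.1
      have hly := h.low_le w z y hw0 hws hwz hzy.1
      rcases h.vertical z y hz0 hy0 hzy.1 with hd | hd
      · exact hwz.trans hd
      · rcases hwz.comparable hd with hd' | hd'
        · exact hd'
        · cases hd' with
          | refl => exact Desc.refl
          | step _ _ hd' =>
            exact absurd (h.eq_of_desc_of_num_le hd' (hl.trans hly)) hzy.2.2
    rcases he with rfl | rfl
    · exact hws (desc_root_iff.1 hwe)
    · exact (h.desc_t hwe).elim hwt hws

theorem reducedGraph_adj_iff [Finite V] (h : DfsTree G s t num par low)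
    (hB : ∀ v, num v ≠ 0 → v ≠ s → v ≠ t → (v ∈ B ↔ par v ∈ B ∧ low v < num (par v)))
    (hs : s ∈ B) (ht : t ∈ B) (hun : ∀ v ∈ B, num v ≠ 0) {a b : V} :
    (reducedGraph G s t).Adj a b ↔ G.Adj a b ∧ a ∈ B ∧ b ∈ B := by
  refine Tracking.reducedGraph_adj_iff ?_
    (fun v hv hvs _ => h.notSeparated_of_mem hB hs hun hv hvs)
    (fun v hv => h.mem_of_notSeparated hB hs ht hv)
  rintro rfl
  have h1 := h.num_s
  have h2 := h.num_t
  omega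

end DfsTree

end Dfs

/-! ### The invariant of depth-first search -/

section DfsRun

variable {n : ℕ} {G : SimpleGraph (Fin n)} {s t : Fin n}

variable (G s t) in
/-- The invariant of a depth-first search standing at `cur`. The stack consists of the ancestors of
`cur`; `ptr v` is the first possible neighbour of `v` that has not been scanned yet, and the lowpoint
of a vertex that has left the stack has been passed on to its parent. -/
structure DfsInv (cur : Fin n) (num low ptr : Fin n → ℕ) (par : Fin n → Fin n) : Prop where
  num_s : num s = 1
  num_t : num t = 2
  par_t : par t = s
  num_cur : num cur ≠ 0
  par_spec : ∀ v, num v ≠ 0 → v ≠ s → v ≠ t →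
    G.Adj v (par v) ∧ num (par v) ≠ 0 ∧ num (par v) < num v ∧ par v ≠ s
  vertical : ∀ u v, num u ≠ 0 → num v ≠ 0 → G.Adj u v →
    Desc s num par u v ∨ Desc s num par v u
  scanned : ∀ v j : Fin n, num v ≠ 0 → v ≠ s → (j : ℕ) < ptr v → G.Adj v j →
    num j ≠ 0 ∧ low v ≤ num j
  finished : ∀ v, num v ≠ 0 → v ≠ s → ¬ Desc s num par v cur → n ≤ ptr v
  low_le_num : ∀ v, num v ≠ 0 → v ≠ s → low v ≤ num v
  low_par : ∀ v, num v ≠ 0 → v ≠ s → v ≠ t → ¬ Desc s num par v cur → low (par v) ≤ low v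
  low_attained : ∀ v, num v ≠ 0 → v ≠ s →
    low v = num v ∨ ∃ x y, Desc s num par v x ∧ G.Adj x y ∧ num y ≠ 0 ∧ num y = low v

/-- The numbers are given out consecutively, and `ord` is the inverse of the numbering. -/
structure Numbering (cnt : ℕ) (num : Fin n → ℕ) (ord : ℕ → ℕ) : Prop where
  le_cnt : ∀ v, num v ≤ cnt
  ord_num : ∀ v : Fin n, num v ≠ 0 → ord (num v - 1) = v
  exists_num : ∀ i < cnt, ∃ v : Fin n, num v = i + 1 ∧ ord i = v

theorem Numbering.cnt_le {cnt : ℕ} {num : Fin n → ℕ} {ord : ℕ → ℕ} (h : Numbering cnt num ord) :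
    cnt ≤ n := by
  have hex : ∀ i, ∃ v, i < cnt → ∃ hv : v < n, num ⟨v, hv⟩ = i + 1 := by
    intro i
    by_cases hi : i < cnt
    · obtain ⟨v, hv, -⟩ := h.exists_num i hi
      exact ⟨v, fun _ => ⟨v.2, hv⟩⟩
    · exact ⟨0, fun hi' => absurd hi' hi⟩
  choose f hf using hex
  have := Finset.card_le_card_of_injOn (s := Finset.range cnt) (t := Finset.range n) f
    (fun i hi => by
      obtain ⟨hv, -⟩ := hf i (Finset.mem_range.1 (Finset.mem_coe.1 hi))
      exact Finset.mem_coe.2 (Finset.mem_range.2 hv)) (by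
      intro i hi j hj hij
      obtain ⟨h1, h1'⟩ := hf i (Finset.mem_range.1 (Finset.mem_coe.1 hi))
      obtain ⟨h2, h2'⟩ := hf j (Finset.mem_range.1 (Finset.mem_coe.1 hj))
      simp only [hij] at h1'
      omega)
  simpa using this

theorem Numbering.insert {cnt : ℕ} {num : Fin n → ℕ} {ord : ℕ → ℕ} (h : Numbering cnt num ord)
    {y : Fin n} (hy : num y = 0) :
    Numbering (cnt + 1) (Function.update num y (cnt + 1)) (Function.update ord cnt y) where
  le_cnt v := by
    have := h.le_cnt v
    rw [Function.update_apply]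
    split_ifs <;> omega
  ord_num v hv := by
    by_cases hvy : v = y
    · simp [hvy]
    · rw [Function.update_of_ne hvy] at hv ⊢
      have := h.le_cnt v
      rw [Function.update_of_ne (by omega)]
      exact h.ord_num v hv
  exists_num i hi := by
    rcases Nat.lt_succ_iff_lt_or_eq.1 hi with hi | rfl
    · obtain ⟨v, hv, hov⟩ := h.exists_num i hi
      refine ⟨v, ?_, ?_⟩
      · rw [Function.update_of_ne (by rintro rfl; omega), hv]
      · rw [Function.update_of_ne (by omega), hov]
    · exact ⟨y, by simp, by simp⟩

theorem Numbering.lt {cnt : ℕ} {num : Fin n → ℕ} {ord : ℕ → ℕ} (h : Numbering cnt num ord)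
    {y : Fin n} (hy : num y = 0) : cnt < n := by
  have := (h.insert hy).cnt_le
  omega

namespace DfsInv

variable {cur : Fin n} {num low ptr : Fin n → ℕ} {par : Fin n → Fin n}

theorem init (hst : s ≠ t) (num par : _) (hnum : ∀ v, num v = if v = s then 1 else if v = t then 2 else 0)
    (hpar : par t = s) (low : Fin n → ℕ) (hlow : low t = 2) :
    DfsInv G s t t num low (fun _ => 0) par := by
  have hs : num s = 1 := by simp [hnum]
  have ht : num t = 2 := by simp [hnum, hst.symm]
  have hv : ∀ v, num v ≠ 0 → v ≠ s → v = t := by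
    intro v hv hvs
    by_contra hvt
    exact hv (by rw [hnum, if_neg hvs, if_neg hvt])
  have hd : Desc s num par s t := Desc.step (by omega) hst.symm (hpar ▸ Desc.refl)
  refine ⟨hs, ht, hpar, by omega, ?_, ?_, ?_, ?_, ?_, ?_, ?_⟩
  · intro v h0 h1 h2
    exact absurd (hv v h0 h1) h2
  · intro u v hu hv' huv
    by_cases hus : u = s
    · by_cases hvs : v = s
      · exact absurd (hus.trans hvs.symm) huv.ne
      · rw [hus, hv v hv' hvs]; exact Or.inl hd
    · by_cases hvs : v = s
      · rw [hvs, hv u hu hus]; exact Or.inr hd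
      · rw [hv u hu hus, hv v hv' hvs]; exact Or.inl Desc.refl
  · intro v j _ _ hj
    omega
  · intro v h0 h1 h2
    rw [hv v h0 h1] at h2
    exact absurd Desc.refl h2
  · intro v h0 h1
    rw [hv v h0 h1]; omega
  · intro v h0 h1 h2
    exact absurd (hv v h0 h1) h2
  · intro v h0 h1
    rw [hv v h0 h1]; left; omega

theorem num_par (h : DfsInv G s t cur num low ptr par) {v : Fin n} (hv : num v ≠ 0) (hs : v ≠ s) :
    num (par v) ≠ 0 ∧ num (par v) < num v := by
  by_cases ht : v = t
  · subst ht
    rw [h.par_t, h.num_s, h.num_t]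
    omega
  · exact ⟨(h.par_spec v hv hs ht).2.1, (h.par_spec v hv hs ht).2.2.1⟩

theorem desc_s (h : DfsInv G s t cur num low ptr par) {v : Fin n} (hv : num v ≠ 0) :
    Desc s num par s v := by
  induction hn : num v using Nat.strong_induction_on generalizing v with
  | _ m ih =>
    subst hn
    by_cases hs : v = s
    · rw [hs]; exact Desc.refl
    · have := h.num_par hv hs
      exact Desc.step hv hs (ih _ this.2 this.1 rfl)

theorem visited_of_desc (h : DfsInv G s t cur num low ptr par) {w x : Fin n} (hx : num x ≠ 0)
    (hd : Desc s num par w x) : num w ≠ 0 ∧ num w ≤ num x := by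
  induction hd with
  | refl => exact ⟨hx, le_rfl⟩
  | step hx hs _ ih =>
    have h1 := h.num_par hx hs
    have h2 := ih h1.1
    exact ⟨h2.1, by omega⟩

/-- Scanning a pair that is no edge. -/
theorem scan_nonadj (h : DfsInv G s t cur num low ptr par) {y : Fin n} (hy : ptr cur = y)
    (hadj : ¬ G.Adj cur y) :
    DfsInv G s t cur num low (Function.update ptr cur (ptr cur + 1)) par where
  num_s := h.num_s
  num_t := h.num_t
  par_t := h.par_t
  num_cur := h.num_cur
  par_spec := h.par_spec
  vertical := h.vertical
  low_le_num := h.low_le_num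
  low_par := h.low_par
  low_attained := h.low_attained
  scanned v j hv hs hj hvj := by
    by_cases hvc : v = cur
    · subst hvc
      rw [Function.update_self] at hj
      refine h.scanned v j hv hs ?_ hvj
      by_contra hlt
      have : j = y := Fin.ext (by omega)
      exact hadj (this ▸ hvj)
    · rw [Function.update_of_ne hvc] at hj
      exact h.scanned v j hv hs hj hvj
  finished v hv hs hd := by
    rw [Function.update_of_ne (by rintro rfl; exact hd Desc.refl)]
    exact h.finished v hv hs hd

/-- Scanning an edge to a visited vertex. -/
theorem scan_visited (h : DfsInv G s t cur num low ptr par) {y : Fin n} (hy : ptr cur = y)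
    (hadj : G.Adj cur y) (hy0 : num y ≠ 0) :
    DfsInv G s t cur num (Function.update low cur (min (low cur) (num y)))
      (Function.update ptr cur (ptr cur + 1)) par := by
  have hle : ∀ v, Function.update low cur (min (low cur) (num y)) v ≤ low v := by
    intro v
    rw [Function.update_apply]
    split_ifs with hv
    · rw [hv]; exact min_le_left _ _
    · exact le_rfl
  refine ⟨h.num_s, h.num_t, h.par_t, h.num_cur, h.par_spec, h.vertical, ?_, ?_, ?_, ?_, ?_⟩
  · intro v j hv hs hj hvj
    by_cases hvc : v = cur
    · subst hvc
      rw [Function.update_self] at hj ⊢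
      by_cases hlt : (j : ℕ) < ptr v
      · have := h.scanned v j hv hs hlt hvj
        exact ⟨this.1, (min_le_left _ _).trans this.2⟩
      · have : j = y := Fin.ext (by omega)
        rw [this]
        exact ⟨hy0, min_le_right _ _⟩
    · rw [Function.update_of_ne hvc] at hj
      have := h.scanned v j hv hs hj hvj
      exact ⟨this.1, (hle v).trans this.2⟩
  · intro v hv hs hd
    rw [Function.update_of_ne (by rintro rfl; exact hd Desc.refl)]
    exact h.finished v hv hs hd
  · exact fun v hv hs => (hle v).trans (h.low_le_num v hv hs)
  · intro v hv hs ht hd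
    have hvc : v ≠ cur := by rintro rfl; exact hd Desc.refl
    rw [Function.update_of_ne hvc]
    exact (hle _).trans (h.low_par v hv hs ht hd)
  · intro v hv hs
    by_cases hvc : v = cur
    · subst hvc
      rw [Function.update_self]
      rcases le_total (low v) (num y) with hl | hl
      · rw [min_eq_left hl]
        exact h.low_attained v hv hs
      · rw [min_eq_right hl]
        exact Or.inr ⟨v, y, Desc.refl, hadj, hy0, rfl⟩
    · rw [Function.update_of_ne hvc]
      exact h.low_attained v hv hs

theorem desc_update_iff (h : DfsInv G s t cur num low ptr par) {y : Fin n} (hy0 : num y = 0)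
    {c : ℕ} {w x : Fin n} (hx : num x ≠ 0) :
    Desc s (Function.update num y c) (Function.update par y cur) w x ↔ Desc s num par w x := by
  have hne : ∀ v, num v ≠ 0 → v ≠ y := by rintro v hv rfl; exact hv hy0
  refine desc_congr (fun v hv => ?_) (fun v hv => ?_) (fun v hv hs => (h.num_par hv hs).1) hx
  · rwa [Function.update_of_ne (hne v hv)]
  · rw [Function.update_of_ne (hne v hv)]

theorem desc_update_new_iff (h : DfsInv G s t cur num low ptr par) {y : Fin n} (hy0 : num y = 0)
    {c : ℕ} (hc : c ≠ 0) {w : Fin n} :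
    Desc s (Function.update num y c) (Function.update par y cur) w y ↔
      w = y ∨ Desc s num par w cur := by
  have hys : y ≠ s := by
    rintro rfl
    have := h.num_s
    omega
  constructor
  · intro hd
    cases hd with
    | refl => exact Or.inl rfl
    | step _ _ hd =>
      rw [Function.update_self] at hd
      exact Or.inr ((h.desc_update_iff hy0 h.num_cur).1 hd)
  · rintro (rfl | hd)
    · exact Desc.refl
    · refine Desc.step (by rwa [Function.update_self]) hys ?_
      rw [Function.update_self]
      exact (h.desc_update_iff hy0 h.num_cur).2 hd

/-- Scanning an edge to a new vertex. All edges stay vertical: a visited neighbour of the new vertex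
is still on the stack, as otherwise it would have been scanned completely. -/
theorem scan_new (h : DfsInv G s t cur num low ptr par) {y : Fin n} (hy : ptr cur = y)
    (hptr : ptr y = 0) (hcs : cur ≠ s) (hadj : G.Adj cur y) (hy0 : num y = 0) {cnt : ℕ}
    (hcnt : ∀ v, num v ≤ cnt) :
    DfsInv G s t y (Function.update num y (cnt + 1)) (Function.update low y (cnt + 1))
      (Function.update ptr cur (ptr cur + 1)) (Function.update par y cur) := by
  have hne : ∀ v, num v ≠ 0 → v ≠ y := by rintro v hv rfl; exact hv hy0
  have hvis : ∀ v, Function.update num y (cnt + 1) v ≠ 0 → v ≠ y → num v ≠ 0 := by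
    intro v hv hvy
    rwa [Function.update_of_ne hvy] at hv
  have hsy : s ≠ y := hne s (by rw [h.num_s]; omega)
  have hty : t ≠ y := hne t (by rw [h.num_t]; omega)
  have hcy : cur ≠ y := hne cur h.num_cur
  have hD := fun {w x : Fin n} => h.desc_update_iff (c := cnt + 1) (w := w) (x := x) hy0
  have hD' := fun {w : Fin n} => h.desc_update_new_iff (w := w) hy0 (Nat.succ_ne_zero cnt)
  have hvert : ∀ z, num z ≠ 0 → G.Adj y z → Desc s num par z cur := by
    intro z hz hyz
    by_cases hzs : z = s
    · rw [hzs]; exact h.desc_s h.num_cur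
    by_contra hd
    exact (h.scanned z y hz hzs (y.2.trans_le (h.finished z hz hzs hd)) hyz.symm).1 hy0
  refine ⟨?_, ?_, ?_, ?_, ?_, ?_, ?_, ?_, ?_, ?_, ?_⟩
  · rw [Function.update_of_ne hsy, h.num_s]
  · rw [Function.update_of_ne hty, h.num_t]
  · rw [Function.update_of_ne hty, h.par_t]
  · simp
  · intro v hv hs ht
    by_cases hvy : v = y
    · subst hvy
      rw [Function.update_self, Function.update_self, Function.update_of_ne hcy]
      exact ⟨hadj.symm, h.num_cur, Nat.lt_succ_of_le (hcnt cur), hcs⟩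
    · have h1 := h.par_spec v (hvis v hv hvy) hs ht
      rw [Function.update_of_ne hvy, Function.update_of_ne (hne _ h1.2.1),
        Function.update_of_ne hvy]
      exact h1
  · intro u v hu hv huv
    by_cases huy : u = y
    · subst huy
      have hvy := huv.ne'
      exact Or.inr (hD'.2 (Or.inr (hvert v (hvis v hv hvy) huv)))
    · by_cases hvy : v = y
      · subst hvy
        exact Or.inl (hD'.2 (Or.inr (hvert u (hvis u hu huy) huv.symm)))
      · rw [hD (hvis v hv hvy), hD (hvis u hu huy)]
        exact h.vertical u v (hvis u hu huy) (hvis v hv hvy) huv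
  · intro v j hv hs hj hvj
    by_cases hvy : v = y
    · subst hvy
      rw [Function.update_of_ne hcy.symm, hptr] at hj
      omega
    · have hv' := hvis v hv hvy
      rw [Function.update_of_ne hvy]
      by_cases hjy : j = y
      · subst hjy
        rw [Function.update_self]
        exact ⟨by omega, (h.low_le_num v hv' hs).trans ((hcnt v).trans (by omega))⟩
      · rw [Function.update_of_ne hjy]
        refine h.scanned v j hv' hs ?_ hvj
        by_cases hvc : v = cur
        · subst hvc
          rw [Function.update_self] at hj
          by_contra hlt
          exact hjy (Fin.ext (by omega))
        · rwa [Function.update_of_ne hvc] at hj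
  · intro v hv hs hd
    rw [hD', not_or] at hd
    rw [Function.update_of_ne (by rintro rfl; exact hd.2 Desc.refl)]
    exact h.finished v (hvis v hv hd.1) hs hd.2
  · intro v hv hs
    by_cases hvy : v = y
    · subst hvy
      rw [Function.update_self, Function.update_self]
    · rw [Function.update_of_ne hvy, Function.update_of_ne hvy]
      exact h.low_le_num v (hvis v hv hvy) hs
  · intro v hv hs ht hd
    rw [hD', not_or] at hd
    have hv' := hvis v hv hd.1
    rw [Function.update_of_ne hd.1, Function.update_of_ne (hne _ (h.num_par hv' hs).1),
      Function.update_of_ne hd.1]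
    exact h.low_par v hv' hs ht hd.2
  · intro v hv hs
    by_cases hvy : v = y
    · subst hvy
      rw [Function.update_self, Function.update_self]
      exact Or.inl rfl
    · have hv' := hvis v hv hvy
      rw [Function.update_of_ne hvy, Function.update_of_ne hvy]
      rcases h.low_attained v hv' hs with hl | ⟨x, z, hx, hxz, hz, hzl⟩
      · exact Or.inl hl
      · have hx0 : num x ≠ 0 := by
          cases hx with
          | refl => exact hv'
          | step hx _ _ => exact hx
        refine Or.inr ⟨x, z, (hD hx0).2 hx, hxz, ?_⟩
        rw [Function.update_of_ne (hne z hz)]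
        exact ⟨hz, hzl⟩

/-- Leaving a vertex that has been scanned completely. -/
theorem pop (h : DfsInv G s t cur num low ptr par) (hcs : cur ≠ s) (hptr : n ≤ ptr cur) :
    DfsInv G s t (par cur) num
      (Function.update low (par cur) (min (low (par cur)) (low cur))) ptr par := by
  obtain ⟨hp0, hplt⟩ := h.num_par h.num_cur hcs
  have hpc : cur ≠ par cur := by
    intro heq
    rw [← heq] at hplt
    omega
  have hle : ∀ v, Function.update low (par cur) (min (low (par cur)) (low cur)) v ≤ low v := by
    intro v
    rw [Function.update_apply]
    split_ifs with hv
    · rw [hv]; exact min_le_left _ _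
    · exact le_rfl
  have hD : ∀ v, ¬ Desc s num par v (par cur) → v = cur ∨ ¬ Desc s num par v cur := by
    intro v hv
    by_contra hno
    rw [not_or, not_not] at hno
    obtain ⟨hne, hd⟩ := hno
    cases hd with
    | refl => exact hne rfl
    | step _ _ hd => exact hv hd
  refine ⟨h.num_s, h.num_t, h.par_t, hp0, h.par_spec, h.vertical, ?_, ?_, ?_, ?_, ?_⟩
  · intro v j hv hs hj hvj
    have := h.scanned v j hv hs hj hvj
    exact ⟨this.1, (hle v).trans this.2⟩
  · intro v hv hs hd
    rcases hD v hd with rfl | hd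
    · exact hptr
    · exact h.finished v hv hs hd
  · exact fun v hv hs => (hle v).trans (h.low_le_num v hv hs)
  · intro v hv hs ht hd
    have hvp : v ≠ par cur := by rintro rfl; exact hd Desc.refl
    rw [Function.update_of_ne hvp]
    rcases hD v hd with rfl | hd
    · rw [Function.update_self]
      exact min_le_right _ _
    · exact (hle _).trans (h.low_par v hv hs ht hd)
  · intro v hv hs
    by_cases hvp : v = par cur
    · subst hvp
      rw [Function.update_self]
      rcases le_total (low (par cur)) (low cur) with hl | hl
      · rw [min_eq_left hl]
        exact h.low_attained _ hv hs
      · rw [min_eq_right hl]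
        have hct : cur ≠ t := by
          rintro rfl
          exact hs h.par_t
        rcases h.low_attained cur h.num_cur hcs with hl | ⟨x, z, hx, hxz, hz, hzl⟩
        · exact Or.inr ⟨par cur, cur, Desc.refl, (h.par_spec cur h.num_cur hcs hct).1.symm,
            h.num_cur, hl.symm⟩
        · exact Or.inr ⟨x, z, (Desc.step h.num_cur hcs Desc.refl).trans hx, hxz, hz, hzl⟩
    · rw [Function.update_of_ne hvp]
      exact h.low_attained v hv hs

/-- When the search is back at `s`, every other vertex has left the stack. -/
theorem dfsTree (h : DfsInv G s t s num low ptr par) : DfsTree G s t num par low := by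
  have hfin : ∀ v, num v ≠ 0 → v ≠ s → n ≤ ptr v := fun v hv hs =>
    h.finished v hv hs fun hd => hs (desc_root_iff.1 hd)
  refine ⟨h.num_s, h.num_t, h.par_t, h.par_spec, h.vertical, ?_, ?_, h.low_attained⟩
  · intro v y hv hs hvy
    exact (h.scanned v y hv hs (y.2.trans_le (hfin v hv hs)) hvy).1
  · intro v x y hv hs hd hxy
    have hlow : low v ≤ low x ∧ num x ≠ 0 ∧ x ≠ s := by
      clear hxy
      induction hd with
      | refl => exact ⟨le_rfl, hv, hs⟩
      | @step x hx hxs hd ih =>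
        have hxt : x ≠ t := by
          rintro rfl
          rw [h.par_t, desc_root_iff] at hd
          exact hs hd
        exact ⟨ih.1.trans (h.low_par x hx hxs hxt fun hd => hxs (desc_root_iff.1 hd)), hx, hxs⟩
    exact hlow.1.trans
      (h.scanned x y hlow.2.1 hlow.2.2 (y.2.trans_le (hfin x hlow.2.1 hlow.2.2)) hxy).2

end DfsInv

/-- A bound for the number of steps that remain: a scan uses up a pair and puts at most one vertex
on the stack, and every other step takes a vertex off the stack. -/
noncomputable def dfsMeasure (s cur : Fin n) (num ptr : Fin n → ℕ) (par : Fin n → Fin n) : ℕ :=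
  2 * ∑ v, (n - ptr v) + {v | Desc s num par v cur}.ncard

theorem dfsMeasure_le (s cur : Fin n) (num ptr : Fin n → ℕ) (par : Fin n → Fin n) :
    dfsMeasure s cur num ptr par ≤ 2 * (n * n) + n := by
  have h1 : ∑ v, (n - ptr v) ≤ ∑ _v : Fin n, n := Finset.sum_le_sum fun v _ => Nat.sub_le _ _
  have h2 : {v | Desc s num par v cur}.ncard ≤ n := by
    simpa using Set.ncard_le_card {v | Desc s num par v cur}
  simp only [Finset.sum_const, Finset.card_univ, Fintype.card_fin, smul_eq_mul] at h1
  unfold dfsMeasure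
  omega

theorem sum_sub_update {ptr : Fin n → ℕ} {cur : Fin n} (h : ptr cur < n) :
    ∑ v, (n - Function.update ptr cur (ptr cur + 1) v) + 1 = ∑ v, (n - ptr v) := by
  rw [← Finset.add_sum_erase _ _ (Finset.mem_univ cur),
    ← Finset.add_sum_erase (a := cur) _ (fun v => n - ptr v) (Finset.mem_univ cur),
    Function.update_self]
  have : ∑ v ∈ Finset.univ.erase cur, (n - Function.update ptr cur (ptr cur + 1) v) =
      ∑ v ∈ Finset.univ.erase cur, (n - ptr v) :=
    Finset.sum_congr rfl fun v hv => by rw [Function.update_of_ne (Finset.ne_of_mem_erase hv)]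
  omega

theorem dfsMeasure_scan {cur : Fin n} {num ptr : Fin n → ℕ} {par : Fin n → Fin n}
    (h : ptr cur < n) :
    dfsMeasure s cur num (Function.update ptr cur (ptr cur + 1)) par <
      dfsMeasure s cur num ptr par := by
  have := sum_sub_update h
  unfold dfsMeasure
  omega

theorem DfsInv.dfsMeasure_new {cur : Fin n} {num low ptr : Fin n → ℕ} {par : Fin n → Fin n}
    (h : DfsInv G s t cur num low ptr par) (hlt : ptr cur < n) {y : Fin n} (hy0 : num y = 0)
    {c : ℕ} (hc : c ≠ 0) :
    dfsMeasure s y (Function.update num y c) (Function.update ptr cur (ptr cur + 1))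
      (Function.update par y cur) < dfsMeasure s cur num ptr par := by
  have h1 := sum_sub_update hlt
  have h2 : {v | Desc s (Function.update num y c) (Function.update par y cur) v y} =
      insert y {v | Desc s num par v cur} := by
    ext v
    exact h.desc_update_new_iff hy0 hc
  have h3 := Set.ncard_insert_le y {v | Desc s num par v cur}
  unfold dfsMeasure
  rw [h2]
  omega

theorem DfsInv.dfsMeasure_pop {cur : Fin n} {num low ptr : Fin n → ℕ} {par : Fin n → Fin n}
    (h : DfsInv G s t cur num low ptr par) (hcs : cur ≠ s) :
    dfsMeasure s (par cur) num ptr par < dfsMeasure s cur num ptr par := by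
  have h1 : {v | Desc s num par v (par cur)} ⊂ {v | Desc s num par v cur} := by
    refine ⟨fun v hv => Desc.step h.num_cur hcs hv, fun hsub => ?_⟩
    have h2 := h.num_par h.num_cur hcs
    have h3 := h.visited_of_desc h2.1 (hsub (a := cur) Desc.refl)
    omega
  have := Set.ncard_lt_ncard h1
  unfold dfsMeasure
  omega

end DfsRun

end Tracking

namespace Ram

/-! ### Reasoning about programs -/

/-- The state after setting a register. -/
def State.setReg (σ : State) (r v : ℕ) : State :=
  { σ with reg := Function.update σ.reg r v }

/-- The state after writing a cell. -/
def State.setCell (σ : State) (b a v : ℕ) : State :=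
  { σ with cell := Function.update σ.cell b (Function.update (σ.cell b) a v) }

@[simp] theorem State.setReg_reg (σ : State) (r v r' : ℕ) :
    (σ.setReg r v).reg r' = if r' = r then v else σ.reg r' := Function.update_apply _ _ _ _

@[simp] theorem State.setReg_cell (σ : State) (r v : ℕ) : (σ.setReg r v).cell = σ.cell := rfl

@[simp] theorem State.setCell_reg (σ : State) (b a v : ℕ) : (σ.setCell b a v).reg = σ.reg := rfl

@[simp] theorem State.setCell_cell (σ : State) (b a v b' : ℕ) :
    (σ.setCell b a v).cell b' = if b' = b then Function.update (σ.cell b) a v else σ.cell b' :=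
  Function.update_apply _ _ _ _

/-! The equations below are kept from being used as definitional ones by the parentheses around
`rfl`, so that `simp` treats the decidability instances of tests correctly. -/

section Equations

variable (σ : State) (B : ℕ) (a b : Expr)

@[simp] theorem eval_lit (k : ℕ) : (Expr.lit k).eval σ = k := (rfl)
@[simp] theorem eval_reg (r : ℕ) : (Expr.reg r).eval σ = σ.reg r := (rfl)
@[simp] theorem eval_read (b : ℕ) : (Expr.read b a).eval σ = σ.cell b (a.eval σ) := (rfl)
@[simp] theorem eval_add : (Expr.op .add a b).eval σ = a.eval σ + b.eval σ := (rfl)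
@[simp] theorem eval_sub : (Expr.op .sub a b).eval σ = a.eval σ - b.eval σ := (rfl)
@[simp] theorem eval_mul : (Expr.op .mul a b).eval σ = a.eval σ * b.eval σ := (rfl)
@[simp] theorem eval_div : (Expr.op .div a b).eval σ = a.eval σ / b.eval σ := (rfl)
@[simp] theorem eval_lt :
    (Expr.op .lt a b).eval σ = if a.eval σ < b.eval σ then 1 else 0 := (rfl)
@[simp] theorem eval_eq :
    (Expr.op .eq a b).eval σ = if a.eval σ = b.eval σ then 1 else 0 := (rfl)

@[simp] theorem fits_lit (k : ℕ) : (Expr.lit k).Fits B σ ↔ k < B := Iff.rfl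
@[simp] theorem fits_reg (r : ℕ) : (Expr.reg r).Fits B σ ↔ σ.reg r < B := Iff.rfl
@[simp] theorem fits_read (b : ℕ) :
    (Expr.read b a).Fits B σ ↔ a.Fits B σ ∧ σ.cell b (a.eval σ) < B := Iff.rfl
@[simp] theorem fits_op (o : Op) :
    (Expr.op o a b).Fits B σ ↔ a.Fits B σ ∧ b.Fits B σ ∧ (Expr.op o a b).eval σ < B := Iff.rfl

end Equations

theorem ite_one_zero_lt {B : ℕ} (h : 1 < B) (P : Prop) [Decidable P] :
    (if P then 1 else 0) < B := by
  split_ifs <;> omega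

/-- Whether a program contains an assignment to the register `r`. -/
def Prog.setsReg (r : ℕ) : Prog → Bool
  | .skip => false
  | .set r' _ => r' == r
  | .write _ _ _ => false
  | .seq p q => p.setsReg r || q.setsReg r
  | .ite _ p q => p.setsReg r || q.setsReg r
  | .loop _ p => p.setsReg r

/-- Whether a program contains a write to the bank `b`. -/
def Prog.writesBank (b : ℕ) : Prog → Bool
  | .skip => false
  | .set _ _ => false
  | .write b' _ _ => b' == b
  | .seq p q => p.writesBank b || q.writesBank b
  | .ite _ p q => p.writesBank b || q.writesBank b
  | .loop _ p => p.writesBank b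

/-- The states `σ` and `τ` differ only in registers and banks that `p` mentions as targets. -/
structure Frame (p : Prog) (σ τ : State) : Prop where
  reg : ∀ r, p.setsReg r = false → τ.reg r = σ.reg r
  cell : ∀ b, p.writesBank b = false → τ.cell b = σ.cell b

theorem Frame.refl (p : Prog) (σ : State) : Frame p σ σ := ⟨fun _ _ => rfl, fun _ _ => rfl⟩

theorem Frame.trans {p : Prog} {σ τ υ : State} (h : Frame p σ τ) (h' : Frame p τ υ) :
    Frame p σ υ :=
  ⟨fun r hr => (h'.reg r hr).trans (h.reg r hr), fun b hb => (h'.cell b hb).trans (h.cell b hb)⟩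

theorem Exec.frame {B : ℕ} {p : Prog} {σ τ : State} {m : ℕ} (h : Exec B p σ m τ) :
    Frame p σ τ := by
  induction h with
  | skip => exact Frame.refl _ _
  | set r e σ h =>
    refine ⟨fun r' hr' => ?_, fun _ _ => rfl⟩
    exact Function.update_of_ne (by rintro rfl; simp [Prog.setsReg] at hr') _ _
  | write b a e σ =>
    refine ⟨fun _ _ => rfl, fun b' hb' => ?_⟩
    exact Function.update_of_ne (by rintro rfl; simp [Prog.writesBank] at hb') _ _
  | seq _ _ ih₁ ih₂ =>
    constructor
    · intro r hr
      rw [Prog.setsReg, Bool.or_eq_false_iff] at hr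
      exact (ih₂.reg r hr.2).trans (ih₁.reg r hr.1)
    · intro b hb
      rw [Prog.writesBank, Bool.or_eq_false_iff] at hb
      exact (ih₂.cell b hb.2).trans (ih₁.cell b hb.1)
  | ite_true _ _ _ ih =>
    constructor
    · intro r hr
      rw [Prog.setsReg, Bool.or_eq_false_iff] at hr
      exact ih.reg r hr.1
    · intro b hb
      rw [Prog.writesBank, Bool.or_eq_false_iff] at hb
      exact ih.cell b hb.1
  | ite_false _ _ _ ih =>
    constructor
    · intro r hr
      rw [Prog.setsReg, Bool.or_eq_false_iff] at hr
      exact ih.reg r hr.2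
    · intro b hb
      rw [Prog.writesBank, Bool.or_eq_false_iff] at hb
      exact ih.cell b hb.2
  | loop_stop => exact Frame.refl _ _
  | loop_step _ _ _ _ ih₁ ih₂ =>
    exact Frame.trans ⟨ih₁.reg, ih₁.cell⟩ ih₂

/-- Total correctness with a time bound: started in `σ`, the program `p` halts after at most `c`
steps in a state that satisfies `Q`. -/
def Runs (B : ℕ) (p : Prog) (σ : State) (c : ℕ) (Q : State → Prop) : Prop :=
  ∃ m τ, Exec B p σ m τ ∧ m ≤ c ∧ Q τ

theorem Runs.mono {B : ℕ} {p : Prog} {σ : State} {c c' : ℕ} {Q Q' : State → Prop}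
    (h : Runs B p σ c Q) (hc : c ≤ c') (hQ : ∀ τ, Q τ → Q' τ) : Runs B p σ c' Q' := by
  obtain ⟨m, τ, he, hm, hτ⟩ := h
  exact ⟨m, τ, he, hm.trans hc, hQ τ hτ⟩

theorem Runs.frame {B : ℕ} {p : Prog} {σ : State} {c : ℕ} {Q : State → Prop}
    (h : Runs B p σ c Q) : Runs B p σ c (fun τ => Frame p σ τ ∧ Q τ) := by
  obtain ⟨m, τ, he, hm, hτ⟩ := h
  exact ⟨m, τ, he, hm, he.frame, hτ⟩

theorem Runs.seq {B : ℕ} {p q : Prog} {σ : State} {c d : ℕ} {R Q : State → Prop}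
    (hp : Runs B p σ c R) (hq : ∀ τ, Frame p σ τ → R τ → Runs B q τ d Q) :
    Runs B (.seq p q) σ (c + d) Q := by
  obtain ⟨m, τ, he, hm, hfr, hτ⟩ := hp.frame
  obtain ⟨m', υ, he', hm', hυ⟩ := hq τ hfr hτ
  exact ⟨m + m', υ, Exec.seq he he', by omega, hυ⟩

theorem Runs.ite {B : ℕ} {e : Expr} {p q : Prog} {σ : State} {c d : ℕ} {Q : State → Prop}
    (hf : e.Fits B σ) (hp : e.eval σ ≠ 0 → Runs B p σ c Q) (hq : e.eval σ = 0 → Runs B q σ d Q) :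
    Runs B (.ite e p q) σ (e.cost + 1 + max c d) Q := by
  by_cases he : e.eval σ = 0
  · obtain ⟨m, τ, h, hm, hQ⟩ := hq he
    have := le_max_right c d
    exact ⟨_, τ, Exec.ite_false hf he h, by omega, hQ⟩
  · obtain ⟨m, τ, h, hm, hQ⟩ := hp he
    have := le_max_left c d
    exact ⟨_, τ, Exec.ite_true hf he h, by omega, hQ⟩

/-- The weakest precondition of a program without loops. -/
def wp (B : ℕ) : Prog → State → (State → Prop) → Prop
  | .skip, σ, Q => Q σ
  | .set r e, σ, Q => e.Fits B σ ∧ Q (σ.setReg r (e.eval σ))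
  | .write b a e, σ, Q => a.Fits B σ ∧ e.Fits B σ ∧ Q (σ.setCell b (a.eval σ) (e.eval σ))
  | .seq p q, σ, Q => wp B p σ fun τ => wp B q τ Q
  | .ite e p q, σ, Q => e.Fits B σ ∧ (e.eval σ ≠ 0 → wp B p σ Q) ∧ (e.eval σ = 0 → wp B q σ Q)
  | .loop _ _, _, _ => False

section

variable (B : ℕ) (σ : State) (Q : State → Prop)

@[simp] theorem wp_skip : wp B .skip σ Q ↔ Q σ := Iff.rfl
@[simp] theorem wp_set (r : ℕ) (e : Expr) :
    wp B (.set r e) σ Q ↔ e.Fits B σ ∧ Q (σ.setReg r (e.eval σ)) := Iff.rfl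
@[simp] theorem wp_write (b : ℕ) (a e : Expr) :
    wp B (.write b a e) σ Q ↔
      a.Fits B σ ∧ e.Fits B σ ∧ Q (σ.setCell b (a.eval σ) (e.eval σ)) := Iff.rfl
@[simp] theorem wp_seq (p q : Prog) :
    wp B (.seq p q) σ Q ↔ wp B p σ fun τ => wp B q τ Q := Iff.rfl
@[simp] theorem wp_ite (e : Expr) (p q : Prog) :
    wp B (.ite e p q) σ Q ↔
      e.Fits B σ ∧ (e.eval σ ≠ 0 → wp B p σ Q) ∧ (e.eval σ = 0 → wp B q σ Q) := Iff.rfl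

end

/-- The largest number of steps of a program without loops. -/
def Prog.cost : Prog → ℕ
  | .skip => 1
  | .set _ e => e.cost + 1
  | .write _ a e => a.cost + e.cost + 1
  | .seq p q => p.cost + q.cost
  | .ite e p q => e.cost + 1 + max p.cost q.cost
  | .loop _ _ => 0

theorem Runs.of_wp {B : ℕ} {p : Prog} {σ : State} {Q : State → Prop} (h : wp B p σ Q) :
    Runs B p σ p.cost Q := by
  induction p generalizing σ Q with
  | skip => exact ⟨1, σ, Exec.skip σ, le_rfl, h⟩
  | set r e => exact ⟨_, _, Exec.set r e σ h.1, le_rfl, h.2⟩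
  | write b a e => exact ⟨_, _, Exec.write b a e σ h.1 h.2.1, le_rfl, h.2.2⟩
  | seq p q ihp ihq => exact (ihp h).seq fun τ _ hτ => ihq hτ
  | ite e p q ihp ihq => exact Runs.ite h.1 (fun he => ihp (h.2.1 he)) fun he => ihq (h.2.2 he)
  | loop e p => exact h.elim

/-- Loops, with a natural number that bounds the number of rounds to come. -/
theorem Runs.loop {B : ℕ} {e : Expr} {p : Prog} {c : ℕ} (I : ℕ → State → Prop)
    (hf : ∀ k σ, I k σ → e.Fits B σ)
    (hp : ∀ k σ, I k σ → e.eval σ ≠ 0 → Runs B p σ c fun τ => ∃ k' < k, I k' τ)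
    {k : ℕ} {σ : State} (h : I k σ) :
    Runs B (.loop e p) σ (k * (c + e.cost + 1) + (e.cost + 1))
      fun τ => (∃ k, I k τ) ∧ e.eval τ = 0 := by
  induction k using Nat.strong_induction_on generalizing σ with
  | _ k ih =>
    by_cases he : e.eval σ = 0
    · exact ⟨_, σ, Exec.loop_stop (hf k σ h) he, by omega, ⟨k, h⟩, he⟩
    · obtain ⟨m, τ, hx, hm, k', hk', hI⟩ := hp k σ h he
      obtain ⟨m', υ, hx', hm', hυ⟩ := ih k' hk' hI
      refine ⟨_, υ, Exec.loop_step (hf k σ h) he hx hx', ?_, hυ⟩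
      have : (k' + 1) * (c + e.cost + 1) ≤ k * (c + e.cost + 1) := Nat.mul_le_mul_right _ hk'
      rw [add_mul, one_mul] at this
      omega

/-- The loop that runs `body` with the register `r` going from `0` up to `n - 1`, where register
`0` holds `n`. -/
def forUp (r : ℕ) (body : Prog) : Prog :=
  .seq (.set r (.lit 0)) (.loop (.op .lt (.reg r) (.reg 0))
    (.seq body (.set r (.op .add (.reg r) (.lit 1)))))

theorem Runs.forUp {B r n c : ℕ} {body : Prog} {σ : State} (I : ℕ → State → Prop)
    (hn : σ.reg 0 = n) (hB : n + 1 < B) (hr : body.setsReg r = false)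
    (h0 : body.setsReg 0 = false) (hr0 : r ≠ 0)
    (hI : ∀ i x τ, I i τ → I i (τ.setReg r x)) (hinit : I 0 σ)
    (hstep : ∀ i < n, ∀ τ, Frame (Ram.forUp r body) σ τ → τ.reg r = i → I i τ →
      Runs B body τ c (I (i + 1))) :
    Runs B (forUp r body) σ (n * (c + 8) + 6) (I n) := by
  have hsets : ∀ r', r' ≠ r → body.setsReg r' = false → (Ram.forUp r body).setsReg r' = false := by
    intro r' hr' hb
    simp [Ram.forUp, Prog.setsReg, hb, hr'.symm]
  have hfset : ∀ (τ : State) x, Frame (Ram.forUp r body) τ (τ.setReg r x) := by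
    refine fun τ x => ⟨fun r' hr' => ?_, fun _ _ => rfl⟩
    have : r' ≠ r := by rintro rfl; simp [Ram.forUp, Prog.setsReg] at hr'
    simp [this]
  have hfbody : ∀ τ υ, Frame body τ υ → Frame (Ram.forUp r body) τ υ := by
    refine fun τ υ h => ⟨fun r' hr' => h.reg r' ?_, fun b hb => h.cell b ?_⟩
    · simp only [Ram.forUp, Prog.setsReg, Bool.or_eq_false_iff] at hr'
      exact hr'.2.1
    · simp only [Ram.forUp, Prog.writesBank, Bool.or_eq_false_iff] at hb
      exact hb.2.1
  let J : ℕ → State → Prop := fun k τ => Frame (Ram.forUp r body) σ τ ∧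
    ∃ i ≤ n, τ.reg r = i ∧ k + i = n ∧ I i τ
  have hreg0 : ∀ τ, Frame (Ram.forUp r body) σ τ → τ.reg 0 = n := fun τ h =>
    (h.reg 0 (hsets 0 hr0.symm h0)).trans hn
  have hset : Runs B (.set r (.lit 0)) σ 2 (fun τ => J n τ) := by
    refine (Runs.of_wp (p := .set r (.lit 0)) (Q := fun τ => J n τ) ⟨?_, ?_⟩).mono le_rfl
      fun _ h => h
    · exact (Nat.zero_le _).trans_lt hB
    · exact ⟨hfset _ _, 0, Nat.zero_le _, by simp, rfl, hI _ _ _ hinit⟩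
  have hloop := fun τ (hτ : J n τ) => Runs.loop (B := B) (e := .op .lt (.reg r) (.reg 0))
    (p := .seq body (.set r (.op .add (.reg r) (.lit 1)))) (c := c + 4) J
    (by
      rintro k τ ⟨hfr, i, hi, hri, hk, -⟩
      have h1 := hreg0 τ hfr
      simp only [fits_op, fits_reg, eval_lt]
      exact ⟨by omega, by omega, ite_one_zero_lt (by omega) _⟩)
    (by
      rintro k τ ⟨hfr, i, hi, hri, hk, hIi⟩ he
      have h1 := hreg0 τ hfr
      have hlt : i < n := by
        simp only [eval_lt, eval_reg, hri, h1] at he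
        by_contra hge
        rw [if_neg hge] at he
        exact he rfl
      refine (hstep i hlt τ hfr hri hIi).seq (fun υ hυ hIυ => ?_)
      have h2 : υ.reg r = i := (hυ.reg r hr).trans hri
      refine (Runs.of_wp (p := .set r (.op .add (.reg r) (.lit 1)))
        (Q := fun υ => ∃ k' < k, J k' υ) ⟨?_, ?_⟩).mono le_rfl fun _ h => h
      · simp only [fits_op, fits_reg, fits_lit, eval_add, eval_reg, eval_lit, h2]
        omega
      · refine ⟨k - 1, by omega, (hfr.trans (hfbody _ _ hυ)).trans (hfset _ _), i + 1, hlt, ?_,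
          by omega, hI _ _ _ hIυ⟩
        simp [h2])
    hτ
  refine (hset.seq fun τ _ hτ => (hloop τ hτ).mono le_rfl (Q' := I n) ?_).mono ?_ fun _ h => h
  · rintro υ ⟨⟨k, hfr, i, hi, hri, hk, hIi⟩, he⟩
    have h1 := hreg0 υ hfr
    have : i = n := by
      by_contra hne
      simp only [eval_lt, eval_reg, hri, h1] at he
      rw [if_pos (by omega)] at he
      exact one_ne_zero he
    exact this ▸ hIi
  · simp only [Expr.cost]
    have : n * (c + 4 + (1 + 1 + 1) + 1) = n * (c + 8) := by ring
    omega

end Ram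

-- Weakest preconditions are computed by `simp` with one list of facts for all branches.
set_option linter.unusedSimpArgs false

namespace Tracking

open SimpleGraph Ram

/-! ### The program: depth-first search -/

local infixl:65 " +ₑ " => Expr.op Op.add
local infixl:65 " -ₑ " => Expr.op Op.sub
local infixl:70 " *ₑ " => Expr.op Op.mul
local infixl:70 " /ₑ " => Expr.op Op.div
local infix:50 " <ₑ " => Expr.op Op.lt
local infix:50 " =ₑ " => Expr.op Op.eq
local infixr:30 " ⨾ " => Prog.seq

open Ram.Expr (lit reg read)

/-- The start of the search. The current vertex is in register `3` and the number of visited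
vertices in register `4`. The banks `2` to `6` hold, for each vertex, the next neighbour to scan, the
parent, the number (`0` for a vertex not visited), the lowpoint, and the visited vertices in order. -/
def dfsInit : Prog :=
  .write 4 (reg 1) (lit 1) ⨾ .write 4 (reg 2) (lit 2) ⨾ .write 3 (reg 2) (reg 1) ⨾
  .write 5 (reg 2) (lit 2) ⨾ .write 6 (lit 0) (reg 1) ⨾ .write 6 (lit 1) (reg 2) ⨾
  .set 3 (reg 2) ⨾ .set 4 (lit 2)

/-- One step of the search: scan one pair of vertices, or go back to the parent. -/
def dfsBody : Prog :=
  .ite (read 2 (reg 3) <ₑ reg 0)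
    (.set 5 (read 2 (reg 3)) ⨾ .write 2 (reg 3) (reg 5 +ₑ lit 1) ⨾
      .ite (read 0 (reg 3 *ₑ reg 0 +ₑ reg 5))
        (.ite (read 4 (reg 5))
          (.ite (read 4 (reg 5) <ₑ read 5 (reg 3)) (.write 5 (reg 3) (read 4 (reg 5))) .skip)
          (.write 3 (reg 5) (reg 3) ⨾ .write 6 (reg 4) (reg 5) ⨾ .set 4 (reg 4 +ₑ lit 1) ⨾
            .write 4 (reg 5) (reg 4) ⨾ .write 5 (reg 5) (reg 4) ⨾ .set 3 (reg 5)))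
        .skip)
    (.set 5 (read 3 (reg 3)) ⨾
      .ite (read 5 (reg 3) <ₑ read 5 (reg 5)) (.write 5 (reg 5) (read 5 (reg 3))) .skip ⨾
      .set 3 (reg 5))

/-- Depth-first search from `t` until it is back at `s`. -/
def dfs : Prog := dfsInit ⨾ .loop ((reg 3 =ₑ reg 1) =ₑ lit 0) dfsBody

section

variable {n B : ℕ} {G : SimpleGraph (Fin n)} [DecidableRel G.Adj] {s t : Fin n}

variable (G s t) in
/-- The numbers `n`, `s`, `t` and the adjacency matrix of `G` are in memory at the places of the
input. -/
structure HasInput (σ : State) : Prop where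
  reg0 : σ.reg 0 = n
  reg1 : σ.reg 1 = s
  reg2 : σ.reg 2 = t
  adj : ∀ u v : Fin n, σ.cell 0 (u * n + v) = if G.Adj u v then 1 else 0

theorem HasInput.of_frame {p : Prog} {σ τ : State} (h : HasInput G s t σ) (hf : Frame p σ τ)
    (h0 : p.setsReg 0 = false) (h1 : p.setsReg 1 = false) (h2 : p.setsReg 2 = false)
    (hb : p.writesBank 0 = false) : HasInput G s t τ where
  reg0 := (hf.reg 0 h0).trans h.reg0
  reg1 := (hf.reg 1 h1).trans h.reg1
  reg2 := (hf.reg 2 h2).trans h.reg2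
  adj u v := by rw [hf.cell 0 hb]; exact h.adj u v

theorem mul_add_lt (u v : Fin n) : (u : ℕ) * n + v < n * n := by
  have h1 : ((u : ℕ) + 1) * n ≤ n * n := Nat.mul_le_mul_right n u.2
  rw [add_mul, one_mul] at h1
  have := v.2
  omega

theorem le_mul_self_of_fin (u : Fin n) : n ≤ n * n := Nat.le_mul_of_pos_left n u.pos

theorem update_val_apply {f : Fin n → ℕ} {a : ℕ → ℕ} (h : ∀ v : Fin n, a v = f v) (x : Fin n)
    (c : ℕ) (v : Fin n) : Function.update a x c v = Function.update f x c v := by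
  simp only [Function.update_apply, h, Fin.val_inj]

/-- The memory holds the state of the search. -/
structure DfsRep (σ : State) (cur : Fin n) (cnt : ℕ) (num low ptr : Fin n → ℕ)
    (par : Fin n → Fin n) : Prop where
  reg3 : σ.reg 3 = cur
  reg4 : σ.reg 4 = cnt
  ptr_eq : ∀ v : Fin n, σ.cell 2 v = ptr v
  par_eq : ∀ v : Fin n, σ.cell 3 v = par v
  num_eq : ∀ v : Fin n, σ.cell 4 v = num v
  low_eq : ∀ v : Fin n, σ.cell 5 v = low v
  numbering : Numbering cnt num (σ.cell 6)
  ptr_le : ∀ v, ptr v ≤ n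
  low_le : ∀ v, low v ≤ n
  ptr_zero : ∀ v, num v = 0 → ptr v = 0

theorem dfsBody_runs (hB : 4 * (n * n) + 20 ≤ B) {σ : State} {cur : Fin n} {cnt : ℕ}
    {num low ptr : Fin n → ℕ} {par : Fin n → Fin n} (hin : HasInput G s t σ)
    (hrep : DfsRep σ cur cnt num low ptr par) (hinv : DfsInv G s t cur num low ptr par)
    (hcs : cur ≠ s) {Q : State → Prop}
    (hQ : ∀ τ cur' cnt' num' low' ptr' par', DfsRep τ cur' cnt' num' low' ptr' par' →
      DfsInv G s t cur' num' low' ptr' par' →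
      dfsMeasure s cur' num' ptr' par' < dfsMeasure s cur num ptr par → Q τ) :
    Runs B dfsBody σ 60 Q := by
  have hnn := le_mul_self_of_fin s
  have h1B : 1 < B := by omega
  have h0B : 0 < B := by omega
  have hnB : n < B := by omega
  have hite := fun P [Decidable P] => ite_one_zero_lt h1B P
  have hcnt := hrep.numbering.cnt_le
  have hn := hin.reg0
  obtain ⟨h3, h4, hptr, hpar, hnum, hlow, hN, hptrle, hlowle, hptr0⟩ := hrep
  have hvB : ∀ v : Fin n, (v : ℕ) < B := fun v => v.2.trans hnB
  have hvB1 : ∀ v : Fin n, (v : ℕ) + 1 < B := fun v => by have := v.2; omega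
  have hnumB : ∀ v, num v < B := fun v => by have := hN.le_cnt v; omega
  have hlowB : ∀ v, low v < B := fun v => (hlowle v).trans_lt hnB
  have hptrB : ∀ v, ptr v < B := fun v => (hptrle v).trans_lt hnB
  have hcB : cnt < B := by omega
  have hcB1 : cnt + 1 < B := by omega
  refine (Runs.of_wp (p := dfsBody) ?_).mono (by decide) fun _ h => h
  by_cases hlt : ptr cur < n
  · obtain ⟨y, hy⟩ : ∃ y : Fin n, ptr cur = y := ⟨⟨ptr cur, hlt⟩, rfl⟩
    have hyn := y.2
    have hmul := mul_add_lt cur y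
    have hmeas := dfsMeasure_scan (s := s) (cur := cur) (num := num) (par := par) hlt
    have hadj := hin.adj cur y
    have hB1 : (cur : ℕ) * n < B := by omega
    have hB2 : (cur : ℕ) * n + y < B := by omega
    have hptr' : ∀ v, Function.update ptr cur (ptr cur + 1) v ≤ n := by
      intro v
      rw [Function.update_apply]
      split_ifs
      · omega
      · exact hptrle v
    have hptr0' : ∀ v, num v = 0 → Function.update ptr cur (ptr cur + 1) v = 0 := by
      intro v hv
      rw [Function.update_of_ne (by rintro rfl; exact hinv.num_cur hv)]
      exact hptr0 v hv
    by_cases hA : G.Adj cur y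
    · by_cases hy0 : num y = 0
      · simp [dfsBody, h3, h4, hptr, hnum, hlow, hn, hadj, hy, hA, hite, hyn, hB1, hB2, hy0,
          h1B, h0B, hnB, hvB, hvB1, hcB, hcB1]
        refine hQ _ y (cnt + 1) _ _ _ _ ⟨?_, ?_, ?_, ?_, ?_, ?_, ?_, ?_, ?_, ?_⟩
          (hinv.scan_new hy (hptr0 y hy0) hcs hA hy0 hN.le_cnt)
          (hinv.dfsMeasure_new hlt hy0 (Nat.succ_ne_zero cnt))
        · simp
        · simp
        · intro v
          simpa [hy] using update_val_apply hptr cur (ptr cur + 1) v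
        · intro v
          simp only [State.setReg_cell, State.setCell_cell]
          simp only [reduceCtorEq, OfNat.ofNat_eq_ofNat, Nat.reduceEqDiff, if_true, if_false]
          rw [update_val_apply (f := fun v => (par v : ℕ)) hpar, Function.update_apply,
            Function.update_apply]
          split_ifs <;> rfl
        · intro v
          simpa using update_val_apply hnum y (cnt + 1) v
        · intro v
          simpa using update_val_apply hlow y (cnt + 1) v
        · simpa using hN.insert hy0
        · exact hptr'
        · intro v
          have := hN.lt hy0
          rw [Function.update_apply]
          split_ifs
          · omega
          · exact hlowle v
        · intro v hv
          refine hptr0' v ?_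
          by_contra hv0
          rw [Function.update_apply] at hv
          split_ifs at hv
          · exact hv0 hv
      · have key : ∀ τ : State, τ.reg 3 = cur → τ.reg 4 = cnt →
            τ.cell 2 = Function.update (σ.cell 2) cur (y + 1) → τ.cell 3 = σ.cell 3 →
            τ.cell 4 = σ.cell 4 → τ.cell 6 = σ.cell 6 →
            (∀ v : Fin n, τ.cell 5 v = Function.update low cur (min (low cur) (num y)) v) →
            Q τ := by
          intro τ t3 t4 c2 c3 c4 c6 c5
          refine hQ _ cur cnt num _ _ par ⟨t3, t4, ?_, ?_, ?_, c5, ?_, hptr', ?_, hptr0'⟩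
            (hinv.scan_visited hy hA hy0) hmeas
          · intro v
            rw [c2, ← hy]
            exact update_val_apply hptr cur (ptr cur + 1) v
          · rwa [c3]
          · rwa [c4]
          · rwa [c6]
          · intro v
            rw [Function.update_apply]
            split_ifs
            · exact (min_le_left _ _).trans (hlowle _)
            · exact hlowle v
        simp [dfsBody, h3, h4, hptr, hnum, hlow, hn, hadj, hy, hA, hite, hyn, hB1, hB2, hy0,
          h1B, h0B, hnB, hvB, hvB1, hcB, hnumB, hlowB]
        refine ⟨fun hl => ?_, fun hl => ?_⟩
        · refine key _ (by simp [h3]) (by simp [h4]) (by simp) (by simp) (by simp) (by simp) ?_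
          intro v
          rw [min_eq_right hl.le]
          simpa using update_val_apply hlow cur (num y) v
        · refine key _ (by simp [h3]) (by simp [h4]) (by simp) (by simp) (by simp) (by simp) ?_
          intro v
          rw [min_eq_left hl, Function.update_eq_self]
          simpa using hlow v
    · simp [dfsBody, h3, h4, hptr, hnum, hlow, hn, hadj, hy, hA, hite, hyn, hB1, hB2,
        h1B, h0B, hnB, hvB, hvB1, hcB]
      refine hQ _ cur cnt num low _ par ⟨?_, ?_, ?_, ?_, ?_, ?_, ?_, hptr', hlowle, hptr0'⟩
        (hinv.scan_nonadj hy hA) hmeas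
      · simpa using h3
      · simpa using h4
      · intro v
        simpa [hy] using update_val_apply hptr cur (ptr cur + 1) v
      · simpa using hpar
      · simpa using hnum
      · simpa using hlow
      · simpa using hN
  · have key : ∀ τ : State, τ.reg 3 = par cur → τ.reg 4 = cnt →
        τ.cell 2 = σ.cell 2 → τ.cell 3 = σ.cell 3 → τ.cell 4 = σ.cell 4 → τ.cell 6 = σ.cell 6 →
        (∀ v : Fin n, τ.cell 5 v =
          Function.update low (par cur) (min (low (par cur)) (low cur)) v) →
        Q τ := by
      intro τ t3 t4 c2 c3 c4 c6 c5
      refine hQ _ (par cur) cnt num _ ptr par ⟨t3, t4, ?_, ?_, ?_, c5, ?_, hptrle, ?_, hptr0⟩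
        (hinv.pop hcs (not_lt.1 hlt)) (hinv.dfsMeasure_pop hcs)
      · rwa [c2]
      · rwa [c3]
      · rwa [c4]
      · rwa [c6]
      · intro v
        rw [Function.update_apply]
        split_ifs
        · exact (min_le_left _ _).trans (hlowle _)
        · exact hlowle v
    simp [dfsBody, h3, h4, hptr, hnum, hlow, hn, hite, hlt, hpar, h1B, h0B, hnB, hvB, hptrB,
      hlowB]
    refine ⟨fun hl => ?_, fun hl => ?_⟩
    · refine key _ (by simp) (by simp [h4]) (by simp) (by simp) (by simp) (by simp) ?_
      intro v
      rw [min_eq_right hl.le]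
      simpa using update_val_apply hlow (par cur) (low cur) v
    · refine key _ (by simp) (by simp [h4]) (by simp) (by simp) (by simp) (by simp) ?_
      intro v
      rw [min_eq_left hl, Function.update_eq_self]
      simpa using hlow v

theorem dfs_runs (hB : 4 * (n * n) + 20 ≤ B) (hst : s ≠ t) {σ : State} (hin : HasInput G s t σ)
    (hzero : ∀ b, b ≠ 0 → σ.cell b = fun _ => 0) :
    Runs B dfs σ (300 * (n * n)) fun τ => ∃ cnt num low ptr par,
      DfsRep τ s cnt num low ptr par ∧ DfsTree G s t num par low := by
  have hnn := le_mul_self_of_fin s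
  have h1B : 1 < B := by omega
  have h0B : 0 < B := by omega
  have hnB : n < B := by omega
  have h2B : 2 < B := by omega
  have hn2 : 2 ≤ n := by
    have h1 := s.2
    have h2 := t.2
    by_contra hlt
    exact hst (Fin.ext (by omega))
  have hvB : ∀ v : Fin n, (v : ℕ) < B := fun v => v.2.trans hnB
  let num₀ : Fin n → ℕ := fun v => if v = s then 1 else if v = t then 2 else 0
  let par₀ : Fin n → Fin n := fun v => if v = t then s else ⟨0, s.pos⟩
  let low₀ : Fin n → ℕ := fun v => if v = t then 2 else 0
  have hinit : Runs B dfsInit σ 30 fun τ => DfsRep τ t 2 num₀ low₀ (fun _ => 0) par₀ := by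
    refine (Runs.of_wp (p := dfsInit) ?_).mono (by decide) fun _ h => h
    simp [dfsInit, hin.reg1, hin.reg2, h0B, h1B, h2B, hvB]
    have hval : ∀ a b : Fin n, ((a : ℕ) = b) ↔ a = b := fun a b => Fin.val_inj
    refine ⟨?_, ?_, ?_, ?_, ?_, ?_, ?_, ?_, ?_, ?_⟩
    · simp
    · simp
    · intro v; simp [hzero]
    · intro v
      simp only [State.setReg_cell, State.setCell_cell]
      simp [hzero, Function.update_apply, Fin.val_inj, par₀]
      split_ifs <;> rfl
    · intro v
      simp [hzero, Function.update_apply, Fin.val_inj, num₀]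
      grind
    · intro v
      simp [hzero, Function.update_apply, Fin.val_inj, low₀]
    · simp [hzero]
      refine ⟨?_, ?_, ?_⟩
      · intro v
        simp only [num₀]
        split_ifs <;> omega
      · intro v hv
        simp only [num₀] at hv ⊢
        split_ifs at hv ⊢ with h1 h2
        · simp [h1, Function.update_apply]
        · simp [h2, Function.update_apply]
        · exact absurd rfl hv
      · intro i hi
        interval_cases i
        · exact ⟨s, by simp [num₀], by simp [Function.update_apply]⟩
        · exact ⟨t, by simp [num₀, hst.symm], by simp [Function.update_apply]⟩
    · intro v; omega
    · intro v
      simp only [low₀]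
      split_ifs <;> omega
    · simp
  have hinv₀ : DfsInv G s t t num₀ low₀ (fun _ => 0) par₀ :=
    DfsInv.init hst num₀ par₀ (fun _ => rfl) (by simp [par₀]) low₀ (by simp [low₀])
  let J : ℕ → State → Prop := fun k τ => HasInput G s t τ ∧ ∃ cur cnt num low ptr par,
    DfsRep τ cur cnt num low ptr par ∧ DfsInv G s t cur num low ptr par ∧
      dfsMeasure s cur num ptr par = k
  refine (hinit.seq (d := (2 * (n * n) + n) * (60 + 5 + 1) + 6) fun τ hfr hτ => ?_).mono ?_
    fun _ h => h
  · have hin' : HasInput G s t τ := hin.of_frame hfr rfl rfl rfl rfl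
    have hk := dfsMeasure_le s t num₀ (fun _ => 0) par₀
    refine (Runs.loop (B := B) (e := (reg 3 =ₑ reg 1) =ₑ lit 0) (p := dfsBody) (c := 60) J ?_ ?_
      (k := dfsMeasure s t num₀ (fun _ => 0) par₀) (σ := τ)
      ⟨hin', t, 2, num₀, low₀, _, par₀, hτ, hinv₀, rfl⟩).mono ?_ ?_
    · rintro k υ ⟨hin, cur, cnt, num, low, ptr, par, hrep, -, -⟩
      simp [hrep.reg3, hin.reg1, hvB, ite_one_zero_lt h1B, h0B]
      split_ifs <;> assumption
    · rintro k υ ⟨hin, cur, cnt, num, low, ptr, par, hrep, hinv, hk⟩ he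
      have hcs : cur ≠ s := by
        rintro rfl
        simp [hrep.reg3, hin.reg1] at he
      refine (dfsBody_runs hB hin hrep hinv hcs (Q := fun ω => ∃ k' < k, ∃ cur cnt num low ptr par,
        DfsRep ω cur cnt num low ptr par ∧ DfsInv G s t cur num low ptr par ∧
          dfsMeasure s cur num ptr par = k') ?_).frame.mono le_rfl ?_
      · exact fun ω cur' cnt' num' low' ptr' par' hrep' hinv' hlt =>
          ⟨_, hk ▸ hlt, cur', cnt', num', low', ptr', par', hrep', hinv', rfl⟩
      · rintro ω ⟨hfr, k', hk', hω⟩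
        exact ⟨k', hk', hin.of_frame hfr rfl rfl rfl rfl, hω⟩
    · exact Nat.add_le_add_right (Nat.mul_le_mul_right _ hk) _
    · rintro υ ⟨⟨k, hin, cur, cnt, num, low, ptr, par, hrep, hinv, -⟩, he⟩
      have hcs : cur = s := by
        by_contra hne
        simp [hrep.reg3, hin.reg1, Fin.val_inj, hne] at he
      subst hcs
      exact ⟨cnt, num, low, ptr, par, hrep, hinv.dfsTree⟩
  · have : 4 ≤ n * n := Nat.mul_le_mul hn2 hn2
    omega

end

/-! ### The program: the reduced graph -/

/-- One step of the marking: the vertex with the number `i + 1` belongs to the reduced graph if its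
parent does and its lowpoint is below the number of its parent. -/
def markBody : Prog :=
  .ite (lit 1 <ₑ reg 6)
    (.ite (reg 6 <ₑ reg 4)
      (.set 5 (read 6 (reg 6)) ⨾ .set 3 (read 3 (reg 5)) ⨾
        .ite (read 5 (reg 5) <ₑ read 4 (reg 3)) (.write 7 (reg 5) (read 7 (reg 3))) .skip)
      .skip)
    .skip

/-- Bank `7` receives the characteristic vector of the vertices of the reduced graph. -/
def mark : Prog :=
  (.write 7 (reg 1) (lit 1) ⨾ .write 7 (reg 2) (lit 1)) ⨾ forUp 6 markBody

/-- The treatment of one entry of the adjacency matrix. -/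
def restrictBody : Prog :=
  .write 0 (reg 6 *ₑ reg 0 +ₑ reg 7)
    (read 0 (reg 6 *ₑ reg 0 +ₑ reg 7) *ₑ (read 7 (reg 6) *ₑ read 7 (reg 7))) ⨾
  .write 8 (reg 6) (read 8 (reg 6) +ₑ read 0 (reg 6 *ₑ reg 0 +ₑ reg 7))

/-- The adjacency matrix is replaced by that of the reduced graph, whose degrees go to bank `8`, and
every vertex gets the weight `n ^ 2 + 1` in bank `9`. -/
def restrict : Prog :=
  forUp 6 (forUp 7 restrictBody ⨾ .write 9 (reg 6) (reg 0 *ₑ reg 0 +ₑ lit 1))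

section

variable {n B : ℕ} {G : SimpleGraph (Fin n)} [DecidableRel G.Adj] {s t : Fin n}

theorem mark_runs (hB : 4 * (n * n) + 20 ≤ B) (hst : s ≠ t) {σ : State} (hin : HasInput G s t σ)
    {cnt : ℕ} {num low ptr : Fin n → ℕ} {par : Fin n → Fin n}
    (hrep : DfsRep σ s cnt num low ptr par) (htree : DfsTree G s t num par low)
    (hzero : ∀ v : Fin n, σ.cell 7 v = 0) :
    Runs B mark σ (200 * (n * n)) fun τ => ∃ K : Finset (Fin n),
      (∀ v : Fin n, τ.cell 7 v = if v ∈ K then 1 else 0) ∧ s ∈ K ∧ t ∈ K ∧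
      (∀ v ∈ K, num v ≠ 0) ∧
      ∀ v, num v ≠ 0 → v ≠ s → v ≠ t → (v ∈ K ↔ par v ∈ K ∧ low v < num (par v)) := by
  have hnn := le_mul_self_of_fin s
  have hn0 := s.pos
  have h1B : 1 < B := by omega
  have h0B : 0 < B := by omega
  have hnB : n < B := by omega
  have hite := fun P [Decidable P] => ite_one_zero_lt h1B P
  have hvB : ∀ v : Fin n, (v : ℕ) < B := fun v => v.2.trans hnB
  have hN := hrep.numbering
  have hnumB : ∀ v, num v < B := fun v => by have := hN.le_cnt v; have := hN.cnt_le; omega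
  have hlowB : ∀ v, low v < B := fun v => (hrep.low_le v).trans_lt hnB
  have hcB : cnt < B := by have := hN.cnt_le; omega
  have hinj : ∀ {u v : Fin n}, num u ≠ 0 → num u = num v → u = v := by
    intro u v hu huv
    have h1 := hN.ord_num u hu
    rw [huv, hN.ord_num v (huv ▸ hu)] at h1
    exact Fin.ext h1.symm
  let I : ℕ → State → Prop := fun i τ => ∃ K : Finset (Fin n),
      (∀ v : Fin n, τ.cell 7 v = if v ∈ K then 1 else 0) ∧ s ∈ K ∧ t ∈ K ∧
      (∀ v ∈ K, num v ≠ 0 ∧ (num v ≤ 2 ∨ num v ≤ i)) ∧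
      ∀ v, num v ≠ 0 → v ≠ s → v ≠ t → num v ≤ i →
        (v ∈ K ↔ par v ∈ K ∧ low v < num (par v))
  have hinit : Runs B (.write 7 (reg 1) (lit 1) ⨾ .write 7 (reg 2) (lit 1)) σ 10 (I 0) := by
    refine (Runs.of_wp ?_).mono (by decide) fun _ h => h
    have hI : ∀ τ : State, (∀ v : Fin n, τ.cell 7 v = if v = s ∨ v = t then 1 else 0) → I 0 τ := by
      intro τ hτ
      refine ⟨{s, t}, by simpa using hτ, by simp, by simp, ?_, fun v hv _ _ h => absurd h (by omega)⟩
      simp [htree.num_s, htree.num_t]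
    simp [hin.reg1, hin.reg2, hvB, h1B]
    refine hI _ fun v => ?_
    simp [Function.update_apply, Fin.val_inj, hzero]
    grind
  refine (hinit.seq (d := n * (60 + 8) + 6) fun τ hfr hτ => ?_).mono (c' := 200 * (n * n))
    (by omega) (Q := I n) ?_
  · have hn : τ.reg 0 = n := (hfr.reg 0 rfl).trans hin.reg0
    have h4 : τ.reg 4 = cnt := (hfr.reg 4 rfl).trans hrep.reg4
    refine Runs.forUp I hn (by omega) rfl rfl (by decide) (fun _ _ _ h => h) hτ ?_
    rintro i hi υ hυ h6 ⟨K, hK, hsK, htK, hKnum, hiff⟩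
    have h4' : υ.reg 4 = cnt := (hυ.reg 4 rfl).trans h4
    have hc3 : υ.cell 3 = σ.cell 3 := (hυ.cell 3 rfl).trans (hfr.cell 3 rfl)
    have hc4 : υ.cell 4 = σ.cell 4 := (hυ.cell 4 rfl).trans (hfr.cell 4 rfl)
    have hc5 : υ.cell 5 = σ.cell 5 := (hυ.cell 5 rfl).trans (hfr.cell 5 rfl)
    have hc6 : υ.cell 6 = σ.cell 6 := (hυ.cell 6 rfl).trans (hfr.cell 6 rfl)
    have hiB : i < B := hi.trans hnB
    refine (Runs.of_wp (p := markBody) ?_).mono (by decide) fun _ h => h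
    -- the characteristic vector is left as it is
    have hkeep : (∀ v, num v ≠ 0 → v ≠ s → v ≠ t → num v = i + 1 →
        (v ∈ K ↔ par v ∈ K ∧ low v < num (par v))) →
        ∀ τ : State, τ.cell 7 = υ.cell 7 → I (i + 1) τ := by
      intro hv τ hτ
      refine ⟨K, by rwa [hτ], hsK, htK, fun v hv => ?_, fun v h1 h2 h3 h4 => ?_⟩
      · have := hKnum v hv
        omega
      · rcases Nat.lt_or_ge i (num v) with h | h
        · exact hv v h1 h2 h3 (by omega)
        · exact hiff v h1 h2 h3 h
    by_cases h1i : 1 < i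
    · by_cases hic : i < cnt
      · obtain ⟨v, hv, hov⟩ := hN.exists_num i hic
        have hvs : v ≠ s := by rintro rfl; have := htree.num_s; omega
        have hvt : v ≠ t := by rintro rfl; have := htree.num_t; omega
        have hv0 : num v ≠ 0 := by omega
        obtain ⟨-, -, hpar, -⟩ := htree.par_spec v hv0 hvs hvt
        have hvK : v ∉ K := fun h => by have := hKnum v h; omega
        simp [markBody, h6, h4', hc3, hc4, hc5, hc6, h1B, h0B, hiB, hcB, hite, h1i, hic, hov, hvB,
          hrep.par_eq, hrep.num_eq, hrep.low_eq, hnumB, hlowB, hK]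
        refine ⟨fun hlt => ?_, fun hge => ?_⟩
        · by_cases hpK : par v ∈ K
          · refine ⟨insert v K, fun u => ?_, by simp [hsK], by simp [htK], fun u hu => ?_,
              fun u h1 h2 h3 h4 => ?_⟩
            · simp [hpK, Function.update_apply, Fin.val_inj, hK]
              grind
            · rcases Finset.mem_insert.1 hu with rfl | hu
              · omega
              · have := hKnum u hu
                omega
            · by_cases huv : u = v
              · subst huv
                simp [hpK, hlt]
              · have hne : num u ≠ i + 1 := fun h => huv (hinj h1 (h.trans hv.symm))
                obtain ⟨-, -, hpu, -⟩ := htree.par_spec u h1 h2 h3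
                have hpv : par u ≠ v := by rintro h; rw [h] at hpu; omega
                simpa [huv, hpv] using hiff u h1 h2 h3 (by omega)
          · refine hkeep (fun u h1 _ _ h4 => ?_) _ ?_
            · obtain rfl := hinj h1 (h4.trans hv.symm)
              simp [hvK, hpK]
            · simp only [State.setCell_cell, State.setReg_cell, if_true, hpK, if_false]
              refine Function.update_eq_self_iff.2 ?_
              rw [hK, if_neg hvK]
        · refine hkeep (fun u h1 _ _ h4 => ?_) _ (by simp)
          obtain rfl := hinj h1 (h4.trans hv.symm)
          simp [hvK, hge]
      · simp [markBody, h6, h4', h1B, h0B, hiB, hcB, hite, h1i, hic]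
        exact hkeep (fun v _ _ _ h => absurd (hN.le_cnt v) (by omega)) _ rfl
    · simp [markBody, h6, h1B, h0B, hiB, hite, h1i]
      refine hkeep (fun v hv hvs hvt h => ?_) _ rfl
      rcases Nat.lt_or_ge 0 i with h0 | h0
      · exact absurd (hinj hv (h.trans (by rw [htree.num_t]; omega))) hvt
      · exact absurd (hinj hv (h.trans (by rw [htree.num_s]; omega))) hvs
  · rintro τ ⟨K, hK, hsK, htK, hKnum, hiff⟩
    exact ⟨K, hK, hsK, htK, fun v hv => (hKnum v hv).1,
      fun v h1 h2 h3 => hiff v h1 h2 h3 ((hN.le_cnt v).trans hN.cnt_le)⟩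

end

section

variable {n B : ℕ} {G : SimpleGraph (Fin n)} [DecidableRel G.Adj] {s t : Fin n}

theorem addr_inj {u v u' v' : Fin n} : (u : ℕ) * n + v = u' * n + v' ↔ u = u' ∧ v = v' := by
  refine ⟨fun h => ?_, by rintro ⟨rfl, rfl⟩; rfl⟩
  have hu : (u : ℕ) = u' := by
    have h1 := congrArg (· / n) h
    simpa [Nat.add_div_of_dvd_right, Nat.mul_add_div, mul_comm _ n, u.pos, Nat.div_eq_of_lt] using h1
  refine ⟨Fin.ext hu, Fin.ext ?_⟩
  rw [hu] at h
  omega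

/-- The memory when the entries of the adjacency matrix with address less than `k` have been treated
by `restrict`. -/
structure RestrictInv (G H : SimpleGraph (Fin n)) [DecidableRel G.Adj] [DecidableRel H.Adj] (k : ℕ)
    (τ : State) : Prop where
  adj : ∀ u v : Fin n, τ.cell 0 (u * n + v) =
    if u * n + v < k then (if H.Adj u v then 1 else 0) else if G.Adj u v then 1 else 0
  deg : ∀ u : Fin n, τ.cell 8 u =
    (Finset.univ.filter fun v : Fin n => u * n + v < k ∧ H.Adj u v).card

theorem restrict_runs (hB : 4 * (n * n) + 20 ≤ B) {σ : State} (hin : HasInput G s t σ)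
    {H : SimpleGraph (Fin n)} [DecidableRel H.Adj] {K : Finset (Fin n)}
    (hH : ∀ u v, H.Adj u v ↔ G.Adj u v ∧ u ∈ K ∧ v ∈ K)
    (hK : ∀ v : Fin n, σ.cell 7 v = if v ∈ K then 1 else 0)
    (hzero : ∀ v : Fin n, σ.cell 8 v = 0) :
    Runs B restrict σ (200 * (n * n)) fun τ => HasInput H s t τ ∧
      ∀ v : Fin n, τ.cell 8 v = degIn H Finset.univ v ∧ τ.cell 9 v = n * n + 1 := by
  have hnn := le_mul_self_of_fin s
  have hn0 := s.pos
  have h1B : 1 < B := by omega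
  have h0B : 0 < B := by omega
  have hnB : n < B := by omega
  have hnnB : n * n < B := by omega
  have hnnB1 : n * n + 1 < B := by omega
  have hite := fun P [Decidable P] => ite_one_zero_lt h1B P
  have hvB : ∀ v : Fin n, (v : ℕ) < B := fun v => v.2.trans hnB
  refine (Runs.forUp (c := n * (60 + 8) + 6 + 20) (fun i τ => RestrictInv G H (i * n) τ ∧
    ∀ v : Fin n, (v : ℕ) < i → τ.cell 9 v = n * n + 1) hin.reg0 (by omega) rfl rfl (by decide)
    (fun i x τ h => ⟨⟨h.1.1, h.1.2⟩, h.2⟩) ⟨⟨by simpa using hin.adj, by simpa using hzero⟩, by simp⟩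
    ?_).frame.mono ?_ ?_
  · rintro i hi υ hυ h6 ⟨hinv, hw⟩
    obtain ⟨u, rfl⟩ : ∃ u : Fin n, (u : ℕ) = i := ⟨⟨i, hi⟩, rfl⟩
    have h0 : υ.reg 0 = n := (hυ.reg 0 rfl).trans hin.reg0
    have h7 : υ.cell 7 = σ.cell 7 := hυ.cell 7 rfl
    have inner := Runs.forUp (B := B) (r := 7) (σ := υ) (c := 60) (body := restrictBody)
      (fun j τ => RestrictInv G H (u * n + j) τ) h0 (by omega) rfl rfl (by decide)
      (fun i x τ h => ⟨h.1, h.2⟩) hinv ?_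
    · refine (inner.seq (d := 20) fun τ hfr hτ => ?_).mono le_rfl fun _ h => h
      have h0' : τ.reg 0 = n := (hfr.reg 0 rfl).trans h0
      have h6' : τ.reg 6 = u := (hfr.reg 6 rfl).trans h6
      have h9' : τ.cell 9 = υ.cell 9 := hfr.cell 9 rfl
      refine (Runs.of_wp ?_).mono (by decide) fun _ h => h
      simp [h0', h6', hvB, h1B, hnB, hnnB, hnnB1]
      refine ⟨⟨?_, ?_⟩, fun v hv => ?_⟩
      · simpa [add_mul] using hτ.adj
      · simpa [add_mul] using hτ.deg
      · simp only [Function.update_apply, h9']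
        split_ifs with h
        · rfl
        · exact hw v (by omega)
    · intro j hj τ hτ h7τ hinv
      obtain ⟨v, rfl⟩ : ∃ v : Fin n, (v : ℕ) = j := ⟨⟨j, hj⟩, rfl⟩
      have h0' : τ.reg 0 = n := (hτ.reg 0 rfl).trans h0
      have h6' : τ.reg 6 = u := (hτ.reg 6 rfl).trans h6
      have h7' : ∀ v : Fin n, τ.cell 7 v = if v ∈ K then 1 else 0 := by
        rw [hτ.cell 7 rfl, h7]
        exact hK
      have hmul := mul_add_lt u v
      have hB1 : (u : ℕ) * n < B := by omega
      have hB2 : (u : ℕ) * n + v < B := by omega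
      have hadj := hinv.adj u v
      rw [if_neg (lt_irrefl _)] at hadj
      have hdeg := hinv.deg u
      have hdeg' : ∀ k, (Finset.univ.filter fun v : Fin n => u * n + v < k ∧ H.Adj u v).card ≤ n :=
        fun k => (Finset.card_le_univ _).trans_eq (Fintype.card_fin n)
      have hval : (if G.Adj u v then 1 else 0) *
          ((if u ∈ K then 1 else 0) * if v ∈ K then 1 else 0) = if H.Adj u v then 1 else 0 := by
        simp only [hH]
        split_ifs <;> simp_all
      have hstep : ∀ x : Fin n, (Finset.univ.filter fun y : Fin n =>
          x * n + y < u * n + v + 1 ∧ H.Adj x y).card =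
          (Finset.univ.filter fun y : Fin n => x * n + y < u * n + v ∧ H.Adj x y).card +
            if x = u ∧ H.Adj u v then 1 else 0 := by
        intro x
        split_ifs with h
        · obtain ⟨rfl, h⟩ := h
          rw [← Finset.card_insert_of_notMem (a := v) (by simp)]
          congr 1
          ext y
          simp only [Finset.mem_filter, Finset.mem_univ, true_and, Finset.mem_insert, Fin.ext_iff]
          constructor
          · rintro ⟨h1, h2⟩
            rcases Nat.lt_or_ge (x * n + y) (x * n + v) with h3 | h3
            · exact Or.inr ⟨h3, h2⟩
            · exact Or.inl (by omega)
          · rintro (h1 | h1)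
            · obtain rfl := Fin.ext h1
              exact ⟨by omega, h⟩
            · exact ⟨by omega, h1.2⟩
        · rw [add_zero]
          congr 1
          ext y
          simp only [Finset.mem_filter, Finset.mem_univ, true_and]
          refine ⟨fun ⟨h1, h2⟩ => ⟨?_, h2⟩, fun ⟨h1, h2⟩ => ⟨by omega, h2⟩⟩
          refine lt_of_le_of_ne (by omega) fun he => h ?_
          obtain ⟨rfl, rfl⟩ := addr_inj.1 he
          exact ⟨rfl, h2⟩
      refine (Runs.of_wp (p := restrictBody) ?_).mono (by decide) fun _ h => h
      have hD := hdeg' (u * n + v + 1)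
      rw [hstep u] at hD
      have hdB := (hdeg' (u * n + v)).trans_lt hnB
      generalize hd : (Finset.univ.filter fun y : Fin n => u * n + y < u * n + v ∧ H.Adj u y).card = d
        at hdeg hD hdB
      have hDB := hD.trans_lt hnB
      simp only [true_and] at hDB
      simp [restrictBody, h0', h6', h7τ, h7', hadj, hdeg, hvB, h1B, h0B, hnB, hB1, hB2, hval, hite,
        -mul_ite, -ite_mul, -mul_one, -mul_zero]
      refine ⟨?_, ⟨hdB, hDB⟩, fun x y => ?_, fun x => ?_⟩
      · split_ifs <;> omega
      · have hadd : x * n + y < u * n + (v + 1) ↔ x * n + y < u * n + v ∨ (x = u ∧ y = v) := by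
          rw [← addr_inj]
          omega
        simp only [State.setCell_cell, hadd]
        simp only [OfNat.ofNat_ne_zero, OfNat.zero_ne_ofNat, if_true, if_false,
          Function.update_apply, addr_inj, hinv.adj]
        grind
      · rw [← add_assoc, hstep x]
        by_cases hxu : x = u
        · subst hxu
          rw [hd]
          simp
        · simp [Function.update_apply, Fin.val_inj, hxu, hinv.deg]
  · have : n * (n * (60 + 8) + 6 + 20 + 8) = 68 * (n * n) + 34 * n := by ring
    omega
  · rintro τ ⟨hfr, hinv, hw⟩
    refine ⟨⟨(hfr.reg 0 rfl).trans hin.reg0, (hfr.reg 1 rfl).trans hin.reg1,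
      (hfr.reg 2 rfl).trans hin.reg2, fun u v => ?_⟩, fun v => ⟨?_, hw v v.2⟩⟩
    · rw [hinv.adj, if_pos (mul_add_lt u v)]
    · rw [hinv.deg]
      unfold degIn
      congr 1
      ext y
      simp [mul_add_lt]

end

/-! ### The program: elimination -/

/-- The quotient of the weight and the degree of the vertex in register `7`, or `0` if the degree is
at most one. -/
def key : Expr := (lit 1 <ₑ read 8 (reg 7)) *ₑ (read 9 (reg 7) /ₑ read 8 (reg 7))

/-- One step of the search for the smallest key among the remaining vertices. -/
def minBody : Prog :=
  .ite (read 10 (reg 7)) .skip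
    (.set 10 key ⨾ .ite (reg 10 <ₑ reg 8) (.set 8 (reg 10) ⨾ .set 9 (reg 7)) .skip)

/-- One step of the update of weights and degrees for the elimination of the vertex in register `9`
with the key in register `8`. -/
def reduceBody : Prog :=
  .ite (read 10 (reg 7)) .skip
    (.write 9 (reg 7) (read 9 (reg 7) -ₑ reg 8 *ₑ read 8 (reg 7)) ⨾
      .write 8 (reg 7) (read 8 (reg 7) -ₑ read 0 (reg 9 *ₑ reg 0 +ₑ reg 7)))

/-- The elimination of one vertex. It is flagged in bank `10` and listed in bank `11`. -/
def elimBody : Prog :=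
  (.set 8 (reg 0 *ₑ reg 0 +ₑ lit 2) ⨾ forUp 7 minBody) ⨾
  (.write 10 (reg 9) (lit 1) ⨾ .write 11 (reg 6) (reg 9)) ⨾
  forUp 7 reduceBody

/-- All vertices are eliminated. -/
def elim : Prog := forUp 6 elimBody

section

variable {n B : ℕ} {H : SimpleGraph (Fin n)} [DecidableRel H.Adj] {s t : Fin n}

/-- The value of `key` for weight `w` and degree `d`. -/
def keyVal (w d : ℕ) : ℕ := (if 1 < d then 1 else 0) * (w / d)

theorem keyVal_le (w d : ℕ) : keyVal w d ≤ w := by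
  unfold keyVal
  have := Nat.div_le_self w d
  split_ifs <;> omega

theorem keyVal_mul_le (w d : ℕ) : keyVal w d * d ≤ w := by
  unfold keyVal
  have := Nat.div_mul_le_self w d
  split_ifs
  · simpa using this
  · simp

/-- The weights and degrees of the remaining vertices `A` are in memory. -/
structure ElimRep (σ : State) (A : Finset (Fin n)) (w d : Fin n → ℕ) : Prop where
  flag : ∀ u : Fin n, σ.cell 10 u = if u ∈ A then 0 else 1
  weight : ∀ u ∈ A, σ.cell 9 u = w u
  degree : ∀ u ∈ A, σ.cell 8 u = d u
  weight_le : ∀ u ∈ A, w u ≤ n * n + 1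
  degree_le : ∀ u ∈ A, d u ≤ n

/-- A remaining vertex with the smallest key is found. -/
theorem min_runs (hB : 4 * (n * n) + 20 ≤ B) {σ : State} (h0 : σ.reg 0 = n)
    {A : Finset (Fin n)} {w d : Fin n → ℕ} (hrep : ElimRep σ A w d) (hA : A.Nonempty) :
    Runs B (.set 8 (reg 0 *ₑ reg 0 +ₑ lit 2) ⨾ forUp 7 minBody) σ (n * 58 + 20) fun τ =>
      ∃ v ∈ A, τ.reg 9 = v ∧ τ.reg 8 = keyVal (w v) (d v) ∧
        ∀ u ∈ A, keyVal (w v) (d v) ≤ keyVal (w u) (d u) := by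
  have hnn := le_mul_self_of_fin hA.choose
  have h1B : 1 < B := by omega
  have h0B : 0 < B := by omega
  have h2B : 2 < B := by omega
  have hnB : n < B := by omega
  have hnnB : n * n < B := by omega
  have hnnB1 : n * n + 2 < B := by omega
  have hite := fun P [Decidable P] => ite_one_zero_lt h1B P
  have hvB : ∀ v : Fin n, (v : ℕ) < B := fun v => v.2.trans hnB
  -- the start value `n * n + 2` exceeds all keys, so register `9` is set before the loop ends
  let I : ℕ → State → Prop := fun j τ => τ.reg 8 ≤ n * n + 2 ∧
    (τ.reg 8 < n * n + 2 → ∃ v ∈ A, τ.reg 9 = v ∧ τ.reg 8 = keyVal (w v) (d v)) ∧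
    ∀ u ∈ A, (u : ℕ) < j → τ.reg 8 ≤ keyVal (w u) (d u)
  refine (Runs.seq (c := 10) (d := n * (50 + 8) + 6) (R := I 0) (Q := I n) ?_
    fun τ hfr hτ => ?_).mono (by omega) ?_
  · refine (Runs.of_wp ?_).mono (by decide) fun _ h => h
    simp [h0, hnB, hnnB, hnnB1, h2B, I]
  · refine Runs.forUp I ((hfr.reg 0 rfl).trans h0) (by omega) rfl rfl (by decide)
      (fun _ _ _ h => by simpa [I] using h) hτ ?_
    rintro j hj υ hυ h7 ⟨h8, h9, hle⟩
    obtain ⟨v, rfl⟩ : ∃ v : Fin n, (v : ℕ) = j := ⟨⟨j, hj⟩, rfl⟩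
    have hc8 : υ.cell 8 = σ.cell 8 := (hυ.cell 8 rfl).trans (hfr.cell 8 rfl)
    have hc9 : υ.cell 9 = σ.cell 9 := (hυ.cell 9 rfl).trans (hfr.cell 9 rfl)
    have hc10 : υ.cell 10 = σ.cell 10 := (hυ.cell 10 rfl).trans (hfr.cell 10 rfl)
    refine (Runs.of_wp (p := minBody) ?_).mono (by decide) fun _ h => h
    by_cases hvA : v ∈ A
    · have hd := hrep.degree v hvA
      have hw := hrep.weight v hvA
      have hdB := (hrep.degree_le v hvA).trans_lt hnB
      have hwB : w v < B := by have := hrep.weight_le v hvA; omega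
      have hqB : w v / d v < B := (Nat.div_le_self _ _).trans_lt hwB
      have hkw := keyVal_le (w v) (d v)
      have hkB : keyVal (w v) (d v) < B := hkw.trans_lt hwB
      have hwle := hrep.weight_le v hvA
      have hk : (if 1 < d v then 1 else 0) * (w v / d v) = keyVal (w v) (d v) := rfl
      have h8B : υ.reg 8 < B := by omega
      simp [minBody, key, h7, hc8, hc9, hc10, hrep.flag, hvA, hd, hw, hvB, h1B, h0B, hdB, hwB, hqB,
        hite, h8B, -mul_ite, -ite_mul, -mul_one, -mul_zero, -one_mul, -zero_mul]
      rw [hk]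
      refine ⟨hkB, fun hlt => ⟨hkB, ?_, fun _ => ⟨v, hvA, by simp [h7], by simp⟩, fun u hu hlt' => ?_⟩,
        fun hge => ⟨h8, h9, fun u hu hlt' => ?_⟩⟩
      · simp
        omega
      · rcases Nat.lt_succ_iff_lt_or_eq.1 hlt' with h | h
        · simpa using hlt.le.trans (hle u hu h)
        · obtain rfl := Fin.ext h
          simp
      · rcases Nat.lt_succ_iff_lt_or_eq.1 hlt' with h | h
        · simpa using hle u hu h
        · obtain rfl := Fin.ext h
          simpa using hge
    · simp [minBody, h7, hc10, hrep.flag, hvA, hvB, h1B]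
      refine ⟨h8, h9, fun u hu hlt => hle u hu ?_⟩
      refine lt_of_le_of_ne (by omega) fun he => hvA ?_
      rwa [← Fin.ext he]
  · rintro τ ⟨-, h9, hle⟩
    obtain ⟨u, hu⟩ := hA
    have h1 := hle u hu u.2
    have h2 := keyVal_le (w u) (d u)
    have h3 := hrep.weight_le u hu
    obtain ⟨v, hv, h9, h8⟩ := h9 (by omega)
    exact ⟨v, hv, h9, h8, fun u hu => h8 ▸ hle u hu u.2⟩

theorem reduce_runs (hB : 4 * (n * n) + 20 ≤ B) {σ : State} (hin : HasInput H s t σ)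
    {A : Finset (Fin n)} {w d : Fin n → ℕ} (hrep : ElimRep σ A w d) {v : Fin n} {γ : ℕ}
    (h9 : σ.reg 9 = v) (h8 : σ.reg 8 = γ) (hγB : γ < B) (hγ : ∀ u ∈ A, γ * d u ≤ w u) :
    Runs B (forUp 7 reduceBody) σ (n * 58 + 6) fun τ =>
      ElimRep τ A (fun u => w u - γ * d u) (fun u => d u - if H.Adj v u then 1 else 0) := by
  have hnn := le_mul_self_of_fin s
  have h1B : 1 < B := by omega
  have h0B : 0 < B := by omega
  have hnB : n < B := by omega
  have hnnB : n * n < B := by omega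
  have hite := fun P [Decidable P] => ite_one_zero_lt h1B P
  have hvB : ∀ v : Fin n, (v : ℕ) < B := fun v => v.2.trans hnB
  let I : ℕ → State → Prop := fun j τ =>
    (∀ u ∈ A, τ.cell 9 u = if u < j then w u - γ * d u else w u) ∧
    (∀ u ∈ A, τ.cell 8 u = if u < j then d u - (if H.Adj v u then 1 else 0) else d u)
  refine (Runs.forUp (c := 50) I hin.reg0 (by omega) rfl rfl (by decide) (fun _ _ _ h => h)
    ⟨by simpa using hrep.weight, by simpa using hrep.degree⟩ ?_).frame.mono (by omega) ?_
  · rintro j hj υ hυ h7 ⟨hw, hd⟩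
    obtain ⟨u, rfl⟩ : ∃ u : Fin n, (u : ℕ) = j := ⟨⟨j, hj⟩, rfl⟩
    have hr0 : υ.reg 0 = n := (hυ.reg 0 rfl).trans hin.reg0
    have hr8 : υ.reg 8 = γ := (hυ.reg 8 rfl).trans h8
    have hr9 : υ.reg 9 = v := (hυ.reg 9 rfl).trans h9
    have hc0 : υ.cell 0 = σ.cell 0 := hυ.cell 0 rfl
    have hc10 : υ.cell 10 = σ.cell 10 := hυ.cell 10 rfl
    refine (Runs.of_wp (p := reduceBody) ?_).mono (by decide) fun _ h => h
    by_cases huA : u ∈ A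
    · have hdu := hd u huA
      have hwu := hw u huA
      rw [if_neg (lt_irrefl _)] at hdu hwu
      have hdB := (hrep.degree_le u huA).trans_lt hnB
      have hwB : w u < B := by have := hrep.weight_le u huA; omega
      have hmul := mul_add_lt v u
      have hB1 : (v : ℕ) * n < B := by omega
      have hB2 : (v : ℕ) * n + u < B := by omega
      have hB3 : γ * d u < B := (hγ u huA).trans_lt hwB
      have hB4 : w u - γ * d u < B := by omega
      have hB5 : d u - (if H.Adj v u then 1 else 0) < B := by omega
      simp [reduceBody, h7, hr0, hr8, hr9, hc0, hc10, hrep.flag, huA, hdu, hwu, hvB, h1B, h0B, hnB,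
        hγB, hdB, hwB, hB1, hB2, hB3, hB4, hB5, hin.adj, hite]
      refine ⟨fun x hx => ?_, fun x hx => ?_⟩
      · have := hw x hx
        simp [Function.update_apply, Fin.val_inj]
        grind
      · have := hd x hx
        simp [Function.update_apply, Fin.val_inj]
        grind
    · simp [reduceBody, h7, hc10, hrep.flag, huA, hvB, h1B]
      have hlt : ∀ x ∈ A, ((x : ℕ) < u + 1 ↔ (x : ℕ) < u) := by
        intro x hx
        have : (x : ℕ) ≠ u := fun he => huA (Fin.ext he ▸ hx)
        omega
      exact ⟨fun x hx => by simp only [hlt x hx, hw x hx], fun x hx => by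
        simp only [hlt x hx, hd x hx]⟩
  · rintro τ ⟨hfr, hw, hd⟩
    refine ⟨by rw [hfr.cell 10 rfl]; exact hrep.flag, fun u hu => ?_, fun u hu => ?_, fun u hu => ?_,
      fun u hu => ?_⟩
    · rw [hw u hu, if_pos u.2]
    · rw [hd u hu, if_pos u.2]
    · exact (Nat.sub_le _ _).trans (hrep.weight_le u hu)
    · exact (Nat.sub_le _ _).trans (hrep.degree_le u hu)

end

section

variable {n B : ℕ} {H : SimpleGraph (Fin n)} {s t : Fin n}

theorem degIn_erase {A : Finset (Fin n)} {v : Fin n} (hv : v ∈ A) (u : Fin n)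
    [Decidable (H.Adj v u)] : degIn H (A.erase v) u = degIn H A u - if H.Adj v u then 1 else 0 := by
  classical
  unfold degIn
  rw [Finset.filter_erase]
  split_ifs with h
  · exact Finset.card_erase_of_mem (Finset.mem_filter.2 ⟨hv, h.symm⟩)
  · rw [Finset.erase_eq_of_notMem fun h' => h (Finset.mem_filter.1 h').2.symm, Nat.sub_zero]

theorem degIn_le (A : Finset (Fin n)) (v : Fin n) : degIn H A v ≤ n :=
  (Finset.card_le_univ _).trans_eq (Fintype.card_fin n)

/-- Subtracting the smallest key times the degrees leaves at most the remainder of a division at the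
chosen vertex. -/
theorem Elim.of_key {A : Finset (Fin n)} {w : Fin n → ℕ} {v : Fin n} {L : List (Fin n)}
    (hv : v ∈ A)
    (hmin : ∀ u ∈ A, keyVal (w v) (degIn H A v) ≤ keyVal (w u) (degIn H A u))
    (h : Elim H n (A.erase v) (fun u => w u - keyVal (w v) (degIn H A v) * degIn H A u) L) :
    Elim H n A w (v :: L) := by
  by_cases hd : degIn H A v ≤ 1
  · refine Elim.low hv hd ?_
    simpa [keyVal, hd.not_gt] using h
  · refine Elim.main (γ := keyVal (w v) (degIn H A v)) hv (fun hpos u hu => ?_) (fun u hu => ?_) ?_ h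
    · by_contra hlt
      have h1 := hpos.trans_le (hmin u hu)
      have : ¬ 1 < degIn H A u := by omega
      simp [keyVal, this] at h1
    · have h1 := (Nat.mul_le_mul_right (degIn H A u) (hmin u hu)).trans (keyVal_mul_le _ _)
      omega
    · have h1 : 1 < degIn H A v := by omega
      have h2 := Nat.mod_lt (w v) (zero_lt_one.trans h1)
      have h3 := Nat.div_add_mod' (w v) (degIn H A v)
      have h4 := degIn_le (H := H) A v
      simp only [keyVal, h1, if_true, one_mul]
      omega

theorem elim_runs [DecidableRel H.Adj] (hB : 4 * (n * n) + 20 ≤ B) {σ : State}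
    (hin : HasInput H s t σ)
    (hdeg : ∀ v : Fin n, σ.cell 8 v = degIn H Finset.univ v ∧ σ.cell 9 v = n * n + 1)
    (hzero : ∀ v : Fin n, σ.cell 10 v = 0) :
    Runs B elim σ (300 * (n * n)) fun τ => ∃ L : List (Fin n),
      Elim H n Finset.univ (fun _ => n * n + 1) L ∧ L.length = n ∧
        ∀ k (hk : k < L.length), τ.cell 11 k = L[k] := by
  have hnn := le_mul_self_of_fin s
  have hn0 := s.pos
  have h1B : 1 < B := by omega
  have hnB : n < B := by omega
  have hvB : ∀ v : Fin n, (v : ℕ) < B := fun v => v.2.trans hnB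
  let I : ℕ → State → Prop := fun i τ => ∃ (A : Finset (Fin n)) (w : Fin n → ℕ) (l : List (Fin n)),
    ElimRep τ A w (degIn H A) ∧ A.card + i = n ∧ l.length = i ∧
    (∀ k (hk : k < l.length), τ.cell 11 k = l[k]) ∧
    ∀ L, Elim H n A w L → Elim H n Finset.univ (fun _ => n * n + 1) (l ++ L)
  have hinit : I 0 σ := ⟨Finset.univ, fun _ => n * n + 1, [], ⟨by simpa using hzero,
    fun u _ => (hdeg u).2, fun u _ => (hdeg u).1, fun _ _ => le_rfl, fun u _ => degIn_le _ u⟩,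
    by simp, rfl, by simp, fun L h => h⟩
  refine (Runs.forUp (c := (n * 58 + 20) + (10 + (n * 58 + 6))) I hin.reg0 (by omega) rfl rfl
    (by decide) ?_ hinit ?_).mono ?_ ?_
  · rintro i x τ ⟨A, w, l, hrep, h1, h2, h3, h4⟩
    exact ⟨A, w, l, ⟨hrep.flag, hrep.weight, hrep.degree, hrep.weight_le, hrep.degree_le⟩, h1, h2,
      h3, h4⟩
  · rintro i hi υ hυ h6 ⟨A, w, l, hrep, hcard, hlen, hl, hE⟩
    have hin' := hin.of_frame hυ rfl rfl rfl rfl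
    have hA : A.Nonempty := Finset.card_pos.1 (by omega)
    refine (min_runs hB hin'.reg0 hrep hA).seq fun τ hτ ⟨v, hv, h9, h8, hmin⟩ => ?_
    have hin₁ := hin'.of_frame hτ rfl rfl rfl rfl
    have h6₁ : τ.reg 6 = i := (hτ.reg 6 rfl).trans h6
    have c8 : τ.cell 8 = υ.cell 8 := hτ.cell 8 rfl
    have c9 : τ.cell 9 = υ.cell 9 := hτ.cell 9 rfl
    have c10 : τ.cell 10 = υ.cell 10 := hτ.cell 10 rfl
    have c11 : τ.cell 11 = υ.cell 11 := hτ.cell 11 rfl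
    have hiB : i < B := by omega
    refine Runs.seq (R := fun τ' => ElimRep τ' (A.erase v) w (degIn H A) ∧
      ∀ k (hk : k < (l ++ [v]).length), τ'.cell 11 k = (l ++ [v])[k]) ?_ fun τ' hτ' hR => ?_
    · refine (Runs.of_wp ?_).mono (by decide) fun _ h => h
      simp only [wp_seq, wp_write, fits_reg, fits_lit, eval_reg, eval_lit, State.setCell_reg, h9,
        h6₁]
      refine ⟨hvB v, h1B, hiB, hvB v, ⟨fun u => ?_, fun u hu => ?_, fun u hu => ?_, fun u hu => ?_,
        fun u hu => ?_⟩, fun k hk => ?_⟩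
      · have := hrep.flag u
        simp [Function.update_apply, Fin.val_inj, c10, this]
        grind
      · simpa [c9] using hrep.weight u (Finset.mem_of_mem_erase hu)
      · simpa [c8] using hrep.degree u (Finset.mem_of_mem_erase hu)
      · exact hrep.weight_le u (Finset.mem_of_mem_erase hu)
      · exact hrep.degree_le u (Finset.mem_of_mem_erase hu)
      · rcases Nat.lt_or_ge k l.length with h | h
        · have hki : k ≠ i := by omega
          simp [Function.update_apply, hki, c11, hl k h, List.getElem_append_left h]
        · have hki : k = i := by
            simp only [List.length_append, List.length_singleton] at hk
            omega
          simp [Function.update_apply, hki, ← hlen]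
    · have hin₂ := hin₁.of_frame hτ' rfl rfl rfl rfl
      have h8' := (hτ'.reg 8 rfl).trans h8
      have h9' := (hτ'.reg 9 rfl).trans h9
      have hγB : keyVal (w v) (degIn H A v) < B := by
        have h1 := keyVal_le (w v) (degIn H A v)
        have h2 := hrep.weight_le v hv
        omega
      have hγ : ∀ u ∈ A, keyVal (w v) (degIn H A v) * degIn H A u ≤ w u := fun u hu =>
        (Nat.mul_le_mul_right _ (hmin u hu)).trans (keyVal_mul_le _ _)
      refine (reduce_runs hB hin₂ hR.1 h9' h8' hγB
        fun u hu => hγ u (Finset.mem_of_mem_erase hu)).frame.mono le_rfl ?_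
      rintro ω ⟨hω, hrepω⟩
      have hd : degIn H (A.erase v) = fun u => degIn H A u - if H.Adj v u then 1 else 0 :=
        funext fun u => degIn_erase hv u
      refine ⟨A.erase v, _, l ++ [v], hd ▸ hrepω, ?_, by simp [hlen], ?_, fun L hL => ?_⟩
      · rw [Finset.card_erase_of_mem hv]
        omega
      · rw [hω.cell 11 rfl]
        exact hR.2
      · rw [List.append_assoc]
        exact hE _ (Elim.of_key hv hmin hL)
  · have : n * ((n * 58 + 20) + (10 + (n * 58 + 6)) + 8) = 116 * (n * n) + 44 * n := by ring
    omega
  · rintro τ ⟨A, w, l, -, hcard, hlen, hl, hE⟩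
    obtain rfl : A = ∅ := Finset.card_eq_zero.1 (by omega)
    exact ⟨l, by simpa using hE [] (Elim.nil w), hlen, hl⟩

end

/-! ### The program: the greedy forest -/

/-- One step of the search for two neighbours of the vertex in register `9` that lie in the same
component of the forest. Bank `12` holds the labels of the components, `0` outside the forest, and
a label seen in round `i` is marked with `i + 1` in bank `13`. -/
def scanBody : Prog :=
  .ite (read 12 (reg 7))
    (.ite (read 0 (reg 9 *ₑ reg 0 +ₑ reg 7))
      (.ite (read 13 (read 12 (reg 7)) =ₑ (reg 6 +ₑ lit 1)) (.set 11 (lit 1))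
        (.write 13 (read 12 (reg 7)) (reg 6 +ₑ lit 1)))
      .skip)
    .skip

/-- One step of the merging of the marked components into one, whose label is given by the vertex in
register `9`. -/
def mergeBody : Prog :=
  .ite (read 12 (reg 7))
    (.ite (read 13 (read 12 (reg 7)) =ₑ (reg 6 +ₑ lit 1)) (.write 12 (reg 7) (reg 9 +ₑ lit 1)) .skip)
    .skip

/-- The decision about one vertex. -/
def forestBody : Prog :=
  (.set 9 (read 11 (reg 0 -ₑ lit 1 -ₑ reg 6)) ⨾ .set 11 (lit 0)) ⨾
  forUp 7 scanBody ⨾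
  .ite (reg 11) .skip (forUp 7 mergeBody ⨾ .write 12 (reg 9) (reg 9 +ₑ lit 1))

/-- The greedy forest for the list of vertices in bank `11`. -/
def forest : Prog := forUp 6 forestBody

section

variable {n B : ℕ} {H : SimpleGraph (Fin n)} {s t : Fin n}

theorem Elim.nodup {V : Type*} [DecidableEq V] {H : SimpleGraph V} {n : ℕ} {A : Finset V}
    {w : V → ℕ} {L : List V} (h : Elim H n A w L) : L.Nodup := by
  induction h with
  | nil => exact List.nodup_nil
  | low _ _ h ih | main _ _ _ _ h ih =>
    refine List.nodup_cons.2 ⟨fun hm => ?_, ih⟩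
    simpa using (h.mem_iff _).1 hm

variable (H) in
/-- Nonzero labels for the vertices in `Φ`, equal for vertices in the same component. Labels stem
from vertices in `Φ`. -/
structure IsLabelling (Φ : Finset (Fin n)) (lab : Fin n → ℕ) : Prop where
  eq_zero : ∀ u, u ∉ Φ → lab u = 0
  exists_eq : ∀ u ∈ Φ, ∃ z ∈ Φ, lab u = z + 1
  eq_iff : ∀ u ∈ Φ, ∀ v ∈ Φ, lab u = lab v ↔ (within H (Φ : Set (Fin n))).Reachable u v

theorem IsLabelling.ne_zero_iff {Φ : Finset (Fin n)} {lab : Fin n → ℕ} (h : IsLabelling H Φ lab)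
    (u : Fin n) : lab u ≠ 0 ↔ u ∈ Φ := by
  refine ⟨fun hu => not_imp_comm.1 (h.eq_zero u) hu, fun hu => ?_⟩
  obtain ⟨z, -, hz⟩ := h.exists_eq u hu
  omega

theorem IsLabelling.le {Φ : Finset (Fin n)} {lab : Fin n → ℕ} (h : IsLabelling H Φ lab)
    (u : Fin n) : lab u ≤ n := by
  by_cases hu : u ∈ Φ
  · obtain ⟨z, -, hz⟩ := h.exists_eq u hu
    omega
  · rw [h.eq_zero u hu]
    omega

theorem IsLabelling.conflict_iff {Φ : Finset (Fin n)} {lab : Fin n → ℕ} (h : IsLabelling H Φ lab)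
    (v : Fin n) : Conflict H Φ v ↔
      ∃ x ∈ Φ, ∃ y ∈ Φ, x < y ∧ H.Adj v x ∧ H.Adj v y ∧ lab x = lab y := by
  constructor
  · rintro ⟨x, hx, y, hy, hne, h1, h2, h3⟩
    have h4 := (h.eq_iff x hx y hy).2 h3
    rcases lt_or_gt_of_ne hne with hlt | hlt
    · exact ⟨x, hx, y, hy, hlt, h1, h2, h4⟩
    · exact ⟨y, hy, x, hx, hlt, h2, h1, h4.symm⟩
  · rintro ⟨x, hx, y, hy, hlt, h1, h2, h3⟩
    exact ⟨x, hx, y, hy, hlt.ne, h1, h2, (h.eq_iff x hx y hy).1 h3⟩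

/-- A new vertex merges the components of its neighbours. -/
theorem IsLabelling.insert_vertex {Φ : Finset (Fin n)} {lab lab' : Fin n → ℕ} (h : IsLabelling H Φ lab)
    {v : Fin n} (hv : v ∉ Φ) (h1 : lab' v = v + 1)
    (h2 : ∀ u ∈ Φ, (∃ x ∈ Φ, H.Adj v x ∧ lab x = lab u) → lab' u = v + 1)
    (h3 : ∀ u ∈ Φ, (¬∃ x ∈ Φ, H.Adj v x ∧ lab x = lab u) → lab' u = lab u)
    (h4 : ∀ u ∉ Φ, u ≠ v → lab' u = 0) : IsLabelling H (insert v Φ) lab' := by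
  have hmono : within H (Φ : Set (Fin n)) ≤ within H (insert v Φ : Finset (Fin n)) :=
    within_mono (by simp)
  -- the label of the merged component is new
  have hfresh : ∀ u ∈ Φ, lab u ≠ v + 1 := by
    intro u hu he
    obtain ⟨z, hz, hzu⟩ := h.exists_eq u hu
    have : z = v := Fin.ext (by omega)
    exact hv (this ▸ hz)
  have hreach : ∀ u ∈ insert v Φ, lab' u = v + 1 →
      (within H (insert v Φ : Finset (Fin n))).Reachable u v := by
    intro u hu he
    rcases Finset.mem_insert.1 hu with rfl | hu
    · rfl
    · by_cases hx : ∃ x ∈ Φ, H.Adj v x ∧ lab x = lab u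
      · obtain ⟨x, hx, hvx, hxu⟩ := hx
        refine (((h.eq_iff x hx u hu).1 hxu).symm.mono hmono).trans (Adj.reachable ?_)
        exact within_adj.2 ⟨hvx.symm, by simp [hx], by simp⟩
      · exact absurd ((h3 u hu hx).symm.trans he) (hfresh u hu)
  have hadj : ∀ a b, (within H (insert v Φ : Finset (Fin n))).Adj a b → lab' a = lab' b := by
    have hva : ∀ a ∈ Φ, H.Adj v a → lab' a = v + 1 := fun a ha hva => h2 a ha ⟨a, ha, hva, rfl⟩
    intro a b hab
    obtain ⟨hadj, haI, hbI⟩ := within_adj.1 hab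
    rcases Finset.mem_insert.1 (Finset.mem_coe.1 haI) with rfl | ha
    · rcases Finset.mem_insert.1 (Finset.mem_coe.1 hbI) with rfl | hb
      · rfl
      · rw [h1, hva b hb hadj]
    · rcases Finset.mem_insert.1 (Finset.mem_coe.1 hbI) with rfl | hb
      · rw [h1, hva a ha hadj.symm]
      · have he : lab a = lab b :=
          (h.eq_iff a ha b hb).2 (Adj.reachable (within_adj.2 ⟨hadj, ha, hb⟩))
        by_cases hx : ∃ x ∈ Φ, H.Adj v x ∧ lab x = lab a
        · rw [h2 a ha hx, h2 b hb (he ▸ hx)]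
        · rw [h3 a ha hx, h3 b hb (he ▸ hx), he]
  refine ⟨fun u hu => ?_, fun u hu => ?_, fun a ha b hb => ⟨fun he => ?_, fun hr => ?_⟩⟩
  · rw [Finset.mem_insert, not_or] at hu
    exact h4 u hu.2 hu.1
  · rcases Finset.mem_insert.1 hu with rfl | hu
    · exact ⟨u, by simp, h1⟩
    · by_cases hx : ∃ x ∈ Φ, H.Adj v x ∧ lab x = lab u
      · exact ⟨v, by simp, h2 u hu hx⟩
      · obtain ⟨z, hz, hzu⟩ := h.exists_eq u hu
        exact ⟨z, by simp [hz], (h3 u hu hx).trans hzu⟩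
  · by_cases hav : lab' a = v + 1
    · exact (hreach a ha hav).trans (hreach b hb (he ▸ hav)).symm
    · have key : ∀ u ∈ insert v Φ, lab' u ≠ v + 1 → u ∈ Φ ∧ lab' u = lab u := by
        intro u hu hne
        rcases Finset.mem_insert.1 hu with rfl | hu
        · exact absurd h1 hne
        · exact ⟨hu, h3 u hu fun hx => hne (h2 u hu hx)⟩
      obtain ⟨ha', ha⟩ := key a ha hav
      obtain ⟨hb', hb⟩ := key b hb (he ▸ hav)
      rw [ha, hb] at he
      exact ((h.eq_iff a ha' b hb').1 he).mono hmono
  · obtain ⟨p⟩ := hr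
    clear ha hb
    induction p with
    | nil => rfl
    | cons hab _ ih => exact (hadj _ _ hab).trans ih

/-- The labels of the neighbours of `v` in the forest are marked, and register `11` tells whether two
of these neighbours have the same label. -/
theorem scan_runs [DecidableRel H.Adj] (hB : 4 * (n * n) + 20 ≤ B) {σ : State}
    (hin : HasInput H s t σ) {Φ : Finset (Fin n)} {lab : Fin n → ℕ} (hlab : IsLabelling H Φ lab)
    (h12 : ∀ u : Fin n, σ.cell 12 u = lab u) {i : ℕ} (hi : i < n) (hmark : ∀ a, σ.cell 13 a ≤ i)
    (h6 : σ.reg 6 = i) {v : Fin n} (h9 : σ.reg 9 = v) (h11 : σ.reg 11 = 0) :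
    Runs B (forUp 7 scanBody) σ (n * 58 + 6) fun τ =>
      (∀ a, τ.cell 13 a ≤ i + 1) ∧
      (∀ a, τ.cell 13 a = i + 1 ↔ ∃ x ∈ Φ, H.Adj v x ∧ lab x = a) ∧
      τ.reg 11 ≤ 1 ∧ (τ.reg 11 ≠ 0 ↔ Conflict H Φ v) := by
  have hnn := le_mul_self_of_fin s
  have h1B : 1 < B := by omega
  have h0B : 0 < B := by omega
  have hnB : n < B := by omega
  have hiB : i < B := by omega
  have hi1B : i + 1 < B := by omega
  have hite := fun P [Decidable P] => ite_one_zero_lt h1B P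
  have hvB : ∀ v : Fin n, (v : ℕ) < B := fun v => v.2.trans hnB
  have hlabB : ∀ v : Fin n, lab v < B := fun v => (hlab.le v).trans_lt hnB
  let I : ℕ → State → Prop := fun j τ =>
    (∀ a, τ.cell 13 a ≤ i + 1) ∧
    (∀ a, τ.cell 13 a = i + 1 ↔ ∃ x ∈ Φ, (x : ℕ) < j ∧ H.Adj v x ∧ lab x = a) ∧
    τ.reg 11 ≤ 1 ∧ (τ.reg 11 ≠ 0 ↔
      ∃ y ∈ Φ, (y : ℕ) < j ∧ H.Adj v y ∧ ∃ x ∈ Φ, (x : ℕ) < y ∧ H.Adj v x ∧ lab x = lab y)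
  refine (Runs.forUp (c := 50) I hin.reg0 (by omega) rfl rfl (by decide)
    (fun _ _ _ h => by simpa [I] using h) ⟨fun a => (hmark a).trans (Nat.le_succ i), fun a => ?_,
      by simp [h11], by simp [h11]⟩ ?_).mono (by omega) ?_
  · have := hmark a
    simp
    omega
  · rintro j hj υ hυ h7 ⟨hm, hmi, hr, hri⟩
    obtain ⟨u, rfl⟩ : ∃ u : Fin n, (u : ℕ) = j := ⟨⟨j, hj⟩, rfl⟩
    have hr0 : υ.reg 0 = n := (hυ.reg 0 rfl).trans hin.reg0
    have hr6 : υ.reg 6 = i := (hυ.reg 6 rfl).trans h6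
    have hr9 : υ.reg 9 = v := (hυ.reg 9 rfl).trans h9
    have hc0 : υ.cell 0 = σ.cell 0 := hυ.cell 0 rfl
    have hc12 : υ.cell 12 = σ.cell 12 := hυ.cell 12 rfl
    have hmul := mul_add_lt v u
    have hB1 : (v : ℕ) * n < B := by omega
    have hB2 : (v : ℕ) * n + u < B := by omega
    have hB3 : ∀ a, υ.cell 13 a < B := fun a => by have := hm a; omega
    have hu0 := hlab.ne_zero_iff u
    have hrec : ∀ {p : Fin n → Prop}, (∃ x ∈ Φ, (x : ℕ) < u + 1 ∧ p x) ↔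
        (∃ x ∈ Φ, (x : ℕ) < u ∧ p x) ∨ (u ∈ Φ ∧ p u) := by
      intro p
      constructor
      · rintro ⟨x, hx, hlt, hp⟩
        rcases Nat.lt_succ_iff_lt_or_eq.1 hlt with h | h
        · exact Or.inl ⟨x, hx, h, hp⟩
        · obtain rfl := Fin.ext h
          exact Or.inr ⟨hx, hp⟩
      · rintro (⟨x, hx, hlt, hp⟩ | ⟨hx, hp⟩)
        · exact ⟨x, hx, by omega, hp⟩
        · exact ⟨u, hx, by omega, hp⟩
    -- the case that `u` is no neighbour of `v` in the forest
    have hkeep : ∀ τ : State, τ.cell 13 = υ.cell 13 → τ.reg 11 = υ.reg 11 →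
        ¬(u ∈ Φ ∧ H.Adj v u) → I (u + 1) τ := by
      intro τ h1 h2 h3
      refine ⟨by rwa [h1], fun a => ?_, by rwa [h2], ?_⟩
      · rw [h1, hmi, hrec, or_iff_left fun h => h3 ⟨h.1, h.2.1⟩]
      · rw [h2, hri, hrec, or_iff_left fun h => h3 ⟨h.1, h.2.1⟩]
    refine (Runs.of_wp (p := scanBody) ?_).mono (by decide) fun _ h => h
    by_cases huΦ : u ∈ Φ
    · have hl0 : lab u ≠ 0 := hu0.2 huΦ
      by_cases hA : H.Adj v u
      · simp [scanBody, h7, hr0, hr6, hr9, hc0, hc12, h12, hl0, hA, hin.adj, hvB, h1B, h0B, hnB, hB1,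
          hB2, hB3, hlabB, hiB, hi1B, hite]
        refine ⟨fun he => ⟨?_, fun a => ?_, ?_, ?_⟩, fun hne => ⟨fun a => ?_, fun a => ?_, ?_, ?_⟩⟩
        · simpa using hm
        · have := (hmi (lab u)).1 he
          simp only [State.setReg_cell, hmi, hrec]
          grind
        · simp
        · have := (hmi (lab u)).1 he
          rw [hrec]
          simp only [State.setReg_reg, if_true, ne_eq, one_ne_zero, not_false_eq_true, true_iff]
          exact Or.inr ⟨huΦ, hA, this⟩
        · simp [Function.update_apply]
          split_ifs
          · exact le_rfl
          · exact hm a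
        · rw [hrec, ← hmi]
          simp [Function.update_apply]
          grind
        · simpa using hr
        · rw [hrec, ← hri]
          rw [hmi] at hne
          simp [hne]
          exact fun _ _ x hx hlt h1 h2 => absurd ⟨x, hx, hlt, h1, h2⟩ hne
      · simp [scanBody, h7, hr0, hr6, hr9, hc0, hc12, h12, hl0, hA, hin.adj, hvB, h1B, h0B, hnB, hB1,
          hB2, hB3, hlabB, hiB, hi1B, hite]
        exact hkeep _ rfl rfl fun h => hA h.2
    · have hl0 : lab u = 0 := hlab.eq_zero u huΦ
      simp [scanBody, h7, hc12, h12, hl0, hvB, h0B]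
      exact hkeep _ rfl rfl fun h => huΦ h.1
  · rintro τ ⟨hm, hmi, hr, hri⟩
    refine ⟨hm, fun a => ?_, hr, ?_⟩
    · simp [hmi]
    · rw [hri, hlab.conflict_iff]
      simp only [Fin.is_lt, true_and, Fin.val_fin_lt]
      grind

theorem merge_runs (hB : 4 * (n * n) + 20 ≤ B) {σ : State} (hn : σ.reg 0 = n) {Φ : Finset (Fin n)}
    {lab : Fin n → ℕ} (hlab : IsLabelling H Φ lab) (h12 : ∀ u : Fin n, σ.cell 12 u = lab u) {i : ℕ}
    (hi : i < n) {v : Fin n} (hv : v ∉ Φ) (hmark : ∀ a, σ.cell 13 a ≤ i + 1)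
    (hmarked : ∀ a, σ.cell 13 a = i + 1 ↔ ∃ x ∈ Φ, H.Adj v x ∧ lab x = a) (h6 : σ.reg 6 = i)
    (h9 : σ.reg 9 = v) :
    Runs B (forUp 7 mergeBody ⨾ .write 12 (reg 9) (reg 9 +ₑ lit 1)) σ (n * 58 + 20) fun τ =>
      ∃ lab', IsLabelling H (insert v Φ) lab' ∧ ∀ u : Fin n, τ.cell 12 u = lab' u := by
  have hnn := le_mul_self_of_fin v
  have h1B : 1 < B := by omega
  have h0B : 0 < B := by omega
  have hnB : n < B := by omega
  have hiB : i < B := by omega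
  have hi1B : i + 1 < B := by omega
  have hite := fun P [Decidable P] => ite_one_zero_lt h1B P
  have hvB : ∀ v : Fin n, (v : ℕ) < B := fun v => v.2.trans hnB
  have hvB1 : ∀ v : Fin n, (v : ℕ) + 1 < B := fun v => by have := v.2; omega
  have hlabB : ∀ v : Fin n, lab v < B := fun v => (hlab.le v).trans_lt hnB
  have hmarkB : ∀ a, σ.cell 13 a < B := fun a => by have := hmark a; omega
  let I : ℕ → State → Prop := fun j τ => ∀ u : Fin n, τ.cell 12 u =
    if (u : ℕ) < j ∧ u ∈ Φ ∧ σ.cell 13 (lab u) = i + 1 then (v : ℕ) + 1 else lab u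
  refine (Runs.seq (Runs.forUp (c := 50) I hn (by omega) rfl rfl (by decide) (fun _ _ _ h => h)
    (by simpa [I] using h12) ?_) (d := 10) fun τ hτ hI => ?_).mono (by omega) fun _ h => h
  · rintro j hj υ hυ h7 hI
    obtain ⟨u, rfl⟩ : ∃ u : Fin n, (u : ℕ) = j := ⟨⟨j, hj⟩, rfl⟩
    have hr6 : υ.reg 6 = i := (hυ.reg 6 rfl).trans h6
    have hr9 : υ.reg 9 = v := (hυ.reg 9 rfl).trans h9
    have hc13 : υ.cell 13 = σ.cell 13 := hυ.cell 13 rfl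
    have hu0 := hlab.ne_zero_iff u
    have hIu : υ.cell 12 u = lab u := by simpa using hI u
    refine (Runs.of_wp (p := mergeBody) ?_).mono (by decide) fun _ h => h
    by_cases hl0 : lab u = 0
    · have huΦ : u ∉ Φ := fun h => hu0.2 h hl0
      simp [mergeBody, h7, hIu, hl0, hvB, h0B]
      intro x
      have := hI x
      grind
    · by_cases hm : σ.cell 13 (lab u) = i + 1
      · simp [mergeBody, h7, hIu, hl0, hvB, hvB1, h0B, h1B, hr6, hr9, hc13, hm, hiB, hi1B, hlabB, hite]
        intro x
        have := hI x
        simp [Function.update_apply, Fin.val_inj]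
        grind
      · simp [mergeBody, h7, hIu, hl0, hvB, h0B, h1B, hr6, hr9, hc13, hm, hiB, hi1B, hlabB, hmarkB,
          hite]
        intro x
        have := hI x
        grind
  · have hr9 : τ.reg 9 = v := (hτ.reg 9 rfl).trans h9
    refine (Runs.of_wp ?_).mono (by decide) fun _ h => h
    simp [hr9, hvB, hvB1, h1B]
    refine ⟨fun u => if u = v ∨ (u ∈ Φ ∧ σ.cell 13 (lab u) = i + 1) then v + 1 else lab u,
      hlab.insert_vertex hv (by simp) (fun u hu hx => ?_) (fun u hu hx => ?_) fun u hu huv => ?_,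
      fun u => ?_⟩
    · simp [hu, (hmarked (lab u)).2 hx]
    · have huv : u ≠ v := by rintro rfl; exact hv hu
      rw [if_neg]
      rintro (h | h)
      · exact huv h
      · exact hx ((hmarked _).1 h.2)
    · simp [hu, huv, hlab.eq_zero u hu]
    · have := hI u
      simp [Function.update_apply, Fin.val_inj]
      grind

theorem forest_runs [DecidableRel H.Adj] (hB : 4 * (n * n) + 20 ≤ B) {σ : State}
    (hin : HasInput H s t σ) {L : List (Fin n)} (hL : L.Nodup) (hlen : L.length = n)
    (h11 : ∀ k (hk : k < L.length), σ.cell 11 k = L[k]) (h12 : ∀ u : Fin n, σ.cell 12 u = 0)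
    (h13 : ∀ a, σ.cell 13 a = 0) :
    Runs B forest σ (300 * (n * n)) fun τ =>
      ∀ u : Fin n, τ.cell 12 u < B ∧ (τ.cell 12 u ≠ 0 ↔ u ∈ greedyForest H L) := by
  have hnn := le_mul_self_of_fin s
  have hn0 := s.pos
  have h1B : 1 < B := by omega
  have h0B : 0 < B := by omega
  have hnB : n < B := by omega
  have hvB : ∀ v : Fin n, (v : ℕ) < B := fun v => v.2.trans hnB
  -- the list is treated from its end
  let I : ℕ → State → Prop := fun i τ => ∃ lab, IsLabelling H (greedyForest H (L.drop (n - i))) lab ∧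
    (∀ u : Fin n, τ.cell 12 u = lab u) ∧ ∀ a, τ.cell 13 a ≤ i
  refine (Runs.forUp (c := 20 + ((n * 58 + 6) + (2 + max 1 (n * 58 + 20)))) I hin.reg0 (by omega)
    rfl rfl (by decide) (fun _ _ _ h => h) ⟨fun _ => 0, ?_, h12, fun a => (h13 a).le⟩ ?_).mono ?_ ?_
  · have hnil : L.drop (n - 0) = [] := List.drop_eq_nil_of_le (by omega)
    rw [hnil]
    exact ⟨fun _ _ => rfl, by simp [greedyForest], by simp [greedyForest]⟩
  · rintro i hi υ hυ h6 ⟨lab, hlab, hc12, hc13⟩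
    have hin₁ := hin.of_frame hυ rfl rfl rfl rfl
    have hk : n - 1 - i < L.length := by omega
    obtain ⟨v, hv⟩ : ∃ v, v = L[n - 1 - i] := ⟨_, rfl⟩
    have hdrop : L.drop (n - (i + 1)) = v :: L.drop (n - i) := by
      have h1 : n - (i + 1) = n - 1 - i := by omega
      have h2 : n - i = n - 1 - i + 1 := by omega
      rw [h1, h2, hv, List.drop_eq_getElem_cons hk]
    have hread : υ.cell 11 (n - 1 - i) = v := by
      rw [hυ.cell 11 rfl, h11 _ hk, hv]
    have hvΦ : v ∉ greedyForest H (L.drop (n - i)) := fun h => by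
      have h1 := hL.sublist (List.drop_sublist (n - (i + 1)) L)
      rw [hdrop] at h1
      exact (List.nodup_cons.1 h1).1 (mem_of_mem_greedyForest h)
    have hpos : Conflict H (greedyForest H (L.drop (n - i))) v →
        greedyForest H (L.drop (n - (i + 1))) = greedyForest H (L.drop (n - i)) := fun h => by
      rw [hdrop, greedyForest, if_pos h]
    have hneg : ¬ Conflict H (greedyForest H (L.drop (n - i))) v →
        greedyForest H (L.drop (n - (i + 1))) = insert v (greedyForest H (L.drop (n - i))) :=
      fun h => by
        rw [hdrop, greedyForest, if_neg h]
    refine Runs.seq (c := 20) (R := fun τ => τ.reg 9 = v ∧ τ.reg 11 = 0) ?_ fun τ hτ hR => ?_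
    · refine (Runs.of_wp ?_).mono (by decide) fun _ h => h
      have hB1 : n - 1 < B := by omega
      have hB2 : n - 1 - i < B := by omega
      have hB3 : i < B := by omega
      simp [hin₁.reg0, h6, hread, hnB, h1B, h0B, hB1, hB2, hB3, hvB]
    · have hin₂ := hin₁.of_frame hτ rfl rfl rfl rfl
      have h6₂ : τ.reg 6 = i := (hτ.reg 6 rfl).trans h6
      have c12 : ∀ u : Fin n, τ.cell 12 u = lab u := by rwa [hτ.cell 12 rfl]
      have c13 : ∀ a, τ.cell 13 a ≤ i := by rwa [hτ.cell 13 rfl]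
      refine (scan_runs hB hin₂ hlab c12 hi c13 h6₂ hR.1 hR.2).seq fun ω hω ⟨m1, m2, m3, m4⟩ => ?_
      have c12' : ∀ u : Fin n, ω.cell 12 u = lab u := by rwa [hω.cell 12 rfl]
      refine Runs.ite (by simp; omega) (fun h11 => ?_) fun h11 => ?_
      · refine Runs.of_wp (p := .skip) ?_
        rw [wp_skip]
        rw [eval_reg, m4] at h11
        exact ⟨lab, by rwa [hpos h11], c12', m1⟩
      · have hnc : ¬ Conflict H (greedyForest H (L.drop (n - i))) v := by
          rw [← m4]
          simpa using h11
        refine (merge_runs hB ((hω.reg 0 rfl).trans hin₂.reg0) hlab c12' hi hvΦ m1 m2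
          ((hω.reg 6 rfl).trans h6₂) ((hω.reg 9 rfl).trans hR.1)).frame.mono le_rfl ?_
        rintro ρ ⟨hρ, lab', hlab', hl⟩
        exact ⟨lab', by rwa [hneg hnc], hl, by rwa [hρ.cell 13 rfl]⟩
  · have h1 : max 1 (n * 58 + 20) = n * 58 + 20 := by omega
    rw [h1]
    have : n * (20 + ((n * 58 + 6) + (2 + (n * 58 + 20))) + 8) = 116 * (n * n) + 56 * n := by ring
    omega
  · rintro τ ⟨lab, hlab, hl, -⟩ u
    rw [Nat.sub_self, List.drop_zero] at hlab
    rw [hl]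
    exact ⟨(hlab.le u).trans_lt hnB, hlab.ne_zero_iff u⟩

end

/-! ### The program: output -/

/-- Vertices that are not in the forest, and their neighbours, are put into the output. -/
def output : Prog :=
  forUp 6 (.ite (read 12 (reg 6)) .skip
    (.write 1 (reg 6) (lit 1) ⨾
      forUp 7 (.ite (read 0 (reg 6 *ₑ reg 0 +ₑ reg 7)) (.write 1 (reg 7) (lit 1)) .skip)))

/-- The whole algorithm. -/
def program : Prog :=
  .ite (reg 1 =ₑ reg 2) .skip (dfs ⨾ mark ⨾ restrict ⨾ elim ⨾ forest ⨾ output)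

section

variable {n B : ℕ} {s t : Fin n}

theorem output_runs {H : SimpleGraph (Fin n)} [DecidableRel H.Adj] (hB : 4 * (n * n) + 20 ≤ B)
    {σ : State} (hin : HasInput H s t σ) {Φ : Finset (Fin n)}
    (h12 : ∀ u : Fin n, σ.cell 12 u < B ∧ (σ.cell 12 u ≠ 0 ↔ u ∈ Φ))
    (h1 : ∀ u : Fin n, σ.cell 1 u = 0) :
    Runs B output σ (200 * (n * n)) fun τ =>
      ∀ u : Fin n, τ.cell 1 u ≠ 0 ↔ u ∉ Φ ∨ ∃ x, x ∉ Φ ∧ H.Adj x u := by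
  have hnn := le_mul_self_of_fin s
  have hn0 := s.pos
  have h1B : 1 < B := by omega
  have h0B : 0 < B := by omega
  have hnB : n < B := by omega
  have hvB : ∀ v : Fin n, (v : ℕ) < B := fun v => v.2.trans hnB
  let I : ℕ → State → Prop := fun i τ => ∀ u : Fin n, τ.cell 1 u ≠ 0 ↔
    ∃ x, x ∉ Φ ∧ (x : ℕ) < i ∧ (u = x ∨ H.Adj x u)
  refine (Runs.forUp (c := 3 + max 1 (10 + (n * 38 + 6))) I hin.reg0 (by omega) rfl rfl (by decide)
    (fun _ _ _ h => h) (by simpa [I] using h1) ?_).mono ?_ ?_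
  · rintro i hi υ hυ h6 hI
    obtain ⟨x, rfl⟩ : ∃ x : Fin n, (x : ℕ) = i := ⟨⟨i, hi⟩, rfl⟩
    have hin₁ := hin.of_frame hυ rfl rfl rfl rfl
    have c12 : υ.cell 12 = σ.cell 12 := hυ.cell 12 rfl
    refine Runs.ite (by simpa [h6, c12, hvB] using (h12 x).1) (fun he => ?_) fun he => ?_
    · have hx : x ∈ Φ := (h12 x).2.1 (by simpa [h6, c12] using he)
      refine Runs.of_wp (p := .skip) ?_
      rw [wp_skip]
      intro u
      rw [hI u]
      refine exists_congr fun y => and_congr_right fun hy => and_congr_left fun _ => ?_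
      have : (y : ℕ) ≠ x := fun h => hy (Fin.ext h ▸ hx)
      omega
    · have hx : x ∉ Φ := fun h => (h12 x).2.2 h (by simpa [h6, c12] using he)
      let J : ℕ → State → Prop := fun j τ => ∀ u : Fin n, τ.cell 1 u ≠ 0 ↔
        υ.cell 1 u ≠ 0 ∨ u = x ∨ ((u : ℕ) < j ∧ H.Adj x u)
      refine Runs.seq (c := 10) (R := J 0) ?_ fun τ hτ hJ => ?_
      · refine (Runs.of_wp ?_).mono (by decide) fun _ h => h
        simp [h6, hvB, h1B]
        intro u
        simp [Function.update_apply, Fin.val_inj]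
        grind
      · have hin₂ := hin₁.of_frame hτ rfl rfl rfl rfl
        refine (Runs.forUp (c := 30) J hin₂.reg0 (by omega) rfl rfl (by decide) (fun _ _ _ h => h)
          hJ ?_).mono le_rfl fun ω hω u => ?_
        · rintro j hj ω hω h7 hJ
          obtain ⟨y, rfl⟩ : ∃ y : Fin n, (y : ℕ) = j := ⟨⟨j, hj⟩, rfl⟩
          have hin₃ := hin₂.of_frame hω rfl rfl rfl rfl
          have h6' : ω.reg 6 = x := (hω.reg 6 rfl).trans ((hτ.reg 6 rfl).trans h6)
          have hmul := mul_add_lt x y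
          have hB1 : (x : ℕ) * n < B := by omega
          have hB2 : (x : ℕ) * n + y < B := by omega
          refine (Runs.of_wp ?_).mono (by decide) fun _ h => h
          by_cases hA : H.Adj x y
          · simp [h6', h7, hin₃.reg0, hin₃.adj, hvB, hnB, hB1, hB2, h1B, hA]
            intro u
            have := hJ u
            simp [Function.update_apply, Fin.val_inj]
            grind
          · simp [h6', h7, hin₃.reg0, hin₃.adj, hvB, hnB, hB1, hB2, h0B, hA]
            intro u
            have hlt : (u : ℕ) < y + 1 ∧ H.Adj x u ↔ (u : ℕ) < y ∧ H.Adj x u := by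
              refine and_congr_left fun h => ?_
              have : (u : ℕ) ≠ y := fun he => hA (Fin.ext he ▸ h)
              omega
            rw [hJ u, hlt]
        · rw [hω u, hI u]
          constructor
          · rintro (⟨z, hz, hlt, h⟩ | h | h)
            · exact ⟨z, hz, by omega, h⟩
            · exact ⟨x, hx, by omega, Or.inl h⟩
            · exact ⟨x, hx, by omega, Or.inr h.2⟩
          · rintro ⟨z, hz, hlt, h⟩
            rcases Nat.lt_succ_iff_lt_or_eq.1 hlt with hlt | heq
            · exact Or.inl ⟨z, hz, hlt, h⟩
            · obtain rfl := Fin.ext heq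
              exact Or.inr (h.imp id fun h => ⟨u.2, h⟩)
  · have h1 : max 1 (10 + (n * 38 + 6)) = n * 38 + 16 := by omega
    rw [h1]
    have : n * (3 + (n * 38 + 16) + 8) = 38 * (n * n) + 27 * n := by ring
    omega
  · intro τ hτ u
    rw [hτ u]
    constructor
    · rintro ⟨x, hx, -, rfl | h⟩
      · exact Or.inl hx
      · exact Or.inr ⟨x, hx, h⟩
    · rintro (h | ⟨x, hx, h⟩)
      · exact ⟨u, h, u.2, Or.inl rfl⟩
      · exact ⟨x, hx, x.2, Or.inr h⟩

/-! ### The algorithm -/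

/-- The greedy forest of the reduced graph leaves a 2-approximate feedback vertex set. -/
theorem isTwoApproxFVS_compl_greedyForest {V : Type*} [Fintype V] [DecidableEq V]
    {G : SimpleGraph V} {H : G.Subgraph} {L : List V}
    (h : Elim H.spanningCoe (Fintype.card V) Finset.univ
      (fun _ => Fintype.card V * Fintype.card V + 1) L) :
    IsTwoApproxFVS H (Finset.univ \ greedyForest H.spanningCoe L) := by
  refine ⟨(isFVS_iff _ _).2 ⟨fun v hv => ?_, ?_⟩, fun S' hS' => ?_⟩
  · have hv' : v ∉ greedyForest H.spanningCoe L := by simpa using hv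
    obtain ⟨x, -, -, -, -, hvx, -⟩ :=
      conflict_of_notMem_greedyForest ((h.mem_iff v).2 (Finset.mem_univ v)) hv'
    exact H.edge_vert hvx
  · have : ((Finset.univ \ greedyForest H.spanningCoe L : Finset V) : Set V)ᶜ =
        greedyForest H.spanningCoe L := by
      ext
      simp
    rw [this]
    exact isAcyclic_within_greedyForest L
  · exact h.card_compl_greedyForest_le (Nat.lt_succ_self _) ((isFVS_iff _ _).1 hS').2

theorem hasInput_inputState (G : SimpleGraph (Fin n)) [DecidableRel G.Adj] (s t : Fin n) :
    HasInput G s t (inputState G s t) where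
  reg0 := rfl
  reg1 := rfl
  reg2 := rfl
  adj u v := by
    have : (∃ i j : Fin n, (u : ℕ) * n + v = i * n + j ∧ G.Adj i j) ↔ G.Adj u v := by
      simp only [addr_inj]
      constructor
      · rintro ⟨i, j, ⟨rfl, rfl⟩, h⟩
        exact h
      · exact fun h => ⟨u, v, ⟨rfl, rfl⟩, h⟩
    simp [inputState, this]

theorem reducedGraph_self_adj {V : Type*} (G : SimpleGraph V) (s a b : V) :
    ¬ (reducedGraph G s s).Adj a b := by
  rintro ⟨p, hp⟩
  rw [p.loop_eq] at hp
  simp at hp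

theorem program_runs (G : SimpleGraph (Fin n)) [DecidableRel G.Adj] (s t : Fin n)
    (hB : 4 * (n * n) + 20 ≤ B) :
    Runs B program (inputState G s t) (2000 * (n * n)) fun τ =>
      ∃ S : Finset (Fin n), IsTwoApproxFVS (reducedGraph G s t) S ∧
        outputSet n τ = withNeighbors (reducedGraph G s t) S := by
  have hnn := le_mul_self_of_fin s
  have hn0 := s.pos
  have h1B : 1 < B := by omega
  have hnB : n < B := by omega
  have hvB : ∀ v : Fin n, (v : ℕ) < B := fun v => v.2.trans hnB
  have hin := hasInput_inputState G s t
  have hzero : ∀ b, b ≠ 0 → (inputState G s t).cell b = fun _ => 0 := by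
    intro b hb
    funext a
    simp [inputState, hb]
  have hite := fun P [Decidable P] => ite_one_zero_lt h1B P
  refine (Runs.ite (c := 1) (d := 300 * (n * n) + (200 * (n * n) + (200 * (n * n) +
    (300 * (n * n) + (300 * (n * n) + 200 * (n * n)))))) ?_ (fun he => ?_) fun he => ?_).mono
    (c' := 2000 * (n * n)) ?_ fun _ h => h
  · simp [hin.reg1, hin.reg2, hvB, hite]
  · have hst : s = t := by
      by_contra hne
      simp [hin.reg1, hin.reg2, Fin.val_inj, hne] at he
    subst hst
    refine Runs.of_wp (p := .skip) ?_
    rw [wp_skip]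
    refine ⟨∅, ⟨(isFVS_iff _ _).2 ⟨by simp, ?_⟩, by simp⟩, ?_⟩
    · refine isAcyclic_bot.anti fun a b hab => ?_
      exact (reducedGraph_self_adj G s a b hab.1).elim
    · ext v
      simp [outputSet, hzero, withNeighbors]
  · have hst : s ≠ t := by
      rintro rfl
      simp [hin.reg1, hin.reg2] at he
    classical
    refine (dfs_runs hB hst hin hzero).seq fun τ₁ f₁ ⟨cnt, num, low, ptr, par, hrep, htree⟩ => ?_
    have hin₁ := hin.of_frame f₁ rfl rfl rfl rfl
    refine (mark_runs hB hst hin₁ hrep htree (by simp [f₁.cell 7 rfl, hzero])).seq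
      fun τ₂ f₂ ⟨K, hK, hsK, htK, hKnum, hiff⟩ => ?_
    have hin₂ := hin₁.of_frame f₂ rfl rfl rfl rfl
    have hH : ∀ u v, (reducedGraph G s t).spanningCoe.Adj u v ↔ G.Adj u v ∧ u ∈ K ∧ v ∈ K :=
      fun u v => htree.reducedGraph_adj_iff (B := (K : Set (Fin n))) hiff hsK htK hKnum
    refine (restrict_runs hB hin₂ hH hK (by simp [f₂.cell 8 rfl, f₁.cell 8 rfl, hzero])).seq
      fun τ₃ f₃ ⟨hin₃, hdeg⟩ => ?_
    refine (elim_runs hB hin₃ hdeg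
      (by simp [f₃.cell 10 rfl, f₂.cell 10 rfl, f₁.cell 10 rfl, hzero])).seq
      fun τ₄ f₄ ⟨L, hL, hlen, hord⟩ => ?_
    have hin₄ := hin₃.of_frame f₄ rfl rfl rfl rfl
    refine (forest_runs hB hin₄ hL.nodup hlen hord
      (by simp [f₄.cell 12 rfl, f₃.cell 12 rfl, f₂.cell 12 rfl, f₁.cell 12 rfl, hzero])
      (by simp [f₄.cell 13 rfl, f₃.cell 13 rfl, f₂.cell 13 rfl, f₁.cell 13 rfl, hzero])).seq
      fun τ₅ f₅ hΦ => ?_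
    have hin₅ := hin₄.of_frame f₅ rfl rfl rfl rfl
    refine (output_runs hB hin₅ hΦ (by simp [f₅.cell 1 rfl, f₄.cell 1 rfl, f₃.cell 1 rfl,
      f₂.cell 1 rfl, f₁.cell 1 rfl, hzero])).mono le_rfl fun τ₆ hout => ?_
    refine ⟨_, isTwoApproxFVS_compl_greedyForest (L := L) (by simpa using hL), ?_⟩
    ext v
    simp [outputSet, withNeighbors, hout v]
  · simp only [Expr.cost]
    have : 0 < n * n := Nat.mul_pos hn0 hn0
    omega

end

end Tracking

theorem mainTheorem5 :
    -- in the reduced graph every tracking set is a feedback vertex set, and any 2-approximate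
    -- feedback vertex set with its neighbours is a 2(δ+1)-approximate tracking set
    (∀ (n : ℕ) (G : SimpleGraph (Fin n)) [DecidableRel G.Adj] (s t : Fin n),
      (∀ T : Finset (Fin n), Tracking.IsTrackingSet G s t T →
        (T : Set (Fin n)) ⊆ (Tracking.reducedGraph G s t).verts →
        Tracking.IsFVS (Tracking.reducedGraph G s t) T) ∧
      (∀ S : Finset (Fin n), Tracking.IsTwoApproxFVS (Tracking.reducedGraph G s t) S →
        Tracking.IsApproxTrackingSet G s t (2 * (G.maxDegree + 1))
          (Tracking.withNeighbors (Tracking.reducedGraph G s t) S))) ∧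
    -- one program does this in O(n ^ 2) steps on words of O(log n) bits
    (∃ (P : Ram.Prog) (c k : ℕ),
      ∀ (n : ℕ) (G : SimpleGraph (Fin n)) [DecidableRel G.Adj] (s t : Fin n),
        ∃ (m : ℕ) (σ : Ram.State),
          Ram.Exec (c * n ^ k) P (Tracking.inputState G s t) m σ ∧
          m ≤ c * n ^ 2 ∧
          Tracking.IsApproxTrackingSet G s t (2 * (G.maxDegree + 1)) (Tracking.outputSet n σ) ∧
          ∃ S : Finset (Fin n), Tracking.IsTwoApproxFVS (Tracking.reducedGraph G s t) S ∧
            Tracking.outputSet n σ =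
              Tracking.withNeighbors (Tracking.reducedGraph G s t) S) := by
  refine ⟨fun n G _ s t => ⟨fun T hT hv => hT.isFVS hv,
    fun S hS => hS.isApproxTrackingSet_withNeighbors⟩,
    Tracking.program, 2000, 2, fun n G _ s t => ?_⟩
  have hn : 0 < n * n := Nat.mul_pos s.pos s.pos
  obtain ⟨m, σ, he, hm, S, hS, hout⟩ :=
    Tracking.program_runs (B := 2000 * n ^ 2) G s t (by rw [pow_two]; omega)
  refine ⟨m, σ, he, by rwa [pow_two], ?_, S, hS, hout⟩
  rw [hout]
  exact hS.isApproxTrackingSet_withNeighbors
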